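/- **The calculus.** $\mathsf{HC}_0$ has core types $A ::= \alpha \mid I \mid A\otimes B$ and host types $X ::= \beta \mid 1 \mid X\times Y \mid X\to Y \mid \mathtt{Proof}(A,B)$, where $\alpha,\beta$ are base types and $A,B$ are core types. Host terms $\Gamma\vdash t:X$ are those of the simply typed $\lambda$-calculus with $1,\times,\to$, together with $\mathtt{promote}(f):\mathtt{Proof}(A_1\otimes\cdots\otimes A_n,A)$ whenever $\Gamma\mid a_1:A_1,\dots,a_n:A_n\vdash f:A$. Core terms $\Gamma\mid\Omega\vdash f:A$ are linear in $\Omega$ (core contexts are used up to permutation) and are built from variables, $\bullet:I$, $f\otimes g$, $\mathsf{let}\ f\ \mathsf{be}\ a\otimes b\ \mathsf{in}\ h$, $\mathsf{let}\ f\ \mathsf{be}\ \bullet\ \mathsf{in}\ h$, and $\Gamma\mid a:A\vdash\mathtt{derelict}(t):B$ for $\Gamma\vdash t:\mathtt{Proof}(A,B)$, closed under substitution for $a$. A theory $T$ extends $\mathsf{HC}_0$ by base types, type equality axioms, typed term symbols, and axioms that are equations between host terms in context or core terms in mixed context. Equal types have the same terms, and type equality is a congruence for all type constructors. Derivable equality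 of terms is the least congruence closed under substitution that contains the axioms of $T$ and - the $\beta$- and $\eta$-rules for $1,\times,\to$; - $\mathsf{let}\ g\otimes h\ \mathsf{be}\ a\otimes b\ \mathsf{in}\ f=f[g/a,h/b]$ and $\mathsf{let}\ g\ \mathsf{be}\ a\otimes b\ \mathsf{in}\ f[a\otimes b/c]=f[g/c]$; - $\mathsf{let}\ \bullet\ \mathsf{be}\ \bullet\ \mathsf{in}\ f=f$ and $\mathsf{let}\ g\ \mathsf{be}\ \bullet\ \mathsf{in}\ f[\bullet/a]=f[g/a]$; - $\mathtt{derelict}(\mathtt{promote}(f))[a_1\otimes\cdots\otimes a_n/\omega]=f$ and $\mathtt{promote}(\mathtt{derelict}(t))=t$. **Models.** Let $\mathcal H$ be a cartesian closed category and $\mathcal C$ an $\mathcal H$-enriched symmetric monoidal category. A structure for $T$ in $(\mathcal H,\mathcal C)$ assigns objects of $\mathcal H$ to host types and objects of $\mathcal C$ to core types, equal types having equal interpretations, with $[\![1]\!]=1$, $[\![X\times Y]\!]=[\![X]\!]\times[\![Y]\!]$, $[\![X\to Y]\!]=[\![X]\!]\to[\![Y]\!]$, $[\![\mathtt{Proof}(A,B)]\!]=\mathcal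 C([\![A]\!],[\![B]\!])$, $[\![I]\!]=I$, $[\![A\otimes B]\!]=[\![A]\!]\otimes[\![B]\!]$, and suitable morphisms of $\mathcal H$ to the term symbols. It interprets host terms $\Gamma\vdash t:X$ by morphisms $[\![\Gamma]\!]\to[\![X]\!]$ of $\mathcal H$ and core terms $\Gamma\mid\Omega\vdash f:A$ by morphisms $[\![\Gamma]\!]\to\mathcal C([\![\Omega]\!],[\![A]\!])$ of $\mathcal H$, by induction on terms in the usual way; $\mathtt{promote}$ and $\mathtt{derelict}$ are interpreted by the identity. It is a model of $T$ if it satisfies the equational axioms of $T$ (for $\mathsf{HC}_0$ itself there are none). **Theorem (Soundness and completeness).** Let $T$ be a theory. 1. (Soundness) Every host equation $\Gamma\vdash s=t:X$ and every core equation $\Gamma\mid\Omega\vdash f=g:A$ that is derivable in $T$ holds in every model of $T$ in every pair $(\mathcal H,\mathcal C)$. 2. (Completeness) Every host or core equation that holds in all models of $T$ is derivable in $T$. 3. (Syntactic model) There is a pair $(\mathcal H_T,\mathcal C_T)$ as follows. The objects of $\mathcal H_T$ are the host types modulo derivable equality, its morphisms $X\to Y$ are the terms $x:X\vdash t:Y$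 modulo derivable equality, composition is substitution, and the cartesian closed structure is given by $1$, $X\times Y$, $X\to Y$ with the projections and the application of the calculus. The objects of $\mathcal C_T$ are the core types modulo derivable equality, $\mathcal C_T(A,B)=\mathtt{Proof}(A,B)$, the unit object is $I$, the tensor product is $A\otimes B$, and - composition $\mathcal C_T(A,B)\times\mathcal C_T(B,D)\to\mathcal C_T(A,D)$ is given by $x,y\mapsto\mathtt{promote}(\mathtt{derelict}(y)[\mathtt{derelict}(x)/b])$; - the identity of $A$ is $\mathtt{promote}(a)$, for $a:A$; - the tensor product of $x:\mathtt{Proof}(A,A')$ and $y:\mathtt{Proof}(B,B')$ is $\mathtt{promote}(\mathtt{derelict}(x)\otimes\mathtt{derelict}(y))$. In $(\mathcal H_T,\mathcal C_T)$ there is a model of $T$ that interprets each type by itself and each term $x:X\vdash t:Y$ by its class, and a host or core equation holds in it if and only if it is derivable in $T$. -/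

import Mathlib

open CategoryTheory MonoidalCategory CartesianMonoidalCategory

universe u v₁ u₁ v₂ u₂

/-! ## Enriched symmetric monoidal categories -/

/-- A `V`-enriched symmetric monoidal category `C`, for a braided monoidal base `V`: a `V`-category
(with its underlying ordinary category, whose morphisms `A ⟶ B` are the morphisms
`𝟙_ V ⟶ (A ⟶[V] B)`), together with a tensor product which is a `V`-functor `C ⊗ C ⟶ C`, a unit
object, and `V`-natural associator, unitors and symmetry that satisfy the coherence equations
(the latter are those of the symmetric monoidal underlying category). -/
class EnrichedSymmetricMonoidal (V : Type u₁) [Category.{v₁} V] [MonoidalCategory V]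
    [BraidedCategory V] (C : Type u₂) [Category.{v₂} C] [MonoidalCategory C]
    [SymmetricCategory C] extends EnrichedOrdinaryCategory V C where
  /-- the action of the tensor `V`-functor on hom-objects -/
  eTensor (A A' B B' : C) : (A ⟶[V] A') ⊗ (B ⟶[V] B') ⟶ ((A ⊗ B) ⟶[V] (A' ⊗ B'))
  /-- on the underlying category, it is the given tensor product of morphisms -/
  eTensor_eHomEquiv {A A' B B' : C} (f : A ⟶ A') (g : B ⟶ B') :
    (λ_ (𝟙_ V)).inv ≫ (eHomEquiv V f ⊗ₘ eHomEquiv V g) ≫ eTensor A A' B B' =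
      eHomEquiv V (f ⊗ₘ g)
  /-- `V`-functoriality: identities -/
  eTensor_id (A B : C) :
    (λ_ (𝟙_ V)).inv ≫ (eId V A ⊗ₘ eId V B) ≫ eTensor A A B B = eId V (A ⊗ B)
  /-- `V`-functoriality: composition -/
  eTensor_comp (A A' A'' B B' B'' : C) :
    (eComp V A A' A'' ⊗ₘ eComp V B B' B'') ≫ eTensor A A'' B B'' =
      tensorμ (A ⟶[V] A') (A' ⟶[V] A'') (B ⟶[V] B') (B' ⟶[V] B'') ≫
        (eTensor A A' B B' ⊗ₘ eTensor A' A'' B' B'') ≫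
          eComp V (A ⊗ B) (A' ⊗ B') (A'' ⊗ B'')
  /-- `V`-naturality of the associator -/
  associator_eNatural (A A' B B' D D' : C) :
    eTensor A A' B B' ▷ (D ⟶[V] D') ≫ eTensor (A ⊗ B) (A' ⊗ B') D D' ≫
        eHomWhiskerLeft V ((A ⊗ B) ⊗ D) (α_ A' B' D').hom =
      (α_ (A ⟶[V] A') (B ⟶[V] B') (D ⟶[V] D')).hom ≫
        (A ⟶[V] A') ◁ eTensor B B' D D' ≫ eTensor A A' (B ⊗ D) (B' ⊗ D') ≫
          eHomWhiskerRight V (α_ A B D).hom (A' ⊗ B' ⊗ D')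
  /-- `V`-naturality of the left unitor -/
  leftUnitor_eNatural (A A' : C) :
    (λ_ (A ⟶[V] A')).inv ≫ eId V (𝟙_ C) ▷ (A ⟶[V] A') ≫ eTensor (𝟙_ C) (𝟙_ C) A A' ≫
        eHomWhiskerLeft V (𝟙_ C ⊗ A) (λ_ A').hom =
      eHomWhiskerRight V (λ_ A).hom A'
  /-- `V`-naturality of the right unitor -/
  rightUnitor_eNatural (A A' : C) :
    (ρ_ (A ⟶[V] A')).inv ≫ (A ⟶[V] A') ◁ eId V (𝟙_ C) ≫ eTensor A A' (𝟙_ C) (𝟙_ C) ≫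
        eHomWhiskerLeft V (A ⊗ 𝟙_ C) (ρ_ A').hom =
      eHomWhiskerRight V (ρ_ A).hom A'
  /-- `V`-naturality of the symmetry -/
  braiding_eNatural (A A' B B' : C) :
    eTensor A A' B B' ≫ eHomWhiskerLeft V (A ⊗ B) (β_ A' B').hom =
      (β_ (A ⟶[V] A') (B ⟶[V] B')).hom ≫ eTensor B B' A A' ≫
        eHomWhiskerRight V (β_ A B).hom (B' ⊗ A')

namespace HC

/-! ## Types -/

/-- Core types: base types, the unit `I`, tensor products. -/
inductive RawC (BC : Type u) : Type u
  | base (α : BC)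
  | unit
  | tens (A B : RawC BC)

/-- Host types: base types, the unit `1`, products, function types, and `Proof(A, B)` for core
types `A`, `B`. -/
inductive RawH (BC BH : Type u) : Type u
  | base (β : BH)
  | unit
  | prod (X Y : RawH BC BH)
  | arr (X Y : RawH BC BH)
  | proof (A B : RawC BC)

/-- The type level of a theory: base types and type equality axioms of both kinds. -/
structure TySys where
  CBase : Type u
  HBase : Type u
  cTyAx : RawC CBase → RawC CBase → Prop
  hTyAx : RawH CBase HBase → RawH CBase HBase → Prop

/-- Derivable equality of core types. -/
inductive CTyEq (Θ : TySys.{u}) : RawC Θ.CBase → RawC Θ.CBase → Prop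
  | ax {A B} : Θ.cTyAx A B → CTyEq Θ A B
  | refl (A) : CTyEq Θ A A
  | symm {A B} : CTyEq Θ A B → CTyEq Θ B A
  | trans {A B C} : CTyEq Θ A B → CTyEq Θ B C → CTyEq Θ A C
  | tens {A A' B B'} : CTyEq Θ A A' → CTyEq Θ B B' → CTyEq Θ (.tens A B) (.tens A' B')

/-- Derivable equality of host types. -/
inductive HTyEq (Θ : TySys.{u}) : RawH Θ.CBase Θ.HBase → RawH Θ.CBase Θ.HBase → Prop
  | ax {X Y} : Θ.hTyAx X Y → HTyEq Θ X Y
  | refl (X) : HTyEq Θ X X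
  | symm {X Y} : HTyEq Θ X Y → HTyEq Θ Y X
  | trans {X Y Z} : HTyEq Θ X Y → HTyEq Θ Y Z → HTyEq Θ X Z
  | prod {X X' Y Y'} : HTyEq Θ X X' → HTyEq Θ Y Y' → HTyEq Θ (.prod X Y) (.prod X' Y')
  | arr {X X' Y Y'} : HTyEq Θ X X' → HTyEq Θ Y Y' → HTyEq Θ (.arr X Y) (.arr X' Y')
  | proof {A A' B B'} : CTyEq Θ A A' → CTyEq Θ B B' → HTyEq Θ (.proof A B) (.proof A' B')

namespace TySys

def cSetoid (Θ : TySys.{u}) : Setoid (RawC Θ.CBase) :=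
  ⟨CTyEq Θ, ⟨CTyEq.refl, CTyEq.symm, CTyEq.trans⟩⟩

def hSetoid (Θ : TySys.{u}) : Setoid (RawH Θ.CBase Θ.HBase) :=
  ⟨HTyEq Θ, ⟨HTyEq.refl, HTyEq.symm, HTyEq.trans⟩⟩

/-- Core types modulo derivable equality. Terms are typed by types modulo equality, which is
the conversion rule "a term of type `A` is also a term of any type equal to `A`". -/
def CTy (Θ : TySys.{u}) : Type u := Quotient Θ.cSetoid

/-- Host types modulo derivable equality. -/
def HTy (Θ : TySys.{u}) : Type u := Quotient Θ.hSetoid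

variable {Θ : TySys.{u}}

/-- The core unit type `I`. -/
def CTy.unit : Θ.CTy := Quotient.mk Θ.cSetoid .unit

/-- The core type `A ⊗ B`. -/
def CTy.tens (A B : Θ.CTy) : Θ.CTy :=
  Quotient.map₂ (sa := Θ.cSetoid) (sb := Θ.cSetoid) (sc := Θ.cSetoid) RawC.tens
    (fun _ _ h _ _ h' => CTyEq.tens h h') A B

/-- The host unit type `1`. -/
def HTy.unit : Θ.HTy := Quotient.mk Θ.hSetoid .unit

/-- The host type `X × Y`. -/
def HTy.prod (X Y : Θ.HTy) : Θ.HTy :=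
  Quotient.map₂ (sa := Θ.hSetoid) (sb := Θ.hSetoid) (sc := Θ.hSetoid) RawH.prod
    (fun _ _ h _ _ h' => HTyEq.prod h h') X Y

/-- The host type `X → Y`. -/
def HTy.arr (X Y : Θ.HTy) : Θ.HTy :=
  Quotient.map₂ (sa := Θ.hSetoid) (sb := Θ.hSetoid) (sc := Θ.hSetoid) RawH.arr
    (fun _ _ h _ _ h' => HTyEq.arr h h') X Y

/-- The host type `Proof(A, B)`. -/
def HTy.proof (A B : Θ.CTy) : Θ.HTy :=
  Quotient.map₂ (sa := Θ.cSetoid) (sb := Θ.cSetoid) (sc := Θ.hSetoid) RawH.proof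
    (fun _ _ h _ _ h' => HTyEq.proof h h') A B

/-- The tensor product `A₁ ⊗ (A₂ ⊗ ⋯ ⊗ Aₙ)` of a core context (`I` if it is empty, `A` if it is
the one-element context `A`). -/
def tensorTy : List Θ.CTy → Θ.CTy
  | [] => .unit
  | [A] => A
  | A :: B :: Ω => .tens A (tensorTy (B :: Ω))

end TySys

open TySys

/-! ## Contexts -/

/-- Variables of type `X` in a host context. -/
inductive HVar {α : Type u} : List α → α → Type u
  | z {Γ X} : HVar (X :: Γ) X
  | s {Γ X Y} : HVar Γ X → HVar (Y :: Γ) X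

/-- `Split Ω Ω₁ Ω₂`: a way to distribute the variables of the core context `Ω` over `Ω₁` and `Ω₂`,
each variable going to exactly one of them. Contexts are thus used up to permutation. -/
inductive Split {α : Type u} : List α → List α → List α → Type u
  | nil : Split [] [] []
  | left {a l l₁ l₂} : Split l l₁ l₂ → Split (a :: l) (a :: l₁) l₂
  | right {a l l₁ l₂} : Split l l₁ l₂ → Split (a :: l) l₁ (a :: l₂)

namespace Split

variable {α : Type u}

def allRight : (l : List α) → Split l [] l
  | [] => nil
  | _ :: l => right (allRight l)

def comm {l l₁ l₂ : List α} : Split l l₁ l₂ → Split l l₂ l₁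
  | nil => nil
  | left s => right s.comm
  | right s => left s.comm

/-- From a distribution of `l` over `l₁` and `m` and of `m` over `m₁` and `m₂`, the distribution
of `l` over `l₁ ∪ m₁` and `m₂`, and of `l₁ ∪ m₁` over `l₁` and `m₁`. -/
def assoc {l l₁ m m₁ m₂ : List α} :
    Split l l₁ m → Split m m₁ m₂ → (k : List α) × Split l k m₂ × Split k l₁ m₁
  | nil, nil => ⟨[], nil, nil⟩
  | left s, t => let r := assoc s t; ⟨_, left r.2.1, left r.2.2⟩
  | right s, left t => let r := assoc s t; ⟨_, left r.2.1, right r.2.2⟩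
  | right s, right t => let r := assoc s t; ⟨_, right r.2.1, r.2.2⟩

theorem eq_left {l l₁ l₂ : List α} (s : Split l l₁ l₂) (h : l₂ = []) : l₁ = l := by
  induction s with
  | nil => rfl
  | left s ih => rw [ih h]
  | right s ih => simp at h

end Split

/-! ## Terms -/

/-- The new term symbols of a theory: `Γ ⊢ k : X` (host) and `Γ | Ω ⊢ k : A` (core). -/
structure TmSig (Θ : TySys.{u}) where
  HSym : Type u
  hDom : HSym → List Θ.HTy
  hCod : HSym → Θ.HTy
  CSym : Type u
  cHDom : CSym → List Θ.HTy
  cCDom : CSym → List Θ.CTy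
  cCod : CSym → Θ.CTy

mutual
/-- Host terms in context, `Γ ⊢ t : X`. Variables are de Bruijn indices, so that terms are
taken up to `α`-equivalence. A symbol is applied to host terms for the variables of its
context. -/
inductive HTm {Θ : TySys.{u}} (S : TmSig Θ) : List Θ.HTy → Θ.HTy → Type u
  | var {Γ X} : HVar Γ X → HTm S Γ X
  | sym {Γ} (k : S.HSym) : (∀ X, HVar (S.hDom k) X → HTm S Γ X) → HTm S Γ (S.hCod k)
  | unit {Γ} : HTm S Γ .unit
  | pair {Γ X Y} : HTm S Γ X → HTm S Γ Y → HTm S Γ (.prod X Y)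
  | fst {Γ X Y} : HTm S Γ (.prod X Y) → HTm S Γ X
  | snd {Γ X Y} : HTm S Γ (.prod X Y) → HTm S Γ Y
  | lam {Γ X Y} : HTm S (X :: Γ) Y → HTm S Γ (.arr X Y)
  | app {Γ X Y} : HTm S Γ (.arr X Y) → HTm S Γ X → HTm S Γ Y
  | promote {Γ Ω A} : CTm S Γ Ω A → HTm S Γ (.proof (tensorTy Ω) A)
/-- Core terms in mixed context, `Γ | Ω ⊢ f : A`, linear in `Ω`: `letT s f h` is
`let f be a ⊗ b in h`, `letU s f h` is `let f be • in h`, and `der t g` is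
`derelict(t)[g/a]`, with `derelict(t)` itself being `der t var`. -/
inductive CTm {Θ : TySys.{u}} (S : TmSig Θ) : List Θ.HTy → List Θ.CTy → Θ.CTy → Type u
  | var {Γ A} : CTm S Γ [A] A
  | sym {Γ Ω} (k : S.CSym) : (∀ X, HVar (S.cHDom k) X → HTm S Γ X) → CSub S Γ Ω (S.cCDom k) →
      CTm S Γ Ω (S.cCod k)
  | unit {Γ} : CTm S Γ [] .unit
  | tens {Γ Ω Ω₁ Ω₂ A B} : Split Ω Ω₁ Ω₂ → CTm S Γ Ω₁ A → CTm S Γ Ω₂ B → CTm S Γ Ω (.tens A B)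
  | letT {Γ Ω Ω₁ Ω₂ A B D} : Split Ω Ω₁ Ω₂ → CTm S Γ Ω₁ (.tens A B) →
      CTm S Γ (A :: B :: Ω₂) D → CTm S Γ Ω D
  | letU {Γ Ω Ω₁ Ω₂ D} : Split Ω Ω₁ Ω₂ → CTm S Γ Ω₁ .unit → CTm S Γ Ω₂ D → CTm S Γ Ω D
  | der {Γ Ω A B} : HTm S Γ (.proof A B) → CTm S Γ Ω A → CTm S Γ Ω B
/-- `CSub S Γ Δ Ω`: a list of core terms, one for each variable of `Ω`, which together use each
variable of `Δ` exactly once. -/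
inductive CSub {Θ : TySys.{u}} (S : TmSig Θ) : List Θ.HTy → List Θ.CTy → List Θ.CTy → Type u
  | nil {Γ} : CSub S Γ [] []
  | cons {Γ Δ Δ₁ Δ₂ Ω A} : Split Δ Δ₁ Δ₂ → CTm S Γ Δ₁ A → CSub S Γ Δ₂ Ω → CSub S Γ Δ (A :: Ω)
end

section Substitution

variable {Θ : TySys.{u}} {S : TmSig Θ}

/-! ### Host renaming and substitution -/

def Ren (Γ Δ : List Θ.HTy) : Type u := ∀ X, HVar Γ X → HVar Δ X

/-- Host terms over `Δ` for the variables of `Γ`. -/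
def HSub (S : TmSig Θ) (Δ Γ : List Θ.HTy) : Type u := ∀ X, HVar Γ X → HTm S Δ X

def Ren.lift {Γ Δ : List Θ.HTy} (ρ : Ren Γ Δ) (Y : Θ.HTy) : Ren (Y :: Γ) (Y :: Δ)
  | _, .z => .z
  | _, .s x => .s (ρ _ x)

mutual
def HTm.ren {Γ Δ : List Θ.HTy} {X : Θ.HTy} : HTm S Γ X → Ren Γ Δ → HTm S Δ X
  | .var x, ρ => .var (ρ _ x)
  | .sym k σ, ρ => .sym k fun X x => (σ X x).ren ρ
  | .unit, _ => .unit
  | .pair s t, ρ => .pair (s.ren ρ) (t.ren ρ)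
  | .fst t, ρ => .fst (t.ren ρ)
  | .snd t, ρ => .snd (t.ren ρ)
  | .lam t, ρ => .lam (t.ren (ρ.lift _))
  | .app t s, ρ => .app (t.ren ρ) (s.ren ρ)
  | .promote f, ρ => .promote (f.ren ρ)
def CTm.ren {Γ Δ : List Θ.HTy} {Ω : List Θ.CTy} {A : Θ.CTy} :
    CTm S Γ Ω A → Ren Γ Δ → CTm S Δ Ω A
  | .var, _ => .var
  | .sym k σ τ, ρ => .sym k (fun X x => (σ X x).ren ρ) (τ.ren ρ)
  | .unit, _ => .unit
  | .tens p f g, ρ => .tens p (f.ren ρ) (g.ren ρ)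
  | .letT p f g, ρ => .letT p (f.ren ρ) (g.ren ρ)
  | .letU p f g, ρ => .letU p (f.ren ρ) (g.ren ρ)
  | .der t g, ρ => .der (t.ren ρ) (g.ren ρ)
def CSub.ren {Γ Δ : List Θ.HTy} {Ω Ω' : List Θ.CTy} :
    CSub S Γ Ω Ω' → Ren Γ Δ → CSub S Δ Ω Ω'
  | .nil, _ => .nil
  | .cons p f τ, ρ => .cons p (f.ren ρ) (τ.ren ρ)
end

/-- The substitution `(σ, y/y)` under a binder. -/
def HSub.lift {Γ Δ : List Θ.HTy} (σ : HSub S Δ Γ) (Y : Θ.HTy) : HSub S (Y :: Δ) (Y :: Γ)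
  | _, .z => .var .z
  | _, .s x => (σ _ x).ren fun _ => .s

/-- The substitution `(σ, t/x)`. -/
def HSub.cons {Γ Δ : List Θ.HTy} {Y : Θ.HTy} (t : HTm S Δ Y) (σ : HSub S Δ Γ) :
    HSub S Δ (Y :: Γ)
  | _, .z => t
  | _, .s x => σ _ x

def HSub.id (Γ : List Θ.HTy) : HSub S Γ Γ := fun _ x => .var x

/-- The only substitution for the empty context. -/
def HSub.nil {Δ : List Θ.HTy} : HSub S Δ [] := fun _ x => nomatch x

mutual
/-- Substitution of host terms in a host term. -/
def HTm.sub {Γ Δ : List Θ.HTy} {X : Θ.HTy} : HTm S Γ X → HSub S Δ Γ → HTm S Δ X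
  | .var x, ρ => ρ _ x
  | .sym k σ, ρ => .sym k fun X x => (σ X x).sub ρ
  | .unit, _ => .unit
  | .pair s t, ρ => .pair (s.sub ρ) (t.sub ρ)
  | .fst t, ρ => .fst (t.sub ρ)
  | .snd t, ρ => .snd (t.sub ρ)
  | .lam t, ρ => .lam (t.sub (ρ.lift _))
  | .app t s, ρ => .app (t.sub ρ) (s.sub ρ)
  | .promote f, ρ => .promote (f.hsub ρ)
/-- Substitution of host terms in a core term. -/
def CTm.hsub {Γ Δ : List Θ.HTy} {Ω : List Θ.CTy} {A : Θ.CTy} :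
    CTm S Γ Ω A → HSub S Δ Γ → CTm S Δ Ω A
  | .var, _ => .var
  | .sym k σ τ, ρ => .sym k (fun X x => (σ X x).sub ρ) (τ.hsub ρ)
  | .unit, _ => .unit
  | .tens p f g, ρ => .tens p (f.hsub ρ) (g.hsub ρ)
  | .letT p f g, ρ => .letT p (f.hsub ρ) (g.hsub ρ)
  | .letU p f g, ρ => .letU p (f.hsub ρ) (g.hsub ρ)
  | .der t g, ρ => .der (t.sub ρ) (g.hsub ρ)
def CSub.hsub {Γ Δ : List Θ.HTy} {Ω Ω' : List Θ.CTy} :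
    CSub S Γ Ω Ω' → HSub S Δ Γ → CSub S Δ Ω Ω'
  | .nil, _ => .nil
  | .cons p f τ, ρ => .cons p (f.hsub ρ) (τ.hsub ρ)
end

/-! ### Core substitution -/

/-- The part of a substitution that concerns the variables in `Ω₁`, and that for `Ω₂`. -/
def CSub.split {Γ : List Θ.HTy} {Ω Ω₁ Ω₂ Δ : List Θ.CTy} : Split Ω Ω₁ Ω₂ → CSub S Γ Δ Ω →
    (Δ₁ Δ₂ : List Θ.CTy) × Split Δ Δ₁ Δ₂ × CSub S Γ Δ₁ Ω₁ × CSub S Γ Δ₂ Ω₂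
  | .nil, .nil => ⟨[], [], .nil, .nil, .nil⟩
  | .left s, .cons p t ρ =>
    let r := CSub.split s ρ
    let q := p.assoc r.2.2.1
    ⟨q.1, r.2.1, q.2.1, .cons q.2.2 t r.2.2.2.1, r.2.2.2.2⟩
  | .right s, .cons p t ρ =>
    let r := CSub.split s ρ
    let q := p.assoc r.2.2.1.comm
    ⟨r.1, q.1, q.2.1.comm, r.2.2.2.1, .cons q.2.2 t r.2.2.2.2⟩

/-- The substitution `(ρ, a/a)` under a binder. -/
def CSub.lift {Γ : List Θ.HTy} {Δ Ω : List Θ.CTy} (A : Θ.CTy) (ρ : CSub S Γ Δ Ω) :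
    CSub S Γ (A :: Δ) (A :: Ω) :=
  .cons (.left (.allRight Δ)) .var ρ

def CSub.id {Γ : List Θ.HTy} : (Ω : List Θ.CTy) → CSub S Γ Ω Ω
  | [] => .nil
  | A :: Ω => (CSub.id Ω).lift A

/-- The term substituted for the only variable. -/
def CSub.head {Γ : List Θ.HTy} {Δ : List Θ.CTy} {A : Θ.CTy} : CSub S Γ Δ [A] → CTm S Γ Δ A
  | .cons p t .nil => p.eq_left rfl ▸ t

mutual
/-- Simultaneous substitution of core terms in a core term. -/
def CTm.csub {Γ : List Θ.HTy} {Ω Δ : List Θ.CTy} {A : Θ.CTy} :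
    CTm S Γ Ω A → CSub S Γ Δ Ω → CTm S Γ Δ A
  | .var, ρ => ρ.head
  | .sym k σ τ, ρ => .sym k σ (τ.csub ρ)
  | .unit, .nil => .unit
  | .tens p f g, ρ =>
    let r := ρ.split p
    .tens r.2.2.1 (f.csub r.2.2.2.1) (g.csub r.2.2.2.2)
  | .letT p f g, ρ =>
    let r := ρ.split p
    .letT r.2.2.1 (f.csub r.2.2.2.1) (g.csub ((r.2.2.2.2.lift _).lift _))
  | .letU p f g, ρ =>
    let r := ρ.split p
    .letU r.2.2.1 (f.csub r.2.2.2.1) (g.csub r.2.2.2.2)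
  | .der t g, ρ => .der t (g.csub ρ)
def CSub.csub {Γ : List Θ.HTy} {Ω Ω' Δ : List Θ.CTy} :
    CSub S Γ Ω Ω' → CSub S Γ Δ Ω → CSub S Γ Δ Ω'
  | .nil, .nil => .nil
  | .cons p f τ, ρ =>
    let r := ρ.split p
    .cons r.2.2.1 (f.csub r.2.2.2.1) (τ.csub r.2.2.2.2)
end

/-- The core term `a₁ ⊗ ⋯ ⊗ aₙ` in context `a₁ : A₁, …, aₙ : Aₙ`. -/
def CTm.tensVars {Γ : List Θ.HTy} : (Ω : List Θ.CTy) → CTm S Γ Ω (tensorTy Ω)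
  | [] => .unit
  | [_] => .var
  | _ :: B :: Ω => .tens (.left (.allRight (B :: Ω))) .var (CTm.tensVars (B :: Ω))

end Substitution

/-! ## Theories and their equations -/

/-- A theory: base types, type equality axioms, term symbols, and axioms that are equations
between host terms in context and between core terms in mixed context. The pure calculus is the
case without symbols and axioms. -/
structure Theory where
  ty : TySys.{u}
  sig : TmSig ty
  hAx : ∀ {Γ : List ty.HTy} {X : ty.HTy}, HTm sig Γ X → HTm sig Γ X → Prop
  cAx : ∀ {Γ : List ty.HTy} {Ω : List ty.CTy} {A : ty.CTy},
    CTm sig Γ Ω A → CTm sig Γ Ω A → Prop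

mutual
/-- Derivable host equations `Γ ⊢ s = t : X`. -/
inductive Theory.HEqn (T : Theory.{u}) :
    {Γ : List T.ty.HTy} → {X : T.ty.HTy} → HTm T.sig Γ X → HTm T.sig Γ X → Prop
  | ax {Γ X} {s t : HTm T.sig Γ X} : T.hAx s t → T.HEqn s t
  -- equivalence relation
  | refl {Γ X} (t : HTm T.sig Γ X) : T.HEqn t t
  | symm {Γ X} {s t : HTm T.sig Γ X} : T.HEqn s t → T.HEqn t s
  | trans {Γ X} {s t r : HTm T.sig Γ X} : T.HEqn s t → T.HEqn t r → T.HEqn s r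
  -- substitution
  | sub {Γ Δ X} {s t : HTm T.sig Γ X} {σ τ : HSub T.sig Δ Γ} :
      T.HEqn s t → (∀ Y x, T.HEqn (σ Y x) (τ Y x)) → T.HEqn (s.sub σ) (t.sub τ)
  -- congruence
  | sym {Γ} (k : T.sig.HSym) {σ τ : HSub T.sig Γ (T.sig.hDom k)} :
      (∀ Y x, T.HEqn (σ Y x) (τ Y x)) → T.HEqn (.sym k σ) (.sym k τ)
  | pair {Γ X Y} {s s' : HTm T.sig Γ X} {t t' : HTm T.sig Γ Y} :
      T.HEqn s s' → T.HEqn t t' → T.HEqn (.pair s t) (.pair s' t')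
  | fst {Γ X Y} {t t' : HTm T.sig Γ (.prod X Y)} : T.HEqn t t' → T.HEqn (.fst t) (.fst t')
  | snd {Γ X Y} {t t' : HTm T.sig Γ (.prod X Y)} : T.HEqn t t' → T.HEqn (.snd t) (.snd t')
  | lam {Γ X Y} {t t' : HTm T.sig (X :: Γ) Y} : T.HEqn t t' → T.HEqn (.lam t) (.lam t')
  | app {Γ X Y} {t t' : HTm T.sig Γ (.arr X Y)} {s s' : HTm T.sig Γ X} :
      T.HEqn t t' → T.HEqn s s' → T.HEqn (.app t s) (.app t' s')
  | promote {Γ Ω A} {f f' : CTm T.sig Γ Ω A} :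
      T.CEqn f f' → T.HEqn (.promote f) (.promote f')
  -- `β` and `η` for `1`, `×`, `→`
  | unit_eta {Γ} (t : HTm T.sig Γ .unit) : T.HEqn t .unit
  | fst_pair {Γ X Y} (s : HTm T.sig Γ X) (t : HTm T.sig Γ Y) : T.HEqn (.fst (.pair s t)) s
  | snd_pair {Γ X Y} (s : HTm T.sig Γ X) (t : HTm T.sig Γ Y) : T.HEqn (.snd (.pair s t)) t
  | pair_eta {Γ X Y} (t : HTm T.sig Γ (.prod X Y)) : T.HEqn (.pair (.fst t) (.snd t)) t
  | app_lam {Γ X Y} (t : HTm T.sig (X :: Γ) Y) (s : HTm T.sig Γ X) :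
      T.HEqn (.app (.lam t) s) (t.sub (.cons s (.id Γ)))
  | lam_eta {Γ X Y} (t : HTm T.sig Γ (.arr X Y)) :
      T.HEqn (.lam (.app (t.ren fun _ => .s) (.var .z))) t
  -- `promote(derelict(t)) = t`
  | promote_der {Γ A B} (t : HTm T.sig Γ (.proof A B)) :
      T.HEqn (.promote (Ω := [A]) (.der t .var)) t
/-- Derivable core equations `Γ | Ω ⊢ f = g : A`. -/
inductive Theory.CEqn (T : Theory.{u}) : {Γ : List T.ty.HTy} → {Ω : List T.ty.CTy} →
    {A : T.ty.CTy} → CTm T.sig Γ Ω A → CTm T.sig Γ Ω A → Prop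
  | ax {Γ Ω A} {f g : CTm T.sig Γ Ω A} : T.cAx f g → T.CEqn f g
  -- equivalence relation
  | refl {Γ Ω A} (f : CTm T.sig Γ Ω A) : T.CEqn f f
  | symm {Γ Ω A} {f g : CTm T.sig Γ Ω A} : T.CEqn f g → T.CEqn g f
  | trans {Γ Ω A} {f g h : CTm T.sig Γ Ω A} : T.CEqn f g → T.CEqn g h → T.CEqn f h
  -- substitution
  | hsub {Γ Δ Ω A} {f g : CTm T.sig Γ Ω A} {σ τ : HSub T.sig Δ Γ} :
      T.CEqn f g → (∀ Y x, T.HEqn (σ Y x) (τ Y x)) → T.CEqn (f.hsub σ) (g.hsub τ)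
  | csub {Γ Δ Ω A} {f g : CTm T.sig Γ Ω A} {ρ τ : CSub T.sig Γ Δ Ω} :
      T.CEqn f g → T.CSubEqn ρ τ → T.CEqn (f.csub ρ) (g.csub τ)
  -- congruence
  | sym {Γ Ω} (k : T.sig.CSym) {σ τ : HSub T.sig Γ (T.sig.cHDom k)}
      {ρ ρ' : CSub T.sig Γ Ω (T.sig.cCDom k)} :
      (∀ Y x, T.HEqn (σ Y x) (τ Y x)) → T.CSubEqn ρ ρ' → T.CEqn (.sym k σ ρ) (.sym k τ ρ')
  | tens {Γ Ω Ω₁ Ω₂ A B} (p : Split Ω Ω₁ Ω₂) {f f' : CTm T.sig Γ Ω₁ A}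
      {g g' : CTm T.sig Γ Ω₂ B} :
      T.CEqn f f' → T.CEqn g g' → T.CEqn (.tens p f g) (.tens p f' g')
  | letT {Γ Ω Ω₁ Ω₂ A B D} (p : Split Ω Ω₁ Ω₂) {f f' : CTm T.sig Γ Ω₁ (.tens A B)}
      {h h' : CTm T.sig Γ (A :: B :: Ω₂) D} :
      T.CEqn f f' → T.CEqn h h' → T.CEqn (.letT p f h) (.letT p f' h')
  | letU {Γ Ω Ω₁ Ω₂ D} (p : Split Ω Ω₁ Ω₂) {f f' : CTm T.sig Γ Ω₁ .unit}
      {h h' : CTm T.sig Γ Ω₂ D} :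
      T.CEqn f f' → T.CEqn h h' → T.CEqn (.letU p f h) (.letU p f' h')
  | der {Γ Ω A B} {t t' : HTm T.sig Γ (.proof A B)} {g g' : CTm T.sig Γ Ω A} :
      T.HEqn t t' → T.CEqn g g' → T.CEqn (.der t g) (.der t' g')
  -- `let g ⊗ h be a ⊗ b in f = f[g/a, h/b]`
  | letT_tens {Γ Ω Ω₁ Ω' Ω₂ Ω₃ A B D} (p : Split Ω Ω₂ Ω') (q : Split Ω' Ω₃ Ω₁)
      (f : CTm T.sig Γ (A :: B :: Ω₁) D) (g : CTm T.sig Γ Ω₂ A) (h : CTm T.sig Γ Ω₃ B) :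
      T.CEqn (.letT (p.assoc q).2.1 (.tens (p.assoc q).2.2 g h) f)
        (f.csub (.cons p g (.cons q h (.id Ω₁))))
  -- `let g be a ⊗ b in f[a ⊗ b/c] = f[g/c]`
  | letT_eta {Γ Ω Ω₁ Ω₂ A B D} (p : Split Ω Ω₂ Ω₁) (f : CTm T.sig Γ (.tens A B :: Ω₁) D)
      (g : CTm T.sig Γ Ω₂ (.tens A B)) :
      T.CEqn
        (.letT p g (f.csub (.cons (.left (.left (.allRight Ω₁)))
          (.tens (.left (.right .nil)) .var .var) (.id Ω₁))))
        (f.csub (.cons p g (.id Ω₁)))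
  -- `let • be • in f = f`
  | letU_unit {Γ Ω A} (f : CTm T.sig Γ Ω A) : T.CEqn (.letU (.allRight Ω) .unit f) f
  -- `let g be • in f[•/a] = f[g/a]`
  | letU_eta {Γ Ω Ω₁ Ω₂ D} (p : Split Ω Ω₂ Ω₁) (f : CTm T.sig Γ (.unit :: Ω₁) D)
      (g : CTm T.sig Γ Ω₂ .unit) :
      T.CEqn (.letU p g (f.csub (.cons (.allRight Ω₁) .unit (.id Ω₁))))
        (f.csub (.cons p g (.id Ω₁)))
  -- `derelict(promote(f))[a₁ ⊗ ⋯ ⊗ aₙ/ω] = f`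
  | der_promote {Γ Ω A} (f : CTm T.sig Γ Ω A) :
      T.CEqn (.der (.promote f) (.tensVars Ω)) f
/-- Componentwise derivable equality of lists of core terms. -/
inductive Theory.CSubEqn (T : Theory.{u}) : {Γ : List T.ty.HTy} → {Δ Ω : List T.ty.CTy} →
    CSub T.sig Γ Δ Ω → CSub T.sig Γ Δ Ω → Prop
  | nil {Γ} : T.CSubEqn (CSub.nil (Γ := Γ)) .nil
  | cons {Γ Δ Δ₁ Δ₂ Ω A} (p : Split Δ Δ₁ Δ₂) {f f' : CTm T.sig Γ Δ₁ A}
      {ρ ρ' : CSub T.sig Γ Δ₂ Ω} :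
      T.CEqn f f' → T.CSubEqn ρ ρ' → T.CSubEqn (.cons p f ρ) (.cons p f' ρ')
end

section Lemmas

variable {Θ : TySys.{u}} {S : TmSig Θ}

def Ren.comp {Γ Δ Ξ : List Θ.HTy} (ρ : Ren Γ Δ) (ρ' : Ren Δ Ξ) : Ren Γ Ξ :=
  fun X x => ρ' X (ρ X x)

def HSub.ren {Γ Δ Ξ : List Θ.HTy} (σ : HSub S Δ Γ) (ρ : Ren Δ Ξ) : HSub S Ξ Γ :=
  fun X x => (σ X x).ren ρ

def Ren.sub {Γ Δ Ξ : List Θ.HTy} (ρ : Ren Γ Δ) (σ : HSub S Ξ Δ) : HSub S Ξ Γ :=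
  fun X x => σ X (ρ X x)

def HSub.comp {Γ Δ Ξ : List Θ.HTy} (σ : HSub S Δ Γ) (τ : HSub S Ξ Δ) : HSub S Ξ Γ :=
  fun X x => (σ X x).sub τ

theorem Ren.lift_comp {Γ Δ Ξ : List Θ.HTy} (ρ : Ren Γ Δ) (ρ' : Ren Δ Ξ) (Y : Θ.HTy) :
    (ρ.lift Y).comp (ρ'.lift Y) = (ρ.comp ρ').lift Y := by
  funext X x; cases x <;> rfl

theorem Ren.lift_sub {Γ Δ Ξ : List Θ.HTy} (ρ : Ren Γ Δ) (σ : HSub S Ξ Δ) (Y : Θ.HTy) :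
    (ρ.lift Y).sub (σ.lift Y) = (ρ.sub σ).lift Y := by
  funext X x; cases x <;> rfl

theorem HSub.lift_id (Γ : List Θ.HTy) (Y : Θ.HTy) :
    (HSub.id (S := S) Γ).lift Y = HSub.id (Y :: Γ) := by
  funext X x; cases x <;> simp [HSub.lift, HSub.id, HTm.ren]

mutual
theorem HTm.ren_ren {Γ Δ Ξ : List Θ.HTy} {X : Θ.HTy} : (t : HTm S Γ X) → (ρ : Ren Γ Δ) →
    (ρ' : Ren Δ Ξ) → (t.ren ρ).ren ρ' = t.ren (ρ.comp ρ')
  | .var _, _, _ => by simp [HTm.ren, Ren.comp]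
  | .sym k σ, ρ, ρ' => by
    simp only [HTm.ren]; congr; funext X x; exact (σ X x).ren_ren ρ ρ'
  | .unit, _, _ => by simp [HTm.ren]
  | .pair s t, ρ, ρ' => by simp [HTm.ren, s.ren_ren ρ ρ', t.ren_ren ρ ρ']
  | .fst t, ρ, ρ' => by simp [HTm.ren, t.ren_ren ρ ρ']
  | .snd t, ρ, ρ' => by simp [HTm.ren, t.ren_ren ρ ρ']
  | .lam t, ρ, ρ' => by simp [HTm.ren, t.ren_ren _ _, Ren.lift_comp]
  | .app t s, ρ, ρ' => by simp [HTm.ren, s.ren_ren ρ ρ', t.ren_ren ρ ρ']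
  | .promote f, ρ, ρ' => by simp [HTm.ren, f.ren_ren ρ ρ']
theorem CTm.ren_ren {Γ Δ Ξ : List Θ.HTy} {Ω : List Θ.CTy} {A : Θ.CTy} : (t : CTm S Γ Ω A) →
    (ρ : Ren Γ Δ) → (ρ' : Ren Δ Ξ) → (t.ren ρ).ren ρ' = t.ren (ρ.comp ρ')
  | .var, _, _ => by simp [CTm.ren]
  | .sym k σ τ, ρ, ρ' => by
    simp only [CTm.ren]; congr 1
    · funext X x; exact (σ X x).ren_ren ρ ρ'
    · exact τ.ren_ren ρ ρ'
  | .unit, _, _ => by simp [CTm.ren]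
  | .tens p f g, ρ, ρ' => by simp [CTm.ren, f.ren_ren ρ ρ', g.ren_ren ρ ρ']
  | .letT p f g, ρ, ρ' => by simp [CTm.ren, f.ren_ren ρ ρ', g.ren_ren ρ ρ']
  | .letU p f g, ρ, ρ' => by simp [CTm.ren, f.ren_ren ρ ρ', g.ren_ren ρ ρ']
  | .der t g, ρ, ρ' => by simp [CTm.ren, t.ren_ren ρ ρ', g.ren_ren ρ ρ']
theorem CSub.ren_ren {Γ Δ Ξ : List Θ.HTy} {Ω Ω' : List Θ.CTy} : (t : CSub S Γ Ω Ω') →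
    (ρ : Ren Γ Δ) → (ρ' : Ren Δ Ξ) → (t.ren ρ).ren ρ' = t.ren (ρ.comp ρ')
  | .nil, _, _ => by simp [CSub.ren]
  | .cons p f g, ρ, ρ' => by simp [CSub.ren, f.ren_ren ρ ρ', g.ren_ren ρ ρ']
end

theorem HSub.lift_ren {Γ Δ Ξ : List Θ.HTy} (σ : HSub S Δ Γ) (ρ : Ren Δ Ξ) (Y : Θ.HTy) :
    (σ.lift Y).ren (ρ.lift Y) = (σ.ren ρ).lift Y := by
  funext X x
  cases x with
  | z => simp [HSub.lift, HSub.ren, HTm.ren, Ren.lift]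
  | s x => exact ((σ X x).ren_ren _ _).trans ((σ X x).ren_ren ρ fun _ => .s).symm

mutual
theorem HTm.ren_sub {Γ Δ Ξ : List Θ.HTy} {X : Θ.HTy} : (t : HTm S Γ X) → (ρ : Ren Γ Δ) →
    (σ : HSub S Ξ Δ) → (t.ren ρ).sub σ = t.sub (ρ.sub σ)
  | .var _, _, _ => by simp [HTm.ren, HTm.sub, Ren.sub]
  | .sym k σ, ρ, ρ' => by
    simp only [HTm.ren, HTm.sub]; congr; funext X x; exact (σ X x).ren_sub ρ ρ'
  | .unit, _, _ => by simp [HTm.ren, HTm.sub]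
  | .pair s t, ρ, ρ' => by simp [HTm.ren, HTm.sub, s.ren_sub ρ ρ', t.ren_sub ρ ρ']
  | .fst t, ρ, ρ' => by simp [HTm.ren, HTm.sub, t.ren_sub ρ ρ']
  | .snd t, ρ, ρ' => by simp [HTm.ren, HTm.sub, t.ren_sub ρ ρ']
  | .lam t, ρ, ρ' => by simp [HTm.ren, HTm.sub, t.ren_sub _ _, Ren.lift_sub]
  | .app t s, ρ, ρ' => by simp [HTm.ren, HTm.sub, s.ren_sub ρ ρ', t.ren_sub ρ ρ']
  | .promote f, ρ, ρ' => by simp [HTm.ren, HTm.sub, f.ren_hsub ρ ρ']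
theorem CTm.ren_hsub {Γ Δ Ξ : List Θ.HTy} {Ω : List Θ.CTy} {A : Θ.CTy} : (t : CTm S Γ Ω A) →
    (ρ : Ren Γ Δ) → (σ : HSub S Ξ Δ) → (t.ren ρ).hsub σ = t.hsub (ρ.sub σ)
  | .var, _, _ => by simp [CTm.ren, CTm.hsub]
  | .sym k σ τ, ρ, ρ' => by
    simp only [CTm.ren, CTm.hsub]; congr 1
    · funext X x; exact (σ X x).ren_sub ρ ρ'
    · exact τ.ren_hsub ρ ρ'
  | .unit, _, _ => by simp [CTm.ren, CTm.hsub]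
  | .tens p f g, ρ, ρ' => by simp [CTm.ren, CTm.hsub, f.ren_hsub ρ ρ', g.ren_hsub ρ ρ']
  | .letT p f g, ρ, ρ' => by simp [CTm.ren, CTm.hsub, f.ren_hsub ρ ρ', g.ren_hsub ρ ρ']
  | .letU p f g, ρ, ρ' => by simp [CTm.ren, CTm.hsub, f.ren_hsub ρ ρ', g.ren_hsub ρ ρ']
  | .der t g, ρ, ρ' => by simp [CTm.ren, CTm.hsub, t.ren_sub ρ ρ', g.ren_hsub ρ ρ']
theorem CSub.ren_hsub {Γ Δ Ξ : List Θ.HTy} {Ω Ω' : List Θ.CTy} : (t : CSub S Γ Ω Ω') →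
    (ρ : Ren Γ Δ) → (σ : HSub S Ξ Δ) → (t.ren ρ).hsub σ = t.hsub (ρ.sub σ)
  | .nil, _, _ => by simp [CSub.ren, CSub.hsub]
  | .cons p f g, ρ, ρ' => by simp [CSub.ren, CSub.hsub, f.ren_hsub ρ ρ', g.ren_hsub ρ ρ']
end

mutual
theorem HTm.sub_ren {Γ Δ Ξ : List Θ.HTy} {X : Θ.HTy} : (t : HTm S Γ X) → (σ : HSub S Δ Γ) →
    (ρ : Ren Δ Ξ) → (t.sub σ).ren ρ = t.sub (σ.ren ρ)
  | .var _, _, _ => by simp [HTm.sub, HSub.ren]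
  | .sym k σ, ρ, ρ' => by
    simp only [HTm.ren, HTm.sub]; congr; funext X x; exact (σ X x).sub_ren ρ ρ'
  | .unit, _, _ => by simp [HTm.ren, HTm.sub]
  | .pair s t, ρ, ρ' => by simp [HTm.ren, HTm.sub, s.sub_ren ρ ρ', t.sub_ren ρ ρ']
  | .fst t, ρ, ρ' => by simp [HTm.ren, HTm.sub, t.sub_ren ρ ρ']
  | .snd t, ρ, ρ' => by simp [HTm.ren, HTm.sub, t.sub_ren ρ ρ']
  | .lam t, ρ, ρ' => by simp [HTm.ren, HTm.sub, t.sub_ren _ _, HSub.lift_ren]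
  | .app t s, ρ, ρ' => by simp [HTm.ren, HTm.sub, s.sub_ren ρ ρ', t.sub_ren ρ ρ']
  | .promote f, ρ, ρ' => by simp [HTm.ren, HTm.sub, f.hsub_ren ρ ρ']
theorem CTm.hsub_ren {Γ Δ Ξ : List Θ.HTy} {Ω : List Θ.CTy} {A : Θ.CTy} : (t : CTm S Γ Ω A) →
    (σ : HSub S Δ Γ) → (ρ : Ren Δ Ξ) → (t.hsub σ).ren ρ = t.hsub (σ.ren ρ)
  | .var, _, _ => by simp [CTm.ren, CTm.hsub]
  | .sym k σ τ, ρ, ρ' => by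
    simp only [CTm.ren, CTm.hsub]; congr 1
    · funext X x; exact (σ X x).sub_ren ρ ρ'
    · exact τ.hsub_ren ρ ρ'
  | .unit, _, _ => by simp [CTm.ren, CTm.hsub]
  | .tens p f g, ρ, ρ' => by simp [CTm.ren, CTm.hsub, f.hsub_ren ρ ρ', g.hsub_ren ρ ρ']
  | .letT p f g, ρ, ρ' => by simp [CTm.ren, CTm.hsub, f.hsub_ren ρ ρ', g.hsub_ren ρ ρ']
  | .letU p f g, ρ, ρ' => by simp [CTm.ren, CTm.hsub, f.hsub_ren ρ ρ', g.hsub_ren ρ ρ']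
  | .der t g, ρ, ρ' => by simp [CTm.ren, CTm.hsub, t.sub_ren ρ ρ', g.hsub_ren ρ ρ']
theorem CSub.hsub_ren {Γ Δ Ξ : List Θ.HTy} {Ω Ω' : List Θ.CTy} : (t : CSub S Γ Ω Ω') →
    (σ : HSub S Δ Γ) → (ρ : Ren Δ Ξ) → (t.hsub σ).ren ρ = t.hsub (σ.ren ρ)
  | .nil, _, _ => by simp [CSub.ren, CSub.hsub]
  | .cons p f g, ρ, ρ' => by simp [CSub.ren, CSub.hsub, f.hsub_ren ρ ρ', g.hsub_ren ρ ρ']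
end

theorem HSub.lift_comp {Γ Δ Ξ : List Θ.HTy} (σ : HSub S Δ Γ) (τ : HSub S Ξ Δ) (Y : Θ.HTy) :
    (σ.lift Y).comp (τ.lift Y) = (σ.comp τ).lift Y := by
  funext X x
  cases x with
  | z => simp [HSub.lift, HSub.comp, HTm.sub]
  | s x => exact ((σ X x).ren_sub _ _).trans ((σ X x).sub_ren _ _).symm

mutual
theorem HTm.sub_sub {Γ Δ Ξ : List Θ.HTy} {X : Θ.HTy} : (t : HTm S Γ X) → (σ : HSub S Δ Γ) →
    (τ : HSub S Ξ Δ) → (t.sub σ).sub τ = t.sub (σ.comp τ)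
  | .var _, _, _ => by simp [HTm.sub, HSub.comp]
  | .sym k σ, ρ, ρ' => by
    simp only [HTm.sub]; congr; funext X x; exact (σ X x).sub_sub ρ ρ'
  | .unit, _, _ => by simp [HTm.sub]
  | .pair s t, ρ, ρ' => by simp [HTm.sub, s.sub_sub ρ ρ', t.sub_sub ρ ρ']
  | .fst t, ρ, ρ' => by simp [HTm.sub, t.sub_sub ρ ρ']
  | .snd t, ρ, ρ' => by simp [HTm.sub, t.sub_sub ρ ρ']
  | .lam t, ρ, ρ' => by simp [HTm.sub, t.sub_sub _ _, HSub.lift_comp]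
  | .app t s, ρ, ρ' => by simp [HTm.sub, s.sub_sub ρ ρ', t.sub_sub ρ ρ']
  | .promote f, ρ, ρ' => by simp [HTm.sub, f.hsub_hsub ρ ρ']
theorem CTm.hsub_hsub {Γ Δ Ξ : List Θ.HTy} {Ω : List Θ.CTy} {A : Θ.CTy} : (t : CTm S Γ Ω A) →
    (σ : HSub S Δ Γ) → (τ : HSub S Ξ Δ) → (t.hsub σ).hsub τ = t.hsub (σ.comp τ)
  | .var, _, _ => by simp [CTm.hsub]
  | .sym k σ τ, ρ, ρ' => by
    simp only [CTm.hsub]; congr 1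
    · funext X x; exact (σ X x).sub_sub ρ ρ'
    · exact τ.hsub_hsub ρ ρ'
  | .unit, _, _ => by simp [CTm.hsub]
  | .tens p f g, ρ, ρ' => by simp [CTm.hsub, f.hsub_hsub ρ ρ', g.hsub_hsub ρ ρ']
  | .letT p f g, ρ, ρ' => by simp [CTm.hsub, f.hsub_hsub ρ ρ', g.hsub_hsub ρ ρ']
  | .letU p f g, ρ, ρ' => by simp [CTm.hsub, f.hsub_hsub ρ ρ', g.hsub_hsub ρ ρ']
  | .der t g, ρ, ρ' => by simp [CTm.hsub, t.sub_sub ρ ρ', g.hsub_hsub ρ ρ']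
theorem CSub.hsub_hsub {Γ Δ Ξ : List Θ.HTy} {Ω Ω' : List Θ.CTy} : (t : CSub S Γ Ω Ω') →
    (σ : HSub S Δ Γ) → (τ : HSub S Ξ Δ) → (t.hsub σ).hsub τ = t.hsub (σ.comp τ)
  | .nil, _, _ => by simp [CSub.hsub]
  | .cons p f g, ρ, ρ' => by simp [CSub.hsub, f.hsub_hsub ρ ρ', g.hsub_hsub ρ ρ']
end

mutual
theorem HTm.sub_id {Γ : List Θ.HTy} {X : Θ.HTy} : (t : HTm S Γ X) → t.sub (.id Γ) = t
  | .var _ => by simp [HTm.sub, HSub.id]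
  | .sym k σ => by
    simp only [HTm.sub]; congr; funext X x; exact (σ X x).sub_id
  | .unit => by simp [HTm.sub]
  | .pair s t => by simp [HTm.sub, s.sub_id, t.sub_id]
  | .fst t => by simp [HTm.sub, t.sub_id]
  | .snd t => by simp [HTm.sub, t.sub_id]
  | .lam t => by simp [HTm.sub, t.sub_id, HSub.lift_id]
  | .app t s => by simp [HTm.sub, s.sub_id, t.sub_id]
  | .promote f => by simp [HTm.sub, f.hsub_id]
theorem CTm.hsub_id {Γ : List Θ.HTy} {Ω : List Θ.CTy} {A : Θ.CTy} : (t : CTm S Γ Ω A) →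
    t.hsub (.id Γ) = t
  | .var => by simp [CTm.hsub]
  | .sym k σ τ => by
    simp only [CTm.hsub]; congr 1
    · funext X x; exact (σ X x).sub_id
    · exact τ.hsub_id
  | .unit => by simp [CTm.hsub]
  | .tens p f g => by simp [CTm.hsub, f.hsub_id, g.hsub_id]
  | .letT p f g => by simp [CTm.hsub, f.hsub_id, g.hsub_id]
  | .letU p f g => by simp [CTm.hsub, f.hsub_id, g.hsub_id]
  | .der t g => by simp [CTm.hsub, t.sub_id, g.hsub_id]
theorem CSub.hsub_id {Γ : List Θ.HTy} {Ω Ω' : List Θ.CTy} : (t : CSub S Γ Ω Ω') →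
    t.hsub (.id Γ) = t
  | .nil => by simp [CSub.hsub]
  | .cons p f g => by simp [CSub.hsub, f.hsub_id, g.hsub_id]
end

end Lemmas

/-! ## The syntactic host category -/

/-- Host terms `Γ ⊢ t : X` modulo derivable equality. -/
def Theory.hSetoid (T : Theory.{u}) (Γ : List T.ty.HTy) (X : T.ty.HTy) : Setoid (HTm T.sig Γ X) :=
  ⟨T.HEqn, ⟨.refl, .symm, .trans⟩⟩

/-- The objects of the syntactic host category: host types modulo equality. -/
def SynH (T : Theory.{u}) : Type u := T.ty.HTy

/-- The objects of the syntactic core category: core types modulo equality. -/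
def SynC (T : Theory.{u}) : Type u := T.ty.CTy

/-- Morphisms `X ⟶ Y` of the syntactic host category: terms `x : X ⊢ t : Y` modulo derivable
equality. -/
def SynHom (T : Theory.{u}) (X Y : T.ty.HTy) : Type u := Quotient (T.hSetoid [X] Y)

/-- Composition is substitution. -/
instance SynH.category (T : Theory.{u}) : Category.{u} (SynH T) where
  Hom X Y := SynHom T X Y
  id X := Quotient.mk (T.hSetoid [X] X) (.var .z)
  comp {X Y Z} f g := Quotient.map₂ (sa := T.hSetoid [X] Y) (sb := T.hSetoid [Y] Z)
    (sc := T.hSetoid [X] Z) (fun s t => t.sub (HSub.cons s .nil))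
    (fun _ _ h _ _ h' => Theory.HEqn.sub h' fun _ x => match x with | .z => h) f g
  id_comp {X Y} f := by
    refine Quotient.inductionOn (s := T.hSetoid [X] Y) f fun t => ?_
    refine congrArg (Quotient.mk _) (Eq.trans (congrArg t.sub ?_) t.sub_id)
    funext Y y
    cases y with
    | z => rfl
    | s y => cases y
  comp_id {X Y} f := by
    refine Quotient.inductionOn (s := T.hSetoid [X] Y) f fun t => ?_
    refine congrArg (Quotient.mk _) ?_
    simp only [HTm.sub]
    rfl
  assoc {W X Y Z} f g h := by
    refine Quotient.inductionOn (s := T.hSetoid [W] X) f fun r => ?_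
    refine Quotient.inductionOn (s := T.hSetoid [X] Y) g fun s => ?_
    refine Quotient.inductionOn (s := T.hSetoid [Y] Z) h fun t => ?_
    refine congrArg (Quotient.mk _) (Eq.trans (congrArg t.sub ?_) (t.sub_sub _ _).symm)
    funext Y y
    cases y with
    | z => rfl
    | s y => cases y

/-- A host type, as an object of the syntactic host category. -/
def SynH.of {T : Theory.{u}} (X : T.ty.HTy) : SynH T := X

/-- A core type, as an object of the syntactic core category. -/
def SynC.of {T : Theory.{u}} (A : T.ty.CTy) : SynC T := A

/-- The morphism `X ⟶ Y` given by a term `x : X ⊢ t : Y`. -/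
def SynH.mk {T : Theory.{u}} {X Y : T.ty.HTy} (t : HTm T.sig [X] Y) : SynH.of X ⟶ SynH.of Y :=
  Quotient.mk (T.hSetoid [X] Y) t

/-! ## Interpretations -/

section Interpretation

/-- The product `⟦X₁⟧ × (⟦X₂⟧ × ⋯ × 1)` that interprets a host context. -/
def prodCtx {α : Type u} {H : Type u₁} [Category.{v₁} H] [MonoidalCategory H] (o : α → H) :
    List α → H
  | [] => 𝟙_ H
  | X :: Γ => o X ⊗ prodCtx o Γ

/-- The tensor product `⟦A₁⟧ ⊗ (⟦A₂⟧ ⊗ ⋯ ⊗ ⟦Aₙ⟧)` that interprets a core context (`I` if it is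
empty, `⟦A⟧` if it is the one-element context `A`). -/
def tensCtx {α : Type u} {C : Type u₂} [Category.{v₂} C] [MonoidalCategory C] (o : α → C) :
    List α → C
  | [] => 𝟙_ C
  | [A] => o A
  | A :: B :: Ω => o A ⊗ tensCtx o (B :: Ω)

section Ctx

variable {α : Type u} {H : Type u₁} [Category.{v₁} H] [CartesianMonoidalCategory H] (o : α → H)

/-- The projection to a variable. -/
def projVar : {Γ : List α} → {X : α} → HVar Γ X → (prodCtx o Γ ⟶ o X)
  | _ :: Γ, _, .z => fst _ (prodCtx o Γ)
  | Y :: _, _, .s x => snd (o Y) _ ≫ projVar x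

/-- The morphism to a context with given components. -/
def tuple {P : H} : (Γ : List α) → (∀ X, HVar Γ X → (P ⟶ o X)) → (P ⟶ prodCtx o Γ)
  | [], _ => toUnit P
  | X :: Γ, f => lift (f X .z) (tuple Γ fun Y y => f Y (.s y))

end Ctx

section Ctx

variable {α : Type u} {C : Type u₂} [Category.{v₂} C] [MonoidalCategory C] (o : α → C)

/-- The canonical isomorphism `⟦A, Ω⟧ ≅ ⟦A⟧ ⊗ ⟦Ω⟧`. -/
def consIso (A : α) : (Ω : List α) → (tensCtx o (A :: Ω) ≅ o A ⊗ tensCtx o Ω)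
  | [] => (ρ_ (o A)).symm
  | _ :: _ => Iso.refl _

/-- The canonical morphism `⟦Ω⟧ ⟶ ⟦Ω₁⟧ ⊗ ⟦Ω₂⟧`, which permutes the factors by the symmetry. -/
def splitHom [SymmetricCategory C] :
    {Ω Ω₁ Ω₂ : List α} → Split Ω Ω₁ Ω₂ → (tensCtx o Ω ⟶ tensCtx o Ω₁ ⊗ tensCtx o Ω₂)
  | _, _, _, .nil => (λ_ (𝟙_ C)).inv
  | _, _, Ω₂, .left (a := A) (l := l) (l₁ := l₁) s =>
    (consIso o A l).hom ≫ o A ◁ splitHom s ≫ (α_ (o A) (tensCtx o l₁) (tensCtx o Ω₂)).inv ≫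
      (consIso o A l₁).inv ▷ tensCtx o Ω₂
  | _, Ω₁, _, .right (a := A) (l := l) (l₂ := l₂) s =>
    (consIso o A l).hom ≫ o A ◁ splitHom s ≫ (α_ (o A) (tensCtx o Ω₁) (tensCtx o l₂)).inv ≫
      (β_ (o A) (tensCtx o Ω₁)).hom ▷ tensCtx o l₂ ≫
        (α_ (tensCtx o Ω₁) (o A) (tensCtx o l₂)).hom ≫ tensCtx o Ω₁ ◁ (consIso o A l₂).inv

end Ctx

variable {H : Type u₁} [Category.{v₁} H] [CartesianMonoidalCategory H] [BraidedCategory H]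
  {C : Type u₂} [Category.{v₂} C] [MonoidalCategory C] [SymmetricCategory C]
  [EnrichedSymmetricMonoidal H C]

/-- The morphism of `C`, seen as a constant family of morphisms indexed by `P`. -/
def eConst {P : H} {A B : C} (f : A ⟶ B) : P ⟶ (A ⟶[H] B) :=
  toUnit P ≫ eHomEquiv H f

/-- Composition `g ∘ f` of families of morphisms indexed by `P`. -/
def eSeq {P : H} {A B D : C} (f : P ⟶ (A ⟶[H] B)) (g : P ⟶ (B ⟶[H] D)) : P ⟶ (A ⟶[H] D) :=
  lift f g ≫ eComp H A B D

/-- Tensor product `f ⊗ g` of families of morphisms indexed by `P`. -/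
def ePar {P : H} {A A' B B' : C} (f : P ⟶ (A ⟶[H] A')) (g : P ⟶ (B ⟶[H] B')) :
    P ⟶ ((A ⊗ B) ⟶[H] (A' ⊗ B')) :=
  lift f g ≫ EnrichedSymmetricMonoidal.eTensor A A' B B'

variable (H C) in
/-- An interpretation of the types: an object of `H` for each host type and an object of `C` for
each core type (equal types having the same interpretation), compatible with the type
constructors. -/
structure TyInterp [MonoidalClosed H] (Θ : TySys.{u}) where
  hObj : Θ.HTy → H
  cObj : Θ.CTy → C
  hObj_unit : hObj .unit = 𝟙_ H
  hObj_prod (X Y) : hObj (.prod X Y) = hObj X ⊗ hObj Y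
  hObj_arr (X Y) : hObj (.arr X Y) = (ihom (hObj X)).obj (hObj Y)
  hObj_proof (A B) : hObj (.proof A B) = (cObj A ⟶[H] cObj B)
  cObj_unit : cObj .unit = 𝟙_ C
  cObj_tens (A B) : cObj (.tens A B) = cObj A ⊗ cObj B

variable (H C) in
/-- A structure in `(H, C)` for the types and the term symbols of a theory. -/
structure Interp [MonoidalClosed H] {Θ : TySys.{u}} (S : TmSig Θ) extends TyInterp H C Θ where
  hSym (k : S.HSym) : prodCtx hObj (S.hDom k) ⟶ hObj (S.hCod k)
  cSym (k : S.CSym) :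
    prodCtx hObj (S.cHDom k) ⟶ (tensCtx cObj (S.cCDom k) ⟶[H] cObj (S.cCod k))

variable [MonoidalClosed H]

theorem TyInterp.cObj_tensorTy {Θ : TySys.{u}} (I : TyInterp H C Θ) :
    (Ω : List Θ.CTy) → I.cObj (tensorTy Ω) = tensCtx I.cObj Ω
  | [] => I.cObj_unit
  | [_] => rfl
  | A :: B :: Ω => by
    rw [tensorTy, tensCtx, I.cObj_tens, I.cObj_tensorTy (B :: Ω)]

theorem TyInterp.hObj_proof_tensorTy {Θ : TySys.{u}} (I : TyInterp H C Θ) (Ω : List Θ.CTy)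
    (A : Θ.CTy) : (tensCtx I.cObj Ω ⟶[H] I.cObj A) = I.hObj (.proof (tensorTy Ω) A) := by
  rw [I.hObj_proof, I.cObj_tensorTy]

variable {Θ : TySys.{u}} {S : TmSig Θ}

mutual
/-- The interpretation `⟦Γ⟧ ⟶ ⟦X⟧` of a host term. The morphisms `eqToHom` only identify the
two sides of the equations `⟦X × Y⟧ = ⟦X⟧ × ⟦Y⟧`, etc. -/
noncomputable def Interp.hTm (I : Interp H C S) {Γ : List Θ.HTy} {X : Θ.HTy} :
    HTm S Γ X → (prodCtx I.hObj Γ ⟶ I.hObj X)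
  | .var x => projVar I.hObj x
  | .sym k σ => tuple I.hObj (S.hDom k) (fun X x => I.hTm (σ X x)) ≫ I.hSym k
  | .unit => toUnit _ ≫ eqToHom I.hObj_unit.symm
  | .pair s t => lift (I.hTm s) (I.hTm t) ≫ eqToHom (I.hObj_prod _ _).symm
  | .fst t => I.hTm t ≫ eqToHom (I.hObj_prod _ _) ≫ fst _ _
  | .snd t => I.hTm t ≫ eqToHom (I.hObj_prod _ _) ≫ snd _ _
  | .lam t => MonoidalClosed.curry (I.hTm t) ≫ eqToHom (I.hObj_arr _ _).symm
  | .app t s =>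
    lift (I.hTm s) (I.hTm t ≫ eqToHom (I.hObj_arr _ _)) ≫ (ihom.ev _).app _
  | .promote (Ω := Ω) f => I.cTm f ≫ eqToHom (I.hObj_proof_tensorTy Ω _)
/-- The interpretation `⟦Γ⟧ ⟶ C(⟦Ω⟧, ⟦A⟧)` of a core term. -/
noncomputable def Interp.cTm (I : Interp H C S) {Γ : List Θ.HTy} {Ω : List Θ.CTy} {A : Θ.CTy} :
    CTm S Γ Ω A → (prodCtx I.hObj Γ ⟶ (tensCtx I.cObj Ω ⟶[H] I.cObj A))
  | .var (A := A) => toUnit _ ≫ eId H (I.cObj A)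
  | .sym k σ τ =>
    eSeq (I.cSub τ) (tuple I.hObj (S.cHDom k) (fun X x => I.hTm (σ X x)) ≫ I.cSym k)
  | .unit => eConst (eqToHom I.cObj_unit.symm)
  | .tens p f g =>
    eSeq (eConst (splitHom I.cObj p)) (eSeq (ePar (I.cTm f) (I.cTm g))
      (eConst (eqToHom (I.cObj_tens _ _).symm)))
  | .letT (Ω₂ := Ω₂) (A := A) (B := B) p f h =>
    eSeq (eConst (splitHom I.cObj p))
      (eSeq (ePar (I.cTm f) (eConst (𝟙 (tensCtx I.cObj Ω₂))))
        (eSeq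
          (eConst (eqToHom (I.cObj_tens A B) ▷ tensCtx I.cObj Ω₂ ≫
            (α_ (I.cObj A) (I.cObj B) (tensCtx I.cObj Ω₂)).hom ≫
              I.cObj A ◁ (consIso I.cObj B Ω₂).inv ≫ (consIso I.cObj A (B :: Ω₂)).inv))
          (I.cTm h)))
  | .letU (Ω₂ := Ω₂) p f h =>
    eSeq (eConst (splitHom I.cObj p))
      (eSeq (ePar (I.cTm f) (eConst (𝟙 (tensCtx I.cObj Ω₂))))
        (eSeq
          (eConst (eqToHom I.cObj_unit ▷ tensCtx I.cObj Ω₂ ≫ (λ_ (tensCtx I.cObj Ω₂)).hom))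
          (I.cTm h)))
  | .der t g => eSeq (I.cTm g) (I.hTm t ≫ eqToHom (I.hObj_proof _ _))
/-- The interpretation `⟦Γ⟧ ⟶ C(⟦Δ⟧, ⟦Ω⟧)` of a list of core terms. -/
noncomputable def Interp.cSub (I : Interp H C S) {Γ : List Θ.HTy} {Δ Ω : List Θ.CTy} :
    CSub S Γ Δ Ω → (prodCtx I.hObj Γ ⟶ (tensCtx I.cObj Δ ⟶[H] tensCtx I.cObj Ω))
  | .nil => eConst (𝟙 (𝟙_ C))
  | .cons (Ω := Ω) (A := A) p f ρ =>
    eSeq (eConst (splitHom I.cObj p)) (eSeq (ePar (I.cTm f) (I.cSub ρ))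
      (eConst (consIso I.cObj A Ω).inv))
end

end Interpretation

section Models

variable {H : Type u₁} [Category.{v₁} H] [CartesianMonoidalCategory H] [BraidedCategory H]
  [MonoidalClosed H] {C : Type u₂} [Category.{v₂} C] [MonoidalCategory C] [SymmetricCategory C]
  [EnrichedSymmetricMonoidal H C]

/-- The structure is one for the theory `T`: it satisfies the axioms of `T` (the type equality
axioms are satisfied by any interpretation of the types of `T`). -/
structure Interp.IsModel {T : Theory.{u}} (I : Interp H C T.sig) : Prop where
  hAx {Γ : List T.ty.HTy} {X : T.ty.HTy} (s t : HTm T.sig Γ X) : T.hAx s t → I.hTm s = I.hTm t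
  cAx {Γ : List T.ty.HTy} {Ω : List T.ty.CTy} {A : T.ty.CTy} (f g : CTm T.sig Γ Ω A) :
    T.cAx f g → I.cTm f = I.cTm g

end Models

/-- The given structure of a cartesian closed category on the host types and terms of `T`, and of
a category enriched in it on the core types, is the syntactic one, and `G` interprets each type
by itself and each term by its class. (Each `eqToHom` is between equal objects.) -/
structure IsSyntactic (T : Theory.{u}) [CartesianMonoidalCategory (SynH T)]
    [BraidedCategory (SynH T)] [MonoidalClosed (SynH T)] [Category.{u} (SynC T)]
    [MonoidalCategory (SynC T)] [SymmetricCategory (SynC T)]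
    [EnrichedSymmetricMonoidal (SynH T) (SynC T)] (G : Interp (SynH T) (SynC T) T.sig) :
    Prop where
  /-- the terminal object is `1` -/
  unit_eq : 𝟙_ (SynH T) = SynH.of .unit
  /-- the product of `X` and `Y` is `X × Y`, with the projections given by the calculus -/
  prod_eq (X Y : T.ty.HTy) : SynH.of X ⊗ SynH.of Y = SynH.of (.prod X Y)
  fst_eq (X Y : T.ty.HTy) :
    fst (SynH.of X) (SynH.of Y) = eqToHom (prod_eq X Y) ≫ SynH.mk (.fst (.var .z))
  snd_eq (X Y : T.ty.HTy) :
    snd (SynH.of X) (SynH.of Y) = eqToHom (prod_eq X Y) ≫ SynH.mk (.snd (.var .z))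
  /-- the exponential is `X → Y`, with evaluation given by application -/
  arr_eq (X Y : T.ty.HTy) : (ihom (SynH.of X)).obj (SynH.of Y) = SynH.of (.arr X Y)
  ev_eq (X Y : T.ty.HTy) :
    (ihom.ev (SynH.of X)).app (SynH.of Y) =
      eqToHom ((congrArg (SynH.of X ⊗ ·) (arr_eq X Y)).trans (prod_eq X (.arr X Y))) ≫
        SynH.mk (.app (.snd (.var .z)) (.fst (.var .z)))
  /-- the hom-object from `A` to `B` is `Proof(A, B)` -/
  hom_eq (A B : T.ty.CTy) : (SynC.of A ⟶[SynH T] SynC.of B) = SynH.of (.proof A B)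
  /-- the identity of `A` is `promote(a)` -/
  eId_eq (A : T.ty.CTy) :
    eId (SynH T) (SynC.of A) =
      eqToHom unit_eq ≫ SynH.mk (.promote (Ω := [A]) .var) ≫ eqToHom (hom_eq A A).symm
  /-- the composite of `x : Proof(A, B)` and `y : Proof(B, D)` is
  `promote(derelict(y)[derelict(x)/b])` -/
  eComp_eq (A B D : T.ty.CTy) :
    eComp (SynH T) (SynC.of A) (SynC.of B) (SynC.of D) =
      eqToHom ((congrArg₂ (· ⊗ ·) (hom_eq A B) (hom_eq B D)).trans (prod_eq _ _)) ≫
        SynH.mk (.promote (Ω := [A]) (.der (.snd (.var .z)) (.der (.fst (.var .z)) .var))) ≫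
          eqToHom (hom_eq A D).symm
  /-- the unit object is `I` -/
  coreUnit_eq : 𝟙_ (SynC T) = SynC.of .unit
  /-- the tensor product of `A` and `B` is `A ⊗ B`, and that of `x : Proof(A, A')` and
  `y : Proof(B, B')` is `promote(derelict(x) ⊗ derelict(y))` -/
  tens_eq (A B : T.ty.CTy) : SynC.of A ⊗ SynC.of B = SynC.of (.tens A B)
  eTensor_eq (A A' B B' : T.ty.CTy) :
    EnrichedSymmetricMonoidal.eTensor (V := SynH T) (SynC.of A) (SynC.of A') (SynC.of B)
        (SynC.of B') =
      eqToHom ((congrArg₂ (· ⊗ ·) (hom_eq A A') (hom_eq B B')).trans (prod_eq _ _)) ≫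
        SynH.mk (.promote (Ω := [A, B]) (.tens (.left (.right .nil))
          (.der (.fst (.var .z)) .var) (.der (.snd (.var .z)) .var))) ≫
          eqToHom ((congrArg₂ (fun X Y : SynC T => (X ⟶[SynH T] Y)) (tens_eq A B)
            (tens_eq A' B')).trans (hom_eq (.tens A B) (.tens A' B'))).symm
  hObj_eq (X : T.ty.HTy) : G.hObj X = SynH.of X
  cObj_eq (A : T.ty.CTy) : G.cObj A = SynC.of A
  hTm_eq (X Y : T.ty.HTy) (t : HTm T.sig [X] Y) :
    G.hTm t = (ρ_ (G.hObj X)).hom ≫ eqToHom (hObj_eq X) ≫ SynH.mk t ≫ eqToHom (hObj_eq Y).symm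

end HC

-- Soundness. For a fixed object `P` of `H`, the families `P ⟶ C(A, B)` are the morphisms of an
-- ordinary symmetric monoidal category `Fam C P`: the enriched axioms, evaluated at generalized
-- elements, become its axioms, and its structural isomorphisms are constant families. Core terms
-- over `Γ` are interpreted in `Fam C ⟦Γ⟧`, so every rule about them reduces to an equation in an
-- arbitrary symmetric monoidal category. What remains is the combinatorics of distributing a linear
-- context: `splitHom` is associative and symmetric (`splitHom_assoc`, `splitHom_comm`) and natural
-- with respect to substitutions (`cSub_split`). Hence core substitution is composition
-- (`cTm_csub`), host substitution is precomposition (`hTm_sub`, `cTm_hsub`), and soundness is an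
-- induction on derivations.
--
-- Syntactic categories. The rule for `derelict(promote(f))` turns a substitution `f[ρ]` into an
-- application of `promote(f)` to the tensor product of the terms of `ρ` (`der_promote_pack`). The
-- unit and associativity laws of core substitution thus hold up to derivable equality, without
-- induction on `f`. The `η`-rules for `let` say that a proof out of a tensor product is determined
-- by its value on a pattern of variables such as `(a ⊗ b) ⊗ c`; such patterns are called `Dense`. A
-- coherence equation is proved by evaluating both sides on a dense pattern, where the `β`-rules
-- compute them. The enriched axioms follow because a morphism into `Proof(A, B)` is the same as a
-- family of proofs.
--
-- Completeness. In the syntactic model a host term is interpreted by itself, with its variables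
-- replaced by the components of one variable of product type. A core term is interpreted by the
-- morphism whose value on the tensor product of its core variables is that term, with the same
-- replacement of host variables. The replacement is undone by substituting the tuple of the host
-- variables, so equality in the model is derivability. In particular the axioms hold in it, so it
-- is a model, and an equation valid in all models is derivable.

namespace HC

open TySys

-- The symmetric monoidal category of indexed families of morphisms

section Families

variable {H : Type u₁} [Category.{v₁} H] [CartesianMonoidalCategory H] [BraidedCategory H]
  {C : Type u₂} [Category.{v₂} C] [MonoidalCategory C] [SymmetricCategory C]
  [EnrichedSymmetricMonoidal H C]

open EnrichedSymmetricMonoidal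

/-- Composition of the underlying morphisms is composition of constant families. -/
theorem eHomEquiv_comp_lift {A B D : C} (f : A ⟶ B) (g : B ⟶ D) :
    eHomEquiv H (f ≫ g) = lift (eHomEquiv H f) (eHomEquiv H g) ≫ eComp H A B D := by
  rw [eHomEquiv_comp, ← Category.assoc]
  congr 1
  ext <;> simp

theorem eHomEquiv_tensor_lift {A B A' B' : C} (f : A ⟶ A') (g : B ⟶ B') :
    eHomEquiv H (f ⊗ₘ g) = lift (eHomEquiv H f) (eHomEquiv H g) ≫ eTensor A A' B B' := by
  rw [← eTensor_eHomEquiv, ← Category.assoc]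
  congr 1
  ext <;> simp

variable {P Q : H}

theorem eConst_id (A : C) : (eConst (𝟙 A) : P ⟶ (A ⟶[H] A)) = toUnit P ≫ eId H A := by
  simp [eConst]

theorem eConst_comp {A B D : C} (f : A ⟶ B) (g : B ⟶ D) :
    (eConst (f ≫ g) : P ⟶ (A ⟶[H] D)) = eSeq (eConst f) (eConst g) := by
  simp [eConst, eSeq, eHomEquiv_comp_lift, comp_lift_assoc]

theorem eConst_tensor {A B A' B' : C} (f : A ⟶ A') (g : B ⟶ B') :
    (eConst (f ⊗ₘ g) : P ⟶ ((A ⊗ B) ⟶[H] (A' ⊗ B'))) = ePar (eConst f) (eConst g) := by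
  simp [eConst, ePar, eHomEquiv_tensor_lift, comp_lift_assoc]

theorem comp_eConst (u : Q ⟶ P) {A B : C} (f : A ⟶ B) :
    u ≫ (eConst f : P ⟶ (A ⟶[H] B)) = eConst f := by simp [eConst]

theorem comp_eSeq (u : Q ⟶ P) {A B D : C} (f : P ⟶ (A ⟶[H] B)) (g : P ⟶ (B ⟶[H] D)) :
    u ≫ eSeq f g = eSeq (u ≫ f) (u ≫ g) := by simp [eSeq, comp_lift_assoc]

theorem comp_ePar (u : Q ⟶ P) {A B A' B' : C} (f : P ⟶ (A ⟶[H] A')) (g : P ⟶ (B ⟶[H] B')) :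
    u ≫ ePar f g = ePar (u ≫ f) (u ≫ g) := by simp [ePar, comp_lift_assoc]

theorem eSeq_id {A B : C} (f : P ⟶ (A ⟶[H] B)) : eSeq f (eConst (𝟙 B)) = f := by
  have h := congrArg (f ≫ ·) (e_comp_id H A B)
  simp only [Category.comp_id] at h
  conv_rhs => rw [← h]
  rw [eSeq, eConst_id]
  simp only [← Category.assoc]
  congr 1
  ext <;> simp

theorem id_eSeq {A B : C} (f : P ⟶ (A ⟶[H] B)) : eSeq (eConst (𝟙 A)) f = f := by
  have h := congrArg (f ≫ ·) (e_id_comp H A B)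
  simp only [Category.comp_id] at h
  conv_rhs => rw [← h]
  rw [eSeq, eConst_id]
  simp only [← Category.assoc]
  congr 1
  ext <;> simp

/-- The enriched associativity axiom, precomposed with the generalized element `lift f (lift g h)`
of the product of the hom-objects. The other laws of families come from the enriched axioms in the
same way. -/
theorem eSeq_assoc {A B D E : C} (f : P ⟶ (A ⟶[H] B)) (g : P ⟶ (B ⟶[H] D))
    (h : P ⟶ (D ⟶[H] E)) : eSeq (eSeq f g) h = eSeq f (eSeq g h) := by
  have e := congrArg (lift f (lift g h) ≫ ·) (e_assoc H A B D E)
  simp only [← Category.assoc] at e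
  simp only [eSeq]
  convert e using 2
  · ext <;> simp
  · ext <;> simp

theorem ePar_eSeq {A A' A'' B B' B'' : C} (f : P ⟶ (A ⟶[H] A')) (f' : P ⟶ (A' ⟶[H] A''))
    (g : P ⟶ (B ⟶[H] B')) (g' : P ⟶ (B' ⟶[H] B'')) :
    ePar (eSeq f f') (eSeq g g') = eSeq (ePar f g) (ePar f' g') := by
  have e := congrArg (lift (lift f f') (lift g g') ≫ ·) (eTensor_comp (V := H) A A' A'' B B' B'')
  simp only [← Category.assoc] at e
  simp only [eSeq, ePar]
  convert e using 2
  · ext <;> simp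
  · ext <;> simp

/-- Together with `eConst_eSeq`, this translates the whiskerings in the enriched naturality axioms
into composition with constant families. -/
theorem eSeq_eConst {A B D : C} (f : P ⟶ (A ⟶[H] B)) (g : B ⟶ D) :
    eSeq f (eConst g) = f ≫ eHomWhiskerLeft H A g := by
  rw [eSeq, eHomWhiskerLeft, eConst]
  simp only [← Category.assoc]
  congr 1
  ext <;> simp

theorem eConst_eSeq {A B D : C} (f : A ⟶ B) (g : P ⟶ (B ⟶[H] D)) :
    eSeq (eConst f) g = g ≫ eHomWhiskerRight H f D := by
  rw [eSeq, eHomWhiskerRight, eConst]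
  simp only [← Category.assoc]
  congr 1
  ext <;> simp

theorem ePar_associator {A A' B B' D D' : C} (f : P ⟶ (A ⟶[H] A')) (g : P ⟶ (B ⟶[H] B'))
    (h : P ⟶ (D ⟶[H] D')) :
    eSeq (ePar (ePar f g) h) (eConst (α_ A' B' D').hom) =
      eSeq (eConst (α_ A B D).hom) (ePar f (ePar g h)) := by
  rw [eSeq_eConst, eConst_eSeq]
  have e := congrArg (lift (lift f g) h ≫ ·) (associator_eNatural (V := H) A A' B B' D D')
  simp only [← Category.assoc] at e
  simp only [ePar]
  convert e using 2
  · congr 1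
    ext <;> simp
  · congr 1
    ext <;> simp

theorem ePar_leftUnitor {A A' : C} (f : P ⟶ (A ⟶[H] A')) :
    eSeq (ePar (eConst (𝟙 (𝟙_ C))) f) (eConst (λ_ A').hom) = eSeq (eConst (λ_ A).hom) f := by
  rw [eSeq_eConst, eConst_eSeq, ← leftUnitor_eNatural, ePar, eConst_id]
  simp only [← Category.assoc]
  congr 2
  ext <;> simp

theorem ePar_rightUnitor {A A' : C} (f : P ⟶ (A ⟶[H] A')) :
    eSeq (ePar f (eConst (𝟙 (𝟙_ C)))) (eConst (ρ_ A').hom) = eSeq (eConst (ρ_ A).hom) f := by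
  rw [eSeq_eConst, eConst_eSeq, ← rightUnitor_eNatural, ePar, eConst_id]
  simp only [← Category.assoc]
  congr 2
  ext <;> simp

theorem ePar_braiding {A A' B B' : C} (f : P ⟶ (A ⟶[H] A')) (g : P ⟶ (B ⟶[H] B')) :
    eSeq (ePar f g) (eConst (β_ A' B').hom) = eSeq (eConst (β_ A B).hom) (ePar g f) := by
  rw [eSeq_eConst, eConst_eSeq]
  have e := congrArg (lift f g ≫ ·) (braiding_eNatural (V := H) A A' B B')
  simp only [← Category.assoc] at e
  simp only [ePar]
  convert e using 2
  congr 1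
  ext <;> simp

variable (C P) in
/-- The symmetric monoidal category of families, indexed by `P`, of morphisms of `C`. -/
structure Fam (P : H) where
  of ::
  /-- the underlying object of `C` -/
  obj : C

namespace Fam

instance : Category (Fam C P) where
  Hom A B := P ⟶ (A.obj ⟶[H] B.obj)
  id A := eConst (𝟙 A.obj)
  comp f g := eSeq f g
  id_comp := id_eSeq
  comp_id := eSeq_id
  assoc := eSeq_assoc

variable (C P) in
/-- Constant families. -/
def const : C ⥤ Fam C P where
  obj A := ⟨A⟩
  map f := eConst f
  map_id _ := rfl
  map_comp := eConst_comp

instance : MonoidalCategoryStruct (Fam C P) where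
  tensorObj A B := ⟨A.obj ⊗ B.obj⟩
  tensorHom f g := ePar f g
  whiskerLeft A _ _ f := ePar (eConst (𝟙 A.obj)) f
  whiskerRight f B := ePar f (eConst (𝟙 B.obj))
  tensorUnit := ⟨𝟙_ C⟩
  associator A B D := (const C P).mapIso (α_ A.obj B.obj D.obj)
  leftUnitor A := (const C P).mapIso (λ_ A.obj)
  rightUnitor A := (const C P).mapIso (ρ_ A.obj)

/-- Pentagon and triangle involve constant families only, so they are the images of those of `C`.
Only functoriality of the tensor product and naturality use the enrichment. -/
instance : MonoidalCategory (Fam C P) :=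
  .ofTensorHom
    (id_tensorHom := fun _ _ _ _ => rfl)
    (tensorHom_id := fun _ _ => rfl)
    (id_tensorHom_id := fun A B => by
      change ePar (eConst _) (eConst _) = eConst _
      rw [← eConst_tensor, id_tensorHom_id]
      rfl)
    (tensorHom_comp_tensorHom := fun f g f' g' => (ePar_eSeq f f' g g').symm)
    (associator_naturality := fun f g h => ePar_associator f g h)
    (leftUnitor_naturality := fun f => ePar_leftUnitor f)
    (rightUnitor_naturality := fun f => ePar_rightUnitor f)
    (pentagon := fun A B D E => by
      change eSeq (ePar (eConst _) (eConst _)) (eSeq (eConst _) (ePar (eConst _) (eConst _))) =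
        eSeq (eConst _) (eConst _)
      simp only [← eConst_tensor, ← eConst_comp]
      simp only [tensorHom_id, id_tensorHom]
      exact congrArg eConst (MonoidalCategory.pentagon A.obj B.obj D.obj E.obj))
    (triangle := fun A B => by
      change eSeq (eConst _) (ePar (eConst _) (eConst _)) = ePar (eConst _) (eConst _)
      simp only [← eConst_tensor, ← eConst_comp]
      simp only [tensorHom_id, id_tensorHom]
      exact congrArg eConst (MonoidalCategory.triangle A.obj B.obj))

instance : SymmetricCategory (Fam C P) where
  braiding A B := (const C P).mapIso (β_ A.obj B.obj)
  braiding_naturality_right A _ _ f := ePar_braiding (eConst (𝟙 A.obj)) f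
  braiding_naturality_left f B := ePar_braiding f (eConst (𝟙 B.obj))
  hexagon_forward A B D := by
    change eSeq (eConst _) (eSeq (eConst _) (eConst _)) =
      eSeq (ePar (eConst _) (eConst _)) (eSeq (eConst _) (ePar (eConst _) (eConst _)))
    simp only [← eConst_tensor, ← eConst_comp]
    simp only [tensorHom_id, id_tensorHom]
    exact congrArg eConst (BraidedCategory.hexagon_forward A.obj B.obj D.obj)
  hexagon_reverse A B D := by
    change eSeq (eConst _) (eSeq (eConst _) (eConst _)) =
      eSeq (ePar (eConst _) (eConst _)) (eSeq (eConst _) (ePar (eConst _) (eConst _)))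
    simp only [← eConst_tensor, ← eConst_comp]
    simp only [tensorHom_id, id_tensorHom]
    exact congrArg eConst (BraidedCategory.hexagon_reverse A.obj B.obj D.obj)
  symmetry A B := by
    change eSeq (eConst _) (eConst _) = eConst _
    rw [← eConst_comp, SymmetricCategory.symmetry]
    rfl

end Fam

end Families

-- Coherence of the distribution of a context

section SymmetricMonoidal

variable {D : Type u₂} [Category.{v₂} D] [MonoidalCategory D] [SymmetricCategory D]

section

variable {A L K M M₁ M₂ L₁ : D} {s : L ⟶ L₁ ⊗ M} {t : M ⟶ M₁ ⊗ M₂}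
    {x : L ⟶ K ⊗ M₂} {y : K ⟶ L₁ ⊗ M₁} {AL AL₁ AM AM₁ AM₂ AK : D} (c : AL ≅ A ⊗ L)
    (k : AK ≅ A ⊗ K) (c₁ : AL₁ ≅ A ⊗ L₁)
    (m : AM ≅ A ⊗ M) (m₁ : AM₁ ≅ A ⊗ M₁) (m₂ : AM₂ ≅ A ⊗ M₂)

/-- The three `distrib_assoc` lemmas are the induction steps of `splitHom_assoc`, with `e` as
induction hypothesis. Arbitrary isomorphisms replace `consIso`, because `⟦A, Ω⟧` is not literally
`⟦A⟧ ⊗ ⟦Ω⟧` when `Ω` is empty. -/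
theorem distrib_assoc_left (e : x ≫ y ▷ M₂ ≫ (α_ _ _ _).hom = s ≫ L₁ ◁ t) :
    (c.hom ≫ A ◁ x ≫ (α_ _ _ _).inv ≫ k.inv ▷ _) ≫
        (k.hom ≫ A ◁ y ≫ (α_ _ _ _).inv ≫ c₁.inv ▷ _) ▷ M₂ ≫ (α_ _ _ _).hom =
      (c.hom ≫ A ◁ s ≫ (α_ _ _ _).inv ≫ c₁.inv ▷ _) ≫ AL₁ ◁ t := by
  have e' := congrArg (fun z => A ◁ z ≫ (α_ _ _ _).inv ≫ c₁.inv ▷ _) e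
  simp only [MonoidalCategory.whiskerLeft_comp, Category.assoc] at e'
  simp only [Category.assoc, comp_whiskerRight, inv_hom_whiskerRight_assoc]
  rw [← whisker_exchange, ← associator_inv_naturality_right_assoc, ← e']
  monoidal

theorem distrib_assoc_right_left (e : x ≫ y ▷ M₂ ≫ (α_ _ _ _).hom = s ≫ L₁ ◁ t) :
    (c.hom ≫ A ◁ x ≫ (α_ _ _ _).inv ≫ k.inv ▷ _) ≫
        (k.hom ≫ A ◁ y ≫ (α_ _ _ _).inv ≫ (β_ A L₁).hom ▷ M₁ ≫ (α_ _ _ _).hom ≫ _ ◁ m₁.inv) ▷ M₂ ≫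
          (α_ _ _ _).hom =
      (c.hom ≫ A ◁ s ≫ (α_ _ _ _).inv ≫ (β_ A L₁).hom ▷ M ≫ (α_ _ _ _).hom ≫ _ ◁ m.inv) ≫
        L₁ ◁ (m.hom ≫ A ◁ t ≫ (α_ _ _ _).inv ≫ m₁.inv ▷ _) := by
  have e' := congrArg (fun z => A ◁ z ≫ (α_ _ _ _).inv ≫ (β_ A L₁).hom ▷ _ ≫ (α_ _ _ _).hom ≫
    L₁ ◁ ((α_ _ _ _).inv ≫ m₁.inv ▷ _)) e
  simp only [MonoidalCategory.whiskerLeft_comp, Category.assoc] at e'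
  simp only [Category.assoc, comp_whiskerRight, MonoidalCategory.whiskerLeft_comp,
    inv_hom_whiskerRight_assoc, whiskerLeft_inv_hom_assoc]
  rw [← associator_naturality_right_assoc, ← whisker_exchange_assoc,
    ← associator_inv_naturality_right_assoc, ← e']
  monoidal

theorem distrib_assoc_right_right (e : x ≫ y ▷ M₂ ≫ (α_ _ _ _).hom = s ≫ L₁ ◁ t) :
    (c.hom ≫ A ◁ x ≫ (α_ _ _ _).inv ≫ (β_ A K).hom ▷ M₂ ≫ (α_ _ _ _).hom ≫ _ ◁ m₂.inv) ≫
        y ▷ AM₂ ≫ (α_ _ _ _).hom =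
      (c.hom ≫ A ◁ s ≫ (α_ _ _ _).inv ≫ (β_ A L₁).hom ▷ M ≫ (α_ _ _ _).hom ≫ _ ◁ m.inv) ≫
        L₁ ◁ (m.hom ≫ A ◁ t ≫ (α_ _ _ _).inv ≫ (β_ A M₁).hom ▷ M₂ ≫ (α_ _ _ _).hom ≫
          _ ◁ m₂.inv) := by
  have e' := congrArg (fun z => A ◁ z ≫ (α_ _ _ _).inv ≫ (β_ A L₁).hom ▷ _ ≫ (α_ _ _ _).hom ≫
    L₁ ◁ ((α_ _ _ _).inv ≫ (β_ A M₁).hom ▷ M₂ ≫ (α_ _ _ _).hom ≫ _ ◁ m₂.inv)) e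
  simp only [MonoidalCategory.whiskerLeft_comp, Category.assoc] at e'
  simp only [Category.assoc, MonoidalCategory.whiskerLeft_comp, whiskerLeft_inv_hom_assoc]
  rw [← associator_naturality_right_assoc, ← whisker_exchange_assoc,
    ← associator_inv_naturality_right_assoc, ← e']
  -- Naturality moves `y` past `A`; the hexagon identity then splits the braiding of `A` with `L₁ ⊗
  -- M₁` into the two braidings of the other side.
  have n : (β_ A K).hom ▷ M₂ ≫ y ▷ A ▷ M₂ = (A ◁ y) ▷ M₂ ≫ (β_ A (L₁ ⊗ M₁)).hom ▷ M₂ := by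
    rw [← comp_whiskerRight, ← comp_whiskerRight, BraidedCategory.braiding_naturality_right]
  have n' := A ◁ x ≫= (α_ _ _ _).inv ≫= (n =≫ ((α_ _ _ _).hom ≫ _ ◁ m₂.inv ≫ (α_ _ _ _).hom))
  simp only [Category.assoc, BraidedCategory.braiding_tensor_right_hom] at n'
  congr 1
  trans A ◁ x ≫ (α_ A K M₂).inv ≫ (β_ A K).hom ▷ M₂ ≫ y ▷ A ▷ M₂ ≫ (α_ _ _ _).hom ≫
    _ ◁ m₂.inv ≫ (α_ _ _ _).hom
  · rw [whisker_exchange_assoc]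
    monoidal
  · rw [n']
    monoidal

theorem leftUnitor_inv_braiding (A : D) : (λ_ A).inv ≫ (β_ _ _).hom = (ρ_ A).inv := by
  simp

theorem distrib_unit :
    c.hom ≫ A ◁ (λ_ L).inv ≫ (α_ _ _ _).inv ≫ (β_ A (𝟙_ D)).hom ▷ L ≫ (α_ _ _ _).hom ≫
      _ ◁ c.inv = (λ_ AL).inv := by
  simp

end

variable {α : Type u} (o : α → D)

/-- Distributing a context over three contexts in two ways. -/
theorem splitHom_assoc {l l₁ m m₁ m₂ : List α} (p : Split l l₁ m) (q : Split m m₁ m₂) :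
    splitHom o (p.assoc q).2.1 ≫ splitHom o (p.assoc q).2.2 ▷ _ ≫ (α_ _ _ _).hom =
      splitHom o p ≫ _ ◁ splitHom o q := by
  induction p generalizing m₁ m₂ with
  | nil =>
    cases q
    simp only [Split.assoc, splitHom]
    monoidal
  | left s ih => exact distrib_assoc_left (consIso o _ _) (consIso o _ _) (consIso o _ _) (ih q)
  | right s ih =>
    cases q with
    | left t =>
      exact distrib_assoc_right_left (consIso o _ _) (consIso o _ _) (consIso o _ _)
        (consIso o _ _) (ih t)
    | right t =>
      exact distrib_assoc_right_right (consIso o _ _) (consIso o _ _) (consIso o _ _) (ih t)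

/-- In the `left` case the two sides are related by the hexagon identity. In the `right` case the
outer braiding undoes the one inside `splitHom`, which requires the braiding to be a symmetry. -/
theorem splitHom_comm {l l₁ l₂ : List α} (p : Split l l₁ l₂) :
    splitHom o p.comm = splitHom o p ≫ (β_ _ _).hom := by
  induction p with
  | nil => exact (unitors_inv_equal (C := D)).trans (leftUnitor_inv_braiding _).symm
  | left s ih =>
    simp only [Split.comm, splitHom, ih]
    simp
  | right s ih =>
    simp only [Split.comm, splitHom, ih]
    simp [← comp_whiskerRight_assoc]

theorem splitHom_allRight (l : List α) : splitHom o (.allRight l) = (λ_ _).inv := by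
  induction l with
  | nil => rfl
  | cons a l ih =>
    simp only [Split.allRight, splitHom, ih]
    exact distrib_unit (consIso o a l)

theorem splitHom_allLeft (l : List α) : splitHom o (Split.allRight l).comm = (ρ_ _).inv := by
  rw [splitHom_comm, splitHom_allRight]
  exact leftUnitor_inv_braiding _

end SymmetricMonoidal

-- Substitution, as equations in a symmetric monoidal category

section SymmetricMonoidal

variable {D : Type u₂} [Category.{v₂} D] [MonoidalCategory D] [SymmetricCategory D]

/-- The induction step for naturality of `splitHom`: `h` is naturality for the tail of the context,
and `e` is the instance of `splitHom_assoc` that compares the regrouped distribution `x`, `y` with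
`q`, `r`. -/
theorem distrib_natural_left {A Δ Δ₁ Δ₂ L L₁ L₂ M₁ M₂ K AL AL₁ : D} {q : Δ ⟶ Δ₁ ⊗ Δ₂}
    {f : Δ₁ ⟶ A} {ρ : Δ₂ ⟶ L} {s : L ⟶ L₁ ⊗ L₂} {r : Δ₂ ⟶ M₁ ⊗ M₂} {ρ₁ : M₁ ⟶ L₁}
    {ρ₂ : M₂ ⟶ L₂} {x : Δ ⟶ K ⊗ M₂} {y : K ⟶ Δ₁ ⊗ M₁} (c : AL ≅ A ⊗ L) (c₁ : AL₁ ≅ A ⊗ L₁)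
    (h : ρ ≫ s = r ≫ (ρ₁ ⊗ₘ ρ₂)) (e : x ≫ y ▷ M₂ ≫ (α_ _ _ _).hom = q ≫ Δ₁ ◁ r) :
    (q ≫ (f ⊗ₘ ρ) ≫ c.inv) ≫ (c.hom ≫ A ◁ s ≫ (α_ _ _ _).inv ≫ c₁.inv ▷ L₂) =
      x ≫ ((y ≫ (f ⊗ₘ ρ₁) ≫ c₁.inv) ⊗ₘ ρ₂) := by
  have e₁ : x ≫ y ▷ M₂ = q ≫ Δ₁ ◁ r ≫ (α_ _ _ _).inv := by
    rw [← reassoc_of% e]; simp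
  have e₂ : x ≫ ((y ≫ (f ⊗ₘ ρ₁) ≫ c₁.inv) ⊗ₘ ρ₂) =
      x ≫ y ▷ M₂ ≫ ((f ⊗ₘ ρ₁) ⊗ₘ ρ₂) ≫ c₁.inv ▷ L₂ := by
    simp only [← tensorHom_id, tensorHom_comp_tensorHom, tensorHom_comp_tensorHom_assoc,
      Category.id_comp, Category.comp_id, Category.assoc]
  have e₃ : (f ⊗ₘ ρ) ≫ A ◁ s = Δ₁ ◁ r ≫ (f ⊗ₘ ρ₁ ⊗ₘ ρ₂) := by
    simp [← id_tensorHom, h]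
  rw [e₂, reassoc_of% e₁]
  simp only [Category.assoc, Iso.inv_hom_id_assoc, reassoc_of% e₃]
  rw [← associator_inv_naturality_assoc]

/-- Reduces to the left case, applied to the distribution with its two sides exchanged, followed by
a braiding. -/
theorem distrib_natural_right {A Δ Δ₁ Δ₂ L L₁ L₂ M₁ M₂ K AL AL₂ : D} {q : Δ ⟶ Δ₁ ⊗ Δ₂}
    {f : Δ₁ ⟶ A} {ρ : Δ₂ ⟶ L} {s : L ⟶ L₁ ⊗ L₂} {r : Δ₂ ⟶ M₁ ⊗ M₂} {ρ₁ : M₁ ⟶ L₁}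
    {ρ₂ : M₂ ⟶ L₂} {x : Δ ⟶ K ⊗ M₁} {y : K ⟶ Δ₁ ⊗ M₂} (c : AL ≅ A ⊗ L) (c₂ : AL₂ ≅ A ⊗ L₂)
    (h : ρ ≫ s = r ≫ (ρ₁ ⊗ₘ ρ₂))
    (e : x ≫ y ▷ M₁ ≫ (α_ _ _ _).hom = q ≫ Δ₁ ◁ (r ≫ (β_ _ _).hom)) :
    (q ≫ (f ⊗ₘ ρ) ≫ c.inv) ≫ (c.hom ≫ A ◁ s ≫ (α_ _ _ _).inv ≫ (β_ _ _).hom ▷ L₂ ≫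
        (α_ _ _ _).hom ≫ L₁ ◁ c₂.inv) =
      (x ≫ (β_ _ _).hom) ≫ (ρ₁ ⊗ₘ (y ≫ (f ⊗ₘ ρ₂) ≫ c₂.inv)) := by
  have h' : ρ ≫ s ≫ (β_ _ _).hom = (r ≫ (β_ _ _).hom) ≫ (ρ₂ ⊗ₘ ρ₁) := by
    rw [reassoc_of% h, Category.assoc, BraidedCategory.braiding_naturality]
  have e' := distrib_natural_left (f := f) c c₂ h' e =≫ (β_ _ _).hom
  rw [Category.assoc x, ← BraidedCategory.braiding_naturality, ← Category.assoc x, ← e']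
  have b : A ◁ (β_ L₁ L₂).hom ≫ A ◁ (β_ L₂ L₁).hom = 𝟙 _ := by
    rw [← MonoidalCategory.whiskerLeft_comp, SymmetricCategory.symmetry,
      MonoidalCategory.whiskerLeft_id]
  simp [BraidedCategory.braiding_tensor_left_hom, reassoc_of% b]

theorem subst_single {Δ A : D} (t : Δ ⟶ A) :
    ((ρ_ Δ).inv ≫ (t ⊗ₘ 𝟙 (𝟙_ D)) ≫ (ρ_ A).hom) ≫ 𝟙 A = t := by
  simp [tensorHom_id]

/-- This lemma, `subst_letU` and `subst_letT` are the cases of `Interp.cTm_csub` in which the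
context is distributed; they are used with `D` a category of families, and `h` is then
`Interp.cSub_split`. -/
theorem subst_tens {Δ L L₁ L₂ M₁ M₂ A B AB : D} {ρ : Δ ⟶ L} {s : L ⟶ L₁ ⊗ L₂}
    {q : Δ ⟶ M₁ ⊗ M₂} {ρ₁ : M₁ ⟶ L₁} {ρ₂ : M₂ ⟶ L₂} (h : ρ ≫ s = q ≫ (ρ₁ ⊗ₘ ρ₂)) (f : L₁ ⟶ A)
    (g : L₂ ⟶ B) (c : A ⊗ B ⟶ AB) :
    q ≫ ((ρ₁ ≫ f) ⊗ₘ (ρ₂ ≫ g)) ≫ c = ρ ≫ s ≫ (f ⊗ₘ g) ≫ c := by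
  rw [reassoc_of% h]; simp

theorem subst_letU {Δ L L₁ L₂ M₁ M₂ A E : D} {ρ : Δ ⟶ L} {s : L ⟶ L₁ ⊗ L₂}
    {q : Δ ⟶ M₁ ⊗ M₂} {ρ₁ : M₁ ⟶ L₁} {ρ₂ : M₂ ⟶ L₂} (h : ρ ≫ s = q ≫ (ρ₁ ⊗ₘ ρ₂)) (f : L₁ ⟶ A)
    (c : A ⟶ 𝟙_ D) (g : L₂ ⟶ E) :
    q ≫ ((ρ₁ ≫ f) ⊗ₘ 𝟙 M₂) ≫ (c ▷ M₂ ≫ (λ_ _).hom) ≫ ρ₂ ≫ g =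
      ρ ≫ s ≫ (f ⊗ₘ 𝟙 L₂) ≫ (c ▷ L₂ ≫ (λ_ _).hom) ≫ g := by
  rw [reassoc_of% h]
  simp only [tensorHom_id]
  simp only [tensorHom_def', comp_whiskerRight, Category.assoc,
    ← leftUnitor_naturality_assoc, whisker_exchange_assoc]

theorem subst_letT {Δ L L₁ L₂ M₁ M₂ A B AB E BL ABL BM ABM : D} {ρ : Δ ⟶ L} {s : L ⟶ L₁ ⊗ L₂}
    {q : Δ ⟶ M₁ ⊗ M₂} {ρ₁ : M₁ ⟶ L₁} {ρ₂ : M₂ ⟶ L₂} (h : ρ ≫ s = q ≫ (ρ₁ ⊗ₘ ρ₂)) (f : L₁ ⟶ AB)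
    (c : AB ⟶ A ⊗ B) (d : BL ≅ B ⊗ L₂) (d' : ABL ≅ A ⊗ BL) (m : BM ≅ B ⊗ M₂)
    (m' : ABM ≅ A ⊗ BM) (g : ABL ⟶ E) :
    q ≫ ((ρ₁ ≫ f) ⊗ₘ 𝟙 M₂) ≫ (c ▷ M₂ ≫ (α_ _ _ _).hom ≫ _ ◁ m.inv ≫ m'.inv) ≫
        ((m'.hom ≫ A ◁ (m.hom ≫ B ◁ ρ₂ ≫ d.inv) ≫ d'.inv) ≫ g) =
      ρ ≫ s ≫ (f ⊗ₘ 𝟙 L₂) ≫ (c ▷ L₂ ≫ (α_ _ _ _).hom ≫ _ ◁ d.inv ≫ d'.inv) ≫ g := by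
  rw [reassoc_of% h]
  simp only [tensorHom_id]
  simp only [tensorHom_def', comp_whiskerRight, Category.assoc, MonoidalCategory.whiskerLeft_comp,
    Iso.inv_hom_id_assoc, whiskerLeft_inv_hom_assoc]
  simp only [whisker_exchange_assoc]
  simp

theorem subst_nil : 𝟙 (𝟙_ D) ≫ (λ_ (𝟙_ D)).inv = (λ_ (𝟙_ D)).inv ≫ (𝟙 (𝟙_ D) ⊗ₘ 𝟙 (𝟙_ D)) := by
  simp

theorem distrib_unitors {L A AL : D} (c : AL ≅ A ⊗ L) :
    c.hom ≫ A ◁ (λ_ L).inv ≫ (α_ _ _ _).inv ≫ (ρ_ A).hom ▷ L = c.hom := by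
  simp

theorem splitHom_left_allRight {α : Type u} (o : α → D) (a : α) (l : List α) :
    splitHom o (.left (.allRight l)) = (consIso o a l).hom := by
  rw [splitHom, splitHom_allRight]
  exact distrib_unitors (consIso o a l)

end SymmetricMonoidal

namespace Split

/-- A variable `l₂` makes induction on `p` possible; the two sides then have different types until
`l₁ = l` is known, whence the heterogeneous equality. -/
theorem heq_allLeft {α : Type u} {l l₁ l₂ : List α} (p : Split l l₁ l₂) (h : l₂ = []) :
    p ≍ (Split.allRight l).comm := by
  induction p with
  | nil => rfl
  | left s ih =>
    subst h
    obtain rfl := s.eq_left rfl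
    rw [eq_of_heq (ih rfl)]; rfl
  | right s ih => simp at h

theorem eq_allLeft {α : Type u} {l : List α} (p : Split l l []) : p = (Split.allRight l).comm :=
  eq_of_heq (p.heq_allLeft rfl)

end Split

-- Core substitution is interpreted by composition

section Interpretation

variable {H : Type u₁} [Category.{v₁} H] [CartesianMonoidalCategory H] [BraidedCategory H]
  {C : Type u₂} [Category.{v₂} C] [MonoidalCategory C] [SymmetricCategory C]
  [EnrichedSymmetricMonoidal H C]

theorem eConst_whiskerLeft {P : H} (A : C) {B B' : C} (g : B ⟶ B') :
    (eConst (A ◁ g) : P ⟶ _) = ePar (eConst (𝟙 A)) (eConst g) := by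
  rw [← id_tensorHom, eConst_tensor]

theorem eConst_whiskerRight {P : H} {A A' : C} (f : A ⟶ A') (B : C) :
    (eConst (f ▷ B) : P ⟶ _) = ePar (eConst f) (eConst (𝟙 B)) := by
  rw [← tensorHom_id, eConst_tensor]

/-- A constant isomorphism. -/
def Fam.constIso {P : H} {A B : C} (f : A ≅ B) : (Fam.of A : Fam C P) ≅ Fam.of B :=
  (Fam.const C P).mapIso f

variable [MonoidalClosed H] {Θ : TySys.{u}} {S : TmSig Θ} (I : Interp H C S)

/-- Naturality of `splitHom` is the core of the substitution lemma: distributing variables and then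
substituting agrees with substituting and then distributing. The induction takes place in the
category of families over `⟦Γ⟧`. -/
theorem Interp.cSub_split {Γ : List Θ.HTy} {Ω Ω₁ Ω₂ Δ : List Θ.CTy} (p : Split Ω Ω₁ Ω₂)
    (ρ : CSub S Γ Δ Ω) :
    eSeq (I.cSub ρ) (eConst (splitHom I.cObj p)) =
      eSeq (eConst (splitHom I.cObj (ρ.split p).2.2.1))
        (ePar (I.cSub (ρ.split p).2.2.2.1) (I.cSub (ρ.split p).2.2.2.2)) := by
  induction p generalizing Δ with
  | nil =>
    cases ρ
    exact subst_nil (D := Fam C (prodCtx I.hObj Γ))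
  | @left A L L₁ L₂ s ih =>
    cases ρ with
    | @cons _ _ Δ₁ Δ₂ _ _ p t ρ =>
      have e := congrArg (eConst (P := prodCtx I.hObj Γ))
        (splitHom_assoc I.cObj p (ρ.split s).2.2.1)
      simp only [eConst_comp, eConst_whiskerLeft, eConst_whiskerRight] at e
      simp only [Interp.cSub, splitHom]
      simp only [eConst_comp, eConst_whiskerLeft, eConst_whiskerRight]
      exact distrib_natural_left (D := Fam C (prodCtx I.hObj Γ)) (A := .of (I.cObj A))
        (Fam.constIso (consIso I.cObj A L)) (Fam.constIso (consIso I.cObj A L₁)) (ih ρ) e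
  | @right A L L₁ L₂ s ih =>
    cases ρ with
    | @cons _ _ Δ₁ Δ₂ _ _ p t ρ =>
      have e := congrArg (eConst (P := prodCtx I.hObj Γ))
        (splitHom_assoc I.cObj p (ρ.split s).2.2.1.comm)
      rw [splitHom_comm] at e
      simp only [eConst_comp, eConst_whiskerLeft, eConst_whiskerRight] at e
      -- Here `CSub.split` regroups on the left and then reverses the result, so the splitting in
      -- the goal is a `comm` and contributes a braiding.
      refine Eq.trans ?_ (congrArg (fun z => eSeq z _) ((congrArg eConst
        (splitHom_comm I.cObj (p.assoc (ρ.split s).2.2.1.comm).2.1)).trans (eConst_comp _ _)).symm)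
      simp only [Interp.cSub, splitHom]
      simp only [eConst_comp, eConst_whiskerLeft, eConst_whiskerRight]
      exact distrib_natural_right (D := Fam C (prodCtx I.hObj Γ)) (A := .of (I.cObj A))
        (Fam.constIso (consIso I.cObj A L)) (Fam.constIso (consIso I.cObj A L₂)) (ih ρ) e

theorem Interp.cSub_lift {Γ : List Θ.HTy} {Ω Δ : List Θ.CTy} (A : Θ.CTy) (ρ : CSub S Γ Δ Ω) :
    I.cSub (ρ.lift A) = eSeq (eConst (consIso I.cObj A Δ).hom)
      (eSeq (ePar (eConst (𝟙 _)) (I.cSub ρ)) (eConst (consIso I.cObj A Ω).inv)) := by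
  simp only [CSub.lift, Interp.cSub, splitHom_left_allRight, eConst_id]
  rfl

theorem Interp.cTm_head {Γ : List Θ.HTy} {Δ : List Θ.CTy} {A : Θ.CTy} (ρ : CSub S Γ Δ [A]) :
    I.cTm ρ.head = I.cSub ρ := by
  cases ρ with
  | @cons _ _ _ _ _ _ p t ρ =>
    cases ρ
    obtain rfl := p.eq_left rfl
    simp only [CSub.head, Interp.cSub, p.eq_allLeft, splitHom_allLeft]
    have h := subst_single (D := Fam C (prodCtx I.hObj Γ)) (A := .of (I.cObj A))
      (Δ := .of (tensCtx I.cObj _)) (I.cTm t)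
    rw [Category.comp_id] at h
    exact h.symm

mutual
/-- A core substitution is interpreted by composition. -/
theorem Interp.cTm_csub (I : Interp H C S) {Γ : List Θ.HTy} {Ω Δ : List Θ.CTy} {A : Θ.CTy} :
    (f : CTm S Γ Ω A) → (ρ : CSub S Γ Δ Ω) → I.cTm (f.csub ρ) = eSeq (I.cSub ρ) (I.cTm f)
  | .var, ρ => by
    rw [CTm.csub, Interp.cTm]
    exact (I.cTm_head ρ).trans
      ((eSeq_id (I.cSub ρ)).symm.trans (congrArg (eSeq (I.cSub ρ)) (eConst_id _)))
  | .sym k σ τ, ρ => by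
    simp only [CTm.csub, Interp.cTm, Interp.cSub_csub I τ _, eSeq_assoc]
  | .unit, .nil => by
    simp only [CTm.csub, Interp.cTm, Interp.cSub]
    exact (id_eSeq _).symm
  | .tens p f g, ρ => by
    simp only [CTm.csub, Interp.cTm, Interp.cTm_csub I f _, Interp.cTm_csub I g _]
    exact subst_tens (D := Fam C (prodCtx I.hObj Γ)) (I.cSub_split p ρ) (I.cTm f) (I.cTm g) _
  | .letT (Ω₂ := Ω₂) (A := A) (B := B) p f h, ρ => by
    simp only [CTm.csub, Interp.cTm, Interp.cTm_csub I f _, Interp.cTm_csub I h _, Interp.cSub_lift]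
    simp only [eConst_comp, eConst_whiskerLeft, eConst_whiskerRight]
    exact subst_letT (D := Fam C (prodCtx I.hObj Γ)) (I.cSub_split p ρ) (I.cTm f) _
      (A := .of (I.cObj A)) (B := .of (I.cObj B))
      (Fam.constIso (consIso I.cObj B Ω₂)) (Fam.constIso (consIso I.cObj A (B :: Ω₂)))
      (Fam.constIso (consIso I.cObj B _)) (Fam.constIso (consIso I.cObj A (B :: _))) (I.cTm h)
  | .letU (Ω₂ := Ω₂) p f h, ρ => by
    simp only [CTm.csub, Interp.cTm, Interp.cTm_csub I f _, Interp.cTm_csub I h _]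
    simp only [eConst_comp, eConst_whiskerLeft, eConst_whiskerRight]
    exact subst_letU (D := Fam C (prodCtx I.hObj Γ)) (I.cSub_split p ρ) (I.cTm f) _ (I.cTm h)
  | .der t g, ρ => by
    simp only [CTm.csub, Interp.cTm, Interp.cTm_csub I g _, eSeq_assoc]
theorem Interp.cSub_csub (I : Interp H C S) {Γ : List Θ.HTy} {Ω Ω' Δ : List Θ.CTy} :
    (τ : CSub S Γ Ω Ω') → (ρ : CSub S Γ Δ Ω) → I.cSub (τ.csub ρ) = eSeq (I.cSub ρ) (I.cSub τ)
  | .nil, .nil => by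
    simp only [CSub.csub, Interp.cSub]
    exact (id_eSeq _).symm
  | .cons p f τ, ρ => by
    simp only [CSub.csub, Interp.cSub, Interp.cTm_csub I f _, Interp.cSub_csub I τ _]
    exact subst_tens (D := Fam C (prodCtx I.hObj Γ)) (I.cSub_split p ρ) (I.cTm f) (I.cSub τ) _
end

end Interpretation

-- Projections and tuples for host contexts

section Ctx

variable {α : Type u} {H : Type u₁} [Category.{v₁} H] [CartesianMonoidalCategory H] (o : α → H)

theorem tuple_projVar {P : H} {Γ : List α} (f : ∀ X, HVar Γ X → (P ⟶ o X)) {X : α}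
    (x : HVar Γ X) : tuple o Γ f ≫ projVar o x = f X x := by
  induction x with
  | z => exact lift_fst _ _
  | s x ih => exact (lift_snd_assoc _ _ _).trans (ih fun Y y => f Y (.s y))

theorem comp_tuple {P Q : H} (g : Q ⟶ P) (Γ : List α) (f : ∀ X, HVar Γ X → (P ⟶ o X)) :
    g ≫ tuple o Γ f = tuple o Γ fun X x => g ≫ f X x := by
  induction Γ with
  | nil => exact toUnit_unique _ _
  | cons X Γ ih =>
    simp only [tuple, ← ih]
    exact comp_lift _ _ _

theorem prodCtx_hom_ext {P : H} {Γ : List α} {f g : P ⟶ prodCtx o Γ}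
    (h : ∀ X (x : HVar Γ X), f ≫ projVar o x = g ≫ projVar o x) : f = g := by
  induction Γ with
  | nil => exact toUnit_unique _ _
  | cons X Γ ih =>
    refine CartesianMonoidalCategory.hom_ext _ _ (h X .z) (ih fun Y y => ?_)
    exact (Category.assoc _ _ _).trans ((h Y (.s y)).trans (Category.assoc _ _ _).symm)

theorem tuple_projVar_id (Γ : List α) : tuple o Γ (fun _ x => projVar o x) = 𝟙 _ :=
  prodCtx_hom_ext o fun _ x => by rw [tuple_projVar, Category.id_comp]

end Ctx

-- Host substitution is interpreted by precomposition

section HostSubstitution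

variable {H : Type u₁} [Category.{v₁} H] [CartesianMonoidalCategory H] [BraidedCategory H]
  {C : Type u₂} [Category.{v₂} C] [MonoidalCategory C] [SymmetricCategory C]
  [EnrichedSymmetricMonoidal H C] [MonoidalClosed H] {Θ : TySys.{u}} {S : TmSig Θ}

/-- The interpretation of a renaming. -/
def Interp.renHom (I : Interp H C S) {Γ Δ : List Θ.HTy} (ρ : Ren Γ Δ) :
    prodCtx I.hObj Δ ⟶ prodCtx I.hObj Γ :=
  tuple I.hObj Γ fun _ x => projVar I.hObj (ρ _ x)

/-- The interpretation of a host substitution. -/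
noncomputable def Interp.subHom (I : Interp H C S) {Γ Δ : List Θ.HTy} (σ : HSub S Δ Γ) :
    prodCtx I.hObj Δ ⟶ prodCtx I.hObj Γ :=
  tuple I.hObj Γ fun _ x => I.hTm (σ _ x)

theorem Interp.renHom_lift (I : Interp H C S) {Γ Δ : List Θ.HTy} (ρ : Ren Γ Δ) (Y : Θ.HTy) :
    I.renHom (ρ.lift Y) = I.hObj Y ◁ I.renHom ρ := by
  refine CartesianMonoidalCategory.hom_ext _ _ ?_ ?_
  · exact (lift_fst _ _).trans (whiskerLeft_fst _ _).symm
  · exact (lift_snd _ _).trans ((comp_tuple _ _ _ _).symm.trans (whiskerLeft_snd _ _).symm)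

theorem Interp.renHom_weaken (I : Interp H C S) (Γ : List Θ.HTy) (Y : Θ.HTy) :
    I.renHom (fun _ => .s : Ren Γ (Y :: Γ)) = snd (I.hObj Y) (prodCtx I.hObj Γ) :=
  prodCtx_hom_ext _ fun _ _ => tuple_projVar _ _ _

-- Renamings are treated before substitutions, because lifting a substitution under a binder renames
-- its components.
mutual
theorem Interp.hTm_ren (I : Interp H C S) {Γ Δ : List Θ.HTy} {X : Θ.HTy} :
    (t : HTm S Γ X) → (ρ : Ren Γ Δ) → I.hTm (t.ren ρ) = I.renHom ρ ≫ I.hTm t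
  | .var x, ρ => by
    simp only [HTm.ren, Interp.hTm]
    exact (tuple_projVar I.hObj (fun _ x => projVar I.hObj (ρ _ x)) x).symm
  | .sym k σ, ρ => by
    simp only [HTm.ren, Interp.hTm, Interp.hTm_ren I (σ _ _) ρ, ← comp_tuple, Category.assoc]
  | .unit, ρ => by simp [HTm.ren, Interp.hTm]
  | .pair s t, ρ => by simp [HTm.ren, Interp.hTm, Interp.hTm_ren I s ρ, Interp.hTm_ren I t ρ,
      ← comp_lift_assoc]
  | .fst t, ρ => by simp [HTm.ren, Interp.hTm, Interp.hTm_ren I t ρ]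
  | .snd t, ρ => by simp [HTm.ren, Interp.hTm, Interp.hTm_ren I t ρ]
  | .lam t, ρ => by
    simp only [HTm.ren, Interp.hTm, Interp.hTm_ren I t _, Interp.renHom_lift]
    exact (congrArg (· ≫ _) (MonoidalClosed.curry_natural_left _ _)).trans (Category.assoc _ _ _)
  | .app t s, ρ => by
    simp [HTm.ren, Interp.hTm, Interp.hTm_ren I s ρ, Interp.hTm_ren I t ρ, ← comp_lift_assoc]
  | .promote f, ρ => by simp [HTm.ren, Interp.hTm, Interp.cTm_ren I f ρ]
theorem Interp.cTm_ren (I : Interp H C S) {Γ Δ : List Θ.HTy} {Ω : List Θ.CTy} {A : Θ.CTy} :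
    (f : CTm S Γ Ω A) → (ρ : Ren Γ Δ) → I.cTm (f.ren ρ) = I.renHom ρ ≫ I.cTm f
  | .var, ρ => by
    simp only [CTm.ren, Interp.cTm]
    exact (comp_toUnit_assoc _ _).symm
  | .sym k σ τ, ρ => by
    simp only [CTm.ren, Interp.cTm, Interp.hTm_ren I (σ _ _) ρ, ← comp_tuple, Category.assoc,
      Interp.cSub_ren I τ ρ, comp_eSeq]
  | .unit, ρ => by
    simp only [CTm.ren, Interp.cTm]
    exact (comp_eConst _ _).symm
  | .tens p f g, ρ => by
    simp only [CTm.ren, Interp.cTm, Interp.cTm_ren I f ρ, Interp.cTm_ren I g ρ, comp_eSeq,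
      comp_ePar, comp_eConst]
  | .letT p f g, ρ => by
    simp only [CTm.ren, Interp.cTm, Interp.cTm_ren I f ρ, Interp.cTm_ren I g ρ, comp_eSeq,
      comp_ePar, comp_eConst]
  | .letU p f g, ρ => by
    simp only [CTm.ren, Interp.cTm, Interp.cTm_ren I f ρ, Interp.cTm_ren I g ρ, comp_eSeq,
      comp_ePar, comp_eConst]
  | .der t g, ρ => by
    simp only [CTm.ren, Interp.cTm, Interp.hTm_ren I t ρ, Interp.cTm_ren I g ρ, comp_eSeq,
      Category.assoc]
theorem Interp.cSub_ren (I : Interp H C S) {Γ Δ : List Θ.HTy} {Ω Ω' : List Θ.CTy} :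
    (τ : CSub S Γ Ω Ω') → (ρ : Ren Γ Δ) → I.cSub (τ.ren ρ) = I.renHom ρ ≫ I.cSub τ
  | .nil, ρ => by
    simp only [CSub.ren, Interp.cSub]
    exact (comp_eConst _ _).symm
  | .cons p f τ, ρ => by
    simp only [CSub.ren, Interp.cSub, Interp.cTm_ren I f ρ, Interp.cSub_ren I τ ρ, comp_eSeq,
      comp_ePar, comp_eConst]
end

theorem Interp.subHom_lift (I : Interp H C S) {Γ Δ : List Θ.HTy} (σ : HSub S Δ Γ) (Y : Θ.HTy) :
    I.subHom (σ.lift Y) = I.hObj Y ◁ I.subHom σ := by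
  refine CartesianMonoidalCategory.hom_ext _ _ ?_ ?_
  · refine (lift_fst _ _).trans (Eq.trans ?_ (whiskerLeft_fst _ _).symm)
    simp only [HSub.lift, Interp.hTm]
    rfl
  · refine (lift_snd _ _).trans (Eq.trans ?_ (whiskerLeft_snd _ _).symm)
    exact (congrArg (tuple I.hObj Γ) (funext fun X => funext fun x =>
      (I.hTm_ren (σ X x) _).trans (congrArg (· ≫ I.hTm (σ X x)) (I.renHom_weaken Δ Y)))).trans
        (comp_tuple _ _ _ _).symm

mutual
theorem Interp.hTm_sub (I : Interp H C S) {Γ Δ : List Θ.HTy} {X : Θ.HTy} :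
    (t : HTm S Γ X) → (ρ : HSub S Δ Γ) → I.hTm (t.sub ρ) = I.subHom ρ ≫ I.hTm t
  | .var x, ρ => by
    simp only [HTm.sub, Interp.hTm]
    exact (tuple_projVar I.hObj (fun _ x => I.hTm (ρ _ x)) x).symm
  | .sym k σ, ρ => by
    simp only [HTm.sub, Interp.hTm, Interp.hTm_sub I (σ _ _) ρ, ← comp_tuple, Category.assoc]
  | .unit, ρ => by simp [HTm.sub, Interp.hTm]
  | .pair s t, ρ => by simp [HTm.sub, Interp.hTm, Interp.hTm_sub I s ρ, Interp.hTm_sub I t ρ,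
      ← comp_lift_assoc]
  | .fst t, ρ => by simp [HTm.sub, Interp.hTm, Interp.hTm_sub I t ρ]
  | .snd t, ρ => by simp [HTm.sub, Interp.hTm, Interp.hTm_sub I t ρ]
  | .lam t, ρ => by
    simp only [HTm.sub, Interp.hTm, Interp.hTm_sub I t _, Interp.subHom_lift]
    exact (congrArg (· ≫ _) (MonoidalClosed.curry_natural_left _ _)).trans (Category.assoc _ _ _)
  | .app t s, ρ => by
    simp [HTm.sub, Interp.hTm, Interp.hTm_sub I s ρ, Interp.hTm_sub I t ρ, ← comp_lift_assoc]
  | .promote f, ρ => by simp [HTm.sub, Interp.hTm, Interp.cTm_hsub I f ρ]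
theorem Interp.cTm_hsub (I : Interp H C S) {Γ Δ : List Θ.HTy} {Ω : List Θ.CTy} {A : Θ.CTy} :
    (f : CTm S Γ Ω A) → (ρ : HSub S Δ Γ) → I.cTm (f.hsub ρ) = I.subHom ρ ≫ I.cTm f
  | .var, ρ => by
    simp only [CTm.hsub, Interp.cTm]
    exact (comp_toUnit_assoc _ _).symm
  | .sym k σ τ, ρ => by
    simp only [CTm.hsub, Interp.cTm, Interp.hTm_sub I (σ _ _) ρ, ← comp_tuple, Category.assoc,
      Interp.cSub_hsub I τ ρ, comp_eSeq]
  | .unit, ρ => by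
    simp only [CTm.hsub, Interp.cTm]
    exact (comp_eConst _ _).symm
  | .tens p f g, ρ => by
    simp only [CTm.hsub, Interp.cTm, Interp.cTm_hsub I f ρ, Interp.cTm_hsub I g ρ, comp_eSeq,
      comp_ePar, comp_eConst]
  | .letT p f g, ρ => by
    simp only [CTm.hsub, Interp.cTm, Interp.cTm_hsub I f ρ, Interp.cTm_hsub I g ρ, comp_eSeq,
      comp_ePar, comp_eConst]
  | .letU p f g, ρ => by
    simp only [CTm.hsub, Interp.cTm, Interp.cTm_hsub I f ρ, Interp.cTm_hsub I g ρ, comp_eSeq,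
      comp_ePar, comp_eConst]
  | .der t g, ρ => by
    simp only [CTm.hsub, Interp.cTm, Interp.hTm_sub I t ρ, Interp.cTm_hsub I g ρ, comp_eSeq,
      Category.assoc]
theorem Interp.cSub_hsub (I : Interp H C S) {Γ Δ : List Θ.HTy} {Ω Ω' : List Θ.CTy} :
    (τ : CSub S Γ Ω Ω') → (ρ : HSub S Δ Γ) → I.cSub (τ.hsub ρ) = I.subHom ρ ≫ I.cSub τ
  | .nil, ρ => by
    simp only [CSub.hsub, Interp.cSub]
    exact (comp_eConst _ _).symm
  | .cons p f τ, ρ => by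
    simp only [CSub.hsub, Interp.cSub, Interp.cTm_hsub I f ρ, Interp.cSub_hsub I τ ρ, comp_eSeq,
      comp_ePar, comp_eConst]
end

theorem Interp.subHom_id (I : Interp H C S) (Γ : List Θ.HTy) :
    I.subHom (HSub.id Γ) = 𝟙 _ := by
  simp only [Interp.subHom, HSub.id, Interp.hTm]
  exact tuple_projVar_id _ _

theorem Interp.subHom_cons (I : Interp H C S) {Γ Δ : List Θ.HTy} {Y : Θ.HTy} (t : HTm S Δ Y)
    (σ : HSub S Δ Γ) : I.subHom (.cons t σ) = lift (I.hTm t) (I.subHom σ) := rfl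

end HostSubstitution

-- The rules for `let`, as equations in a monoidal category

section SymmetricMonoidal

variable {D : Type u₂} [Category.{v₂} D] [MonoidalCategory D]

/-- In the application `i` identifies `⟦A⟧ ⊗ ⟦B⟧` with the interpretation of the type `A ⊗ B`, and
`e` is `splitHom_assoc` for the two splittings of the rule. -/
theorem sound_letT_tens {Δ K L M A B AB BL ABL E N : D} {x : Δ ⟶ K ⊗ L} {y : K ⟶ N ⊗ M}
    {P : D} {p : Δ ⟶ N ⊗ P} {q : P ⟶ M ⊗ L} (e : x ≫ y ▷ L ≫ (α_ _ _ _).hom = p ≫ N ◁ q)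
    (g : N ⟶ A) (h : M ⟶ B) (i : A ⊗ B ≅ AB) (c : BL ≅ B ⊗ L) (d : ABL ≅ A ⊗ BL) (f : ABL ⟶ E) :
    x ≫ ((y ≫ (g ⊗ₘ h) ≫ i.hom) ⊗ₘ 𝟙 L) ≫
        (i.inv ▷ L ≫ (α_ _ _ _).hom ≫ A ◁ c.inv ≫ d.inv) ≫ f =
      (p ≫ (g ⊗ₘ (q ≫ (h ⊗ₘ 𝟙 L) ≫ c.inv)) ≫ d.inv) ≫ f := by
  have h₁ : p ≫ (g ⊗ₘ (q ≫ (h ⊗ₘ 𝟙 L) ≫ c.inv)) = (p ≫ N ◁ q) ≫ (g ⊗ₘ h ⊗ₘ 𝟙 L) ≫ A ◁ c.inv := by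
    simp only [← id_tensorHom, Category.assoc, tensorHom_comp_tensorHom, Category.id_comp,
      Category.comp_id]
  simp only [Category.assoc, reassoc_of% h₁]
  rw [← reassoc_of% e]
  simp only [tensorHom_id, comp_whiskerRight, Category.assoc, hom_inv_whiskerRight_assoc]
  rw [← tensorHom_id (g ⊗ₘ h), ← tensorHom_id h, associator_naturality_assoc]

theorem sound_letT_eta {Δ N L A B AB BL ABL E CL : D} (p : Δ ⟶ N ⊗ L) (g : N ⟶ AB)
    (i : A ⊗ B ≅ AB) (c : BL ≅ B ⊗ L) (d : ABL ≅ A ⊗ BL) (k : CL ≅ AB ⊗ L) (f : CL ⟶ E) :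
    p ≫ (g ⊗ₘ 𝟙 L) ≫ (i.inv ▷ L ≫ (α_ _ _ _).hom ≫ A ◁ c.inv ≫ d.inv) ≫
        (((d.hom ≫ A ◁ c.hom ≫ (α_ _ _ _).inv) ≫ (i.hom ⊗ₘ 𝟙 L) ≫ k.inv) ≫ f) =
      (p ≫ (g ⊗ₘ 𝟙 L) ≫ k.inv) ≫ f := by
  simp

theorem sound_letU_unit {L U E : D} (i : 𝟙_ D ≅ U) (f : L ⟶ E) :
    (λ_ L).inv ≫ (i.hom ⊗ₘ 𝟙 L) ≫ (i.inv ▷ L ≫ (λ_ L).hom) ≫ f = f := by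
  simp

theorem sound_letU_eta {Δ N L U E CL : D} (p : Δ ⟶ N ⊗ L) (g : N ⟶ U)
    (i : 𝟙_ D ≅ U) (k : CL ≅ U ⊗ L) (f : CL ⟶ E) :
    p ≫ (g ⊗ₘ 𝟙 L) ≫ (i.inv ▷ L ≫ (λ_ L).hom) ≫ (((λ_ L).inv ≫ (i.hom ⊗ₘ 𝟙 L) ≫ k.inv) ≫ f) =
      (p ≫ (g ⊗ₘ 𝟙 L) ≫ k.inv) ≫ f := by
  simp

theorem distrib_two {A B L BL ABL : D} (c : BL ≅ B ⊗ L) (d : ABL ≅ A ⊗ BL) :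
    d.hom ≫ A ◁ c.hom ≫ (α_ _ _ _).inv ≫ 𝟙 (A ⊗ B) ▷ L =
      d.hom ≫ A ◁ c.hom ≫ (α_ _ _ _).inv := by
  simp

theorem splitHom_left_left_allRight [SymmetricCategory D] {α : Type u} (o : α → D) (a b : α)
    (l : List α) : splitHom o (.left (a := a) (.left (a := b) (.allRight l))) =
      (consIso o a (b :: l)).hom ≫ o a ◁ (consIso o b l).hom ≫ (α_ _ _ _).inv := by
  rw [splitHom, splitHom_left_allRight]
  exact distrib_two (consIso o b l) (consIso o a (b :: l))

end SymmetricMonoidal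

-- Soundness

section Interpretation

variable {H : Type u₁} [Category.{v₁} H] [CartesianMonoidalCategory H] [BraidedCategory H]
  {C : Type u₂} [Category.{v₂} C] [MonoidalCategory C] [SymmetricCategory C]
  [EnrichedSymmetricMonoidal H C] [MonoidalClosed H] {Θ : TySys.{u}} {S : TmSig Θ}

theorem Interp.cTm_var (I : Interp H C S) (Γ : List Θ.HTy) (A : Θ.CTy) :
    I.cTm (.var : CTm S Γ [A] A) = eConst (𝟙 (I.cObj A)) := by
  rw [Interp.cTm]
  exact (eConst_id _).symm

theorem Interp.cSub_id (I : Interp H C S) (Γ : List Θ.HTy) (Ω : List Θ.CTy) :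
    I.cSub (CSub.id Ω : CSub S Γ Ω Ω) = eConst (𝟙 _) := by
  induction Ω with
  | nil =>
    simp only [CSub.id, Interp.cSub]
    rfl
  | cons A Ω ih =>
    rw [CSub.id, Interp.cSub_lift, ih, ← eConst_tensor, ← eConst_comp, ← eConst_comp,
      id_tensorHom_id, Category.id_comp, Iso.hom_inv_id]

theorem eConst_eqToHom_eSeq {P : H} {A A' B : C} (h : A = A') (f : P ⟶ (A ⟶[H] B))
    (h' : (A ⟶[H] B) = (A' ⟶[H] B)) : eSeq (eConst (eqToHom h)) (f ≫ eqToHom h') = f := by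
  subst h
  simp only [eqToHom_refl, Category.comp_id, id_eSeq]

/-- `tensorTy` and `tensCtx` both associate to the right and do not pad a one-element context with a
unit, so an identification of equal objects suffices and no structural isomorphism intervenes. -/
theorem Interp.cTm_tensVars (I : Interp H C S) (Γ : List Θ.HTy) (Ω : List Θ.CTy) :
    I.cTm (CTm.tensVars Ω : CTm S Γ Ω _) = eConst (eqToHom (I.cObj_tensorTy Ω).symm) := by
  match Ω with
  | [] =>
    have h : I.cTm (.unit : CTm S Γ [] _) = eConst (eqToHom I.cObj_unit.symm) := by
      rw [Interp.cTm]
      rfl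
    exact h
  | [A] => exact I.cTm_var Γ A
  | A :: B :: Ω =>
    have e {X Y Z : C} (h : X = Y) (h' : I.cObj A ⊗ Y = Z) (h'' : I.cObj A ⊗ X = Z) :
        I.cObj A ◁ eqToHom h ≫ eqToHom h' = eqToHom h'' := by
      subst h h'
      simp
    have h : I.cTm (.tens (.left (.allRight (B :: Ω))) .var (CTm.tensVars (B :: Ω)) :
        CTm S Γ (A :: B :: Ω) _) = eConst (𝟙 _ ≫ (𝟙 _ ⊗ₘ eqToHom (I.cObj_tensorTy (B :: Ω)).symm) ≫
          eqToHom (I.cObj_tens _ _).symm) := by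
      rw [Interp.cTm, splitHom_left_allRight, I.cTm_tensVars Γ (B :: Ω), Interp.cTm_var,
        eConst_comp, eConst_comp, eConst_tensor]
      rfl
    refine h.trans (congrArg eConst ?_)
    rw [Category.id_comp, id_tensorHom]
    exact e _ _ _

theorem Interp.promote_der (I : Interp H C S) {Γ : List Θ.HTy} {A B : Θ.CTy}
    (t : HTm S Γ (.proof A B)) : I.hTm (.promote (Ω := [A]) (.der t .var)) = I.hTm t := by
  rw [Interp.hTm, Interp.cTm, Interp.cTm_var]
  refine (congrArg (· ≫ _) (id_eSeq (I.hTm t ≫ eqToHom _))).trans ?_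
  exact (Category.assoc _ _ _).trans ((congrArg (I.hTm t ≫ ·)
    ((eqToHom_trans _ _).trans (eqToHom_refl _ _))).trans (Category.comp_id _))

variable {T : Theory.{u}}

-- Induction on derivations. Congruence holds since the interpretation is compositional, closure
-- under substitution by the substitution lemmas, `β` and `η` on the host side by the universal
-- properties, and the rules for `let` by the preceding equations in the category of families.
mutual
theorem Interp.IsModel.hTm_eq {I : Interp H C T.sig} (hI : I.IsModel) {Γ : List T.ty.HTy}
    {X : T.ty.HTy} {s t : HTm T.sig Γ X} : T.HEqn s t → I.hTm s = I.hTm t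
  | .ax h => hI.hAx _ _ h
  | .refl _ => rfl
  | .symm h => (Interp.IsModel.hTm_eq hI h).symm
  | .trans h h' => (Interp.IsModel.hTm_eq hI h).trans (Interp.IsModel.hTm_eq hI h')
  | .sub h hσ => by
    rw [I.hTm_sub, I.hTm_sub, Interp.IsModel.hTm_eq hI h]
    simp only [Interp.subHom, fun Y x => Interp.IsModel.hTm_eq hI (hσ Y x)]
  | .sym k hσ => by
    simp only [Interp.hTm, fun Y x => Interp.IsModel.hTm_eq hI (hσ Y x)]
  | .pair h h' => by
    simp only [Interp.hTm, Interp.IsModel.hTm_eq hI h, Interp.IsModel.hTm_eq hI h']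
  | .fst h => by simp only [Interp.hTm, Interp.IsModel.hTm_eq hI h]
  | .snd h => by simp only [Interp.hTm, Interp.IsModel.hTm_eq hI h]
  | .lam h => by simp only [Interp.hTm, Interp.IsModel.hTm_eq hI h]
  | .app h h' => by
    simp only [Interp.hTm, Interp.IsModel.hTm_eq hI h, Interp.IsModel.hTm_eq hI h']
  | .promote h => by simp only [Interp.hTm, Interp.IsModel.cTm_eq hI h]
  | .unit_eta t => by
    rw [← cancel_mono (eqToHom I.hObj_unit)]
    exact toUnit_unique _ _
  | .fst_pair s t => by simp [Interp.hTm]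
  | .snd_pair s t => by simp [Interp.hTm]
  | .pair_eta t => by
    rw [← cancel_mono (eqToHom (I.hObj_prod _ _))]
    ext <;> simp [Interp.hTm]
  | .app_lam (X := X) t s => by
    rw [Interp.hTm_sub, Interp.subHom_cons, Interp.subHom_id]
    simp only [Interp.hTm, Category.assoc, eqToHom_trans, eqToHom_refl, Category.comp_id]
    have h : lift (I.hTm s) (MonoidalClosed.curry (I.hTm t)) =
        lift (I.hTm s) (𝟙 _) ≫ I.hObj X ◁ MonoidalClosed.curry (I.hTm t) := by simp
    rw [h, Category.assoc]
    exact congrArg (lift (I.hTm s) (𝟙 _) ≫ ·) (MonoidalClosed.whiskerLeft_curry_ihom_ev_app _ _ _)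
  | .lam_eta (X := X) t => by
    have hr : I.hTm (t.ren fun _ => .s) = snd (I.hObj X) _ ≫ I.hTm t :=
      (I.hTm_ren t _).trans (congrArg (· ≫ I.hTm t) (I.renHom_weaken Γ X))
    simp only [Interp.hTm]
    rw [← cancel_mono (eqToHom (I.hObj_arr _ _))]
    simp only [Category.assoc, eqToHom_trans, eqToHom_refl, Category.comp_id]
    refine (MonoidalClosed.curry_eq_iff _ _).2 ?_
    rw [MonoidalClosed.uncurry_eq]
    refine congrArg (· ≫ _) ?_
    refine CartesianMonoidalCategory.hom_ext _ _ ?_ ?_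
    · exact (lift_fst _ _).trans (whiskerLeft_fst _ _).symm
    · exact (lift_snd _ _).trans (((congrArg (· ≫ _) hr).trans (Category.assoc _ _ _)).trans
        (whiskerLeft_snd _ _).symm)
  | .promote_der t => I.promote_der t
theorem Interp.IsModel.cTm_eq {I : Interp H C T.sig} (hI : I.IsModel) {Γ : List T.ty.HTy}
    {Ω : List T.ty.CTy} {A : T.ty.CTy} {f g : CTm T.sig Γ Ω A} : T.CEqn f g → I.cTm f = I.cTm g
  | .ax h => hI.cAx _ _ h
  | .refl _ => rfl
  | .symm h => (Interp.IsModel.cTm_eq hI h).symm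
  | .trans h h' => (Interp.IsModel.cTm_eq hI h).trans (Interp.IsModel.cTm_eq hI h')
  | .hsub h hσ => by
    rw [I.cTm_hsub, I.cTm_hsub, Interp.IsModel.cTm_eq hI h]
    simp only [Interp.subHom, fun Y x => Interp.IsModel.hTm_eq hI (hσ Y x)]
  | .csub h hρ => by
    rw [I.cTm_csub, I.cTm_csub, Interp.IsModel.cTm_eq hI h, Interp.IsModel.cSub_eq hI hρ]
  | .sym k hσ hρ => by
    simp only [Interp.cTm, fun Y x => Interp.IsModel.hTm_eq hI (hσ Y x),
      Interp.IsModel.cSub_eq hI hρ]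
  | .tens p h h' => by
    simp only [Interp.cTm, Interp.IsModel.cTm_eq hI h, Interp.IsModel.cTm_eq hI h']
  | .letT p h h' => by
    simp only [Interp.cTm, Interp.IsModel.cTm_eq hI h, Interp.IsModel.cTm_eq hI h']
  | .letU p h h' => by
    simp only [Interp.cTm, Interp.IsModel.cTm_eq hI h, Interp.IsModel.cTm_eq hI h']
  | .der h h' => by
    simp only [Interp.cTm, Interp.IsModel.hTm_eq hI h, Interp.IsModel.cTm_eq hI h']
  | .letT_tens (Ω₁ := Ω₁) (A := A) (B := B) p q f g h => by
    have e := congrArg (eConst (P := prodCtx I.hObj Γ)) (splitHom_assoc I.cObj p q)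
    simp only [eConst_comp, eConst_whiskerLeft, eConst_whiskerRight] at e
    simp only [Interp.cTm_csub, Interp.cTm, Interp.cSub, Interp.cSub_id, eConst_comp,
      eConst_whiskerLeft, eConst_whiskerRight]
    exact sound_letT_tens (D := Fam C (prodCtx I.hObj Γ)) e (I.cTm g) (I.cTm h)
      (A := .of (I.cObj A)) (B := .of (I.cObj B)) (Fam.constIso (eqToIso (I.cObj_tens A B).symm))
      (Fam.constIso (consIso I.cObj B Ω₁)) (Fam.constIso (consIso I.cObj A (B :: Ω₁))) (I.cTm f)
  | .letT_eta (Ω₁ := Ω₁) (A := A) (B := B) p f g => by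
    -- The term `a ⊗ b` is `tensVars [A, B]`, the two splittings being equal by computation.
    have hv : I.cTm (.tens (.left (.right .nil)) .var .var : CTm T.sig Γ [A, B] (.tens A B)) =
        eConst (eqToHom (I.cObj_tens A B).symm) := I.cTm_tensVars Γ [A, B]
    have hs := (congrArg (eConst (P := prodCtx I.hObj Γ))
      (splitHom_left_left_allRight I.cObj A B Ω₁)).trans ((eConst_comp _ _).trans
        (congrArg (eSeq _) ((eConst_comp _ _).trans
          (congrArg (fun z => eSeq z _) (eConst_whiskerLeft _ _)))))
    rw [Interp.cTm, Interp.cTm_csub, Interp.cTm_csub, Interp.cSub, Interp.cSub, hv, hs,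
      Interp.cSub_id]
    simp only [eConst_comp, eConst_whiskerLeft, eConst_whiskerRight]
    exact sound_letT_eta (D := Fam C (prodCtx I.hObj Γ)) (eConst (splitHom I.cObj p)) (I.cTm g)
      (A := .of (I.cObj A)) (B := .of (I.cObj B)) (Fam.constIso (eqToIso (I.cObj_tens A B).symm))
      (Fam.constIso (consIso I.cObj B Ω₁)) (Fam.constIso (consIso I.cObj A (B :: Ω₁)))
      (Fam.constIso (consIso I.cObj (.tens A B) Ω₁)) (I.cTm f)
  | .letU_unit f => by
    simp only [Interp.cTm, splitHom_allRight, eConst_comp, eConst_whiskerRight]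
    exact sound_letU_unit (D := Fam C (prodCtx I.hObj Γ))
      (Fam.constIso (eqToIso I.cObj_unit.symm)) (I.cTm f)
  | .letU_eta (Ω₁ := Ω₁) p f g => by
    simp only [Interp.cTm_csub, Interp.cTm, Interp.cSub, Interp.cSub_id, eConst_comp,
      eConst_whiskerRight, splitHom_allRight]
    exact sound_letU_eta (D := Fam C (prodCtx I.hObj Γ)) (eConst (splitHom I.cObj p)) (I.cTm g)
      (Fam.constIso (eqToIso I.cObj_unit.symm)) (Fam.constIso (consIso I.cObj .unit Ω₁)) (I.cTm f)
  | .der_promote f => by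
    simp only [Interp.cTm, Interp.hTm, Interp.cTm_tensVars, Category.assoc, eqToHom_trans]
    exact eConst_eqToHom_eSeq _ _ _
theorem Interp.IsModel.cSub_eq {I : Interp H C T.sig} (hI : I.IsModel) {Γ : List T.ty.HTy}
    {Δ Ω : List T.ty.CTy} {ρ τ : CSub T.sig Γ Δ Ω} : T.CSubEqn ρ τ → I.cSub ρ = I.cSub τ
  | .nil => rfl
  | .cons p h h' => by
    simp only [Interp.cSub, Interp.IsModel.cTm_eq hI h, Interp.IsModel.cSub_eq hI h']
end

end Interpretation

-- Algebra of splittings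

namespace Split

variable {α : Type u}

theorem comm_comm {l l₁ l₂ : List α} (p : Split l l₁ l₂) : p.comm.comm = p := by
  induction p with
  | nil => rfl
  | left s ih => exact congrArg left ih
  | right s ih => exact congrArg right ih

/-- The distribution of all variables to the left. -/
abbrev allLeft (l : List α) : Split l l [] := (allRight l).comm

/-- The intermediate context is part of the value of `assoc`, so identities about regrouping are
equalities of dependent pairs. This form avoids transport and is suited to rewriting inside
`CSub.split`. -/
theorem assoc_allRight {l l₁ m : List α} (p : Split l l₁ m) :
    p.assoc (allRight m) = ⟨l₁, p, allLeft l₁⟩ := by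
  induction p with
  | nil => rfl
  | left s ih => rw [assoc, ih]; rfl
  | right s ih => rw [allRight, assoc, ih]

theorem assoc_allLeft {l l₁ m : List α} (p : Split l l₁ m) :
    p.assoc (allLeft m) = ⟨l, allLeft l, p⟩ := by
  induction p with
  | nil => rfl
  | left s ih => rw [assoc, ih]; rfl
  | right s ih =>
    change assoc (right s) (left (allLeft _)) = _
    rw [assoc, ih]
    rfl

/-- The inverse of `assoc`. -/
def coassoc {l k l₁ m₁ m₂ : List α} :
    Split l k m₂ → Split k l₁ m₁ → (m : List α) × Split l l₁ m × Split m m₁ m₂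
  | nil, nil => ⟨[], nil, nil⟩
  | left s, left t => let r := coassoc s t; ⟨_, left r.2.1, r.2.2⟩
  | left s, right t => let r := coassoc s t; ⟨_, right r.2.1, left r.2.2⟩
  | right s, t => let r := coassoc s t; ⟨_, right r.2.1, right r.2.2⟩

theorem assoc_coassoc {l k l₁ m₁ m₂ : List α} (p : Split l k m₂) (q : Split k l₁ m₁) :
    (p.coassoc q).2.1.assoc (p.coassoc q).2.2 = ⟨k, p, q⟩ := by
  induction p generalizing l₁ m₁ with
  | nil => cases q; rfl
  | left s ih =>
    cases q with
    | left t =>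
      change assoc (left (s.coassoc t).2.1) (s.coassoc t).2.2 = _
      rw [assoc, ih t]
    | right t =>
      change assoc (right (s.coassoc t).2.1) (left (s.coassoc t).2.2) = _
      rw [assoc, ih t]
  | right s ih =>
    change assoc (right (s.coassoc q).2.1) (right (s.coassoc q).2.2) = _
    rw [assoc, ih q]

end Split

-- Syntactic identities of core substitution

section CoreSubstitution

variable {Θ : TySys.{u}} {S : TmSig Θ} {Γ : List Θ.HTy}

/-- The substitution of a term for the only variable. -/
def CSub.single {Δ : List Θ.CTy} {A : Θ.CTy} (f : CTm S Γ Δ A) : CSub S Γ Δ [A] :=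
  .cons (.allLeft Δ) f .nil

theorem CSub.split_allLeft {Δ Ω : List Θ.CTy} (ρ : CSub S Γ Δ Ω) :
    ρ.split (.allLeft Ω) = ⟨Δ, [], .allLeft Δ, ρ, .nil⟩ := by
  match ρ with
  | .nil => rfl
  | .cons (Ω := Ω) p t ρ =>
    change CSub.split (.left (.allLeft Ω)) (.cons p t ρ) = _
    rw [CSub.split, CSub.split_allLeft ρ]
    simp only
    rw [Split.assoc_allLeft]

theorem CSub.split_allRight {Δ Ω : List Θ.CTy} (ρ : CSub S Γ Δ Ω) :
    ρ.split (.allRight Ω) = ⟨[], Δ, .allRight Δ, .nil, ρ⟩ := by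
  match ρ with
  | .nil => rfl
  | .cons (Ω := Ω) p t ρ =>
    change CSub.split (.right (.allRight Ω)) (.cons p t ρ) = _
    rw [CSub.split, CSub.split_allRight ρ]
    simp only
    rw [Split.assoc_allLeft]
    simp only [Split.comm_comm]

theorem CSub.split_left_allRight {Δ Δ₁ Δ₂ Ω : List Θ.CTy} {A : Θ.CTy} (p : Split Δ Δ₁ Δ₂)
    (f : CTm S Γ Δ₁ A) (ρ : CSub S Γ Δ₂ Ω) :
    (CSub.cons p f ρ).split (.left (.allRight Ω)) = ⟨Δ₁, Δ₂, p, .single f, ρ⟩ := by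
  rw [CSub.split, CSub.split_allRight ρ]
  simp only
  rw [Split.assoc_allRight]
  rfl

/-- The term `f₁ ⊗ ⋯ ⊗ fₙ` for a list of terms. -/
def CSub.pack {Δ : List Θ.CTy} : (Ω : List Θ.CTy) → CSub S Γ Δ Ω → CTm S Γ Δ (tensorTy Ω)
  | [], .nil => .unit
  | [_], ρ => ρ.head
  | _ :: B :: Ω, .cons p f ρ => .tens p f (pack (B :: Ω) ρ)

theorem CTm.tens_csub_cons {Δ Δ₁ Δ₂ Ω : List Θ.CTy} {A A' B : Θ.CTy} (p : Split Δ Δ₁ Δ₂)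
    (f : CTm S Γ Δ₁ A) (ρ : CSub S Γ Δ₂ Ω) (x : CTm S Γ [A] A') (y : CTm S Γ Ω B) :
    (CTm.tens (.left (.allRight Ω)) x y).csub (.cons p f ρ) =
      .tens p (x.csub (.single f)) (y.csub ρ) := by
  rw [CTm.csub, CSub.split_left_allRight]

theorem CTm.tensVars_csub {Δ Ω : List Θ.CTy} (ρ : CSub S Γ Δ Ω) :
    (CTm.tensVars Ω).csub ρ = ρ.pack := by
  match Ω, ρ with
  | [], .nil => rfl
  | [A], .cons p f .nil => rfl
  | A :: B :: Ω, .cons p f ρ =>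
    exact (CTm.tens_csub_cons (Ω := B :: Ω) p f ρ .var (tensVars (B :: Ω))).trans
      (congrArg (CTm.tens p _) (tensVars_csub ρ))

theorem CSub.pack_id (Ω : List Θ.CTy) : (CSub.id Ω : CSub S Γ Ω Ω).pack = CTm.tensVars Ω := by
  match Ω with
  | [] => rfl
  | [A] => rfl
  | A :: B :: Ω => exact congrArg (CTm.tens _ _) (CSub.pack_id (B :: Ω))

theorem CSub.cons_csub {Δ Ω Ω' : List Θ.CTy} {A : Θ.CTy} {Ω₁ Ω₂ : List Θ.CTy}
    (p : Split Ω Ω₁ Ω₂) (f : CTm S Γ Ω₁ A) (ρ : CSub S Γ Ω₂ Ω') (τ : CSub S Γ Δ Ω) :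
    (CSub.cons p f ρ).csub τ = .cons (τ.split p).2.2.1 (f.csub (τ.split p).2.2.2.1)
      (ρ.csub (τ.split p).2.2.2.2) := by
  rw [CSub.csub]

theorem CSub.single_csub {Δ Ω : List Θ.CTy} {A : Θ.CTy} (f : CTm S Γ Ω A) (τ : CSub S Γ Δ Ω) :
    (CSub.single f).csub τ = .single (f.csub τ) := by
  rw [CSub.single, CSub.cons_csub, CSub.split_allLeft]
  rfl

theorem CSub.eq_single {Δ : List Θ.CTy} {A : Θ.CTy} (ρ : CSub S Γ Δ [A]) :
    ρ = .single ρ.head := by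
  match ρ with
  | .cons p t .nil =>
    obtain rfl := p.eq_left rfl
    rw [p.eq_allLeft]
    rfl

/-- An equality of terms, not merely a derivable one: substitution passes through a tensor product
by definition. It is the only associativity of substitution that has to be checked on the syntax. -/
theorem CSub.pack_csub {Δ Ω Ω' : List Θ.CTy} (ρ : CSub S Γ Ω Ω') (τ : CSub S Γ Δ Ω) :
    ρ.pack.csub τ = (ρ.csub τ).pack := by
  match Ω', Ω, ρ with
  | [], _, .nil => cases τ; rfl
  | [A], _, ρ =>
    rw [ρ.eq_single, CSub.single_csub]
    rfl
  | A :: B :: Ω, _, .cons p f ρ =>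
    rw [CSub.cons_csub]
    exact congrArg (CTm.tens _ _) (CSub.pack_csub ρ _)

theorem CSub.lift_csub_cons {Δ Δ₁ Δ₂ Ω Ω' : List Θ.CTy} {A : Θ.CTy} (ρ : CSub S Γ Ω Ω')
    (p : Split Δ Δ₁ Δ₂) (f : CTm S Γ Δ₁ A) (τ : CSub S Γ Δ₂ Ω) :
    (ρ.lift A).csub (.cons p f τ) = .cons p f (ρ.csub τ) := by
  rw [CSub.lift, CSub.cons_csub, CSub.split_left_allRight]
  rfl

theorem CSub.id_csub {Δ Ω : List Θ.CTy} (ρ : CSub S Γ Δ Ω) : (CSub.id Ω).csub ρ = ρ := by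
  match Ω, Δ, ρ with
  | [], _, .nil => rfl
  | A :: Ω, _, .cons p f ρ => rw [CSub.id, CSub.lift_csub_cons, CSub.id_csub ρ]

end CoreSubstitution

-- Laws of core substitution up to derivable equality

section Equations

variable {T : Theory.{u}} {Γ : List T.ty.HTy}

theorem Theory.CSubEqn.refl {Δ Ω : List T.ty.CTy} (ρ : CSub T.sig Γ Δ Ω) : T.CSubEqn ρ ρ := by
  match ρ with
  | .nil => exact .nil
  | .cons p f ρ => exact .cons p (.refl f) (.refl ρ)

/-- Substitution is application of the derelicted promotion. -/
theorem Theory.CEqn.der_promote_pack {Δ Ω : List T.ty.CTy} {A : T.ty.CTy} (f : CTm T.sig Γ Ω A)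
    (ρ : CSub T.sig Γ Δ Ω) : T.CEqn (.der (.promote f) ρ.pack) (f.csub ρ) := by
  have h := Theory.CEqn.csub (Theory.CEqn.der_promote f) (Theory.CSubEqn.refl ρ)
  rwa [CTm.csub, CTm.tensVars_csub] at h

/-- Both sides are equal to `derelict(promote(f))` applied to the tensor product of the variables,
so no induction on `f` is needed. -/
theorem Theory.CEqn.csub_id {Ω : List T.ty.CTy} {A : T.ty.CTy} (f : CTm T.sig Γ Ω A) :
    T.CEqn (f.csub (.id Ω)) f := by
  have h := Theory.CEqn.der_promote_pack f (.id Ω)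
  rw [CSub.pack_id] at h
  exact h.symm.trans (.der_promote f)

/-- Written as `derelict(promote(f))` applied to a packed list, `f.csub ρ` has its core variables
only in that list, so the second substitution acts there alone and `pack_csub` applies. -/
theorem Theory.CEqn.csub_csub {Δ Ω Ω' : List T.ty.CTy} {A : T.ty.CTy} (f : CTm T.sig Γ Ω' A)
    (ρ : CSub T.sig Γ Ω Ω') (τ : CSub T.sig Γ Δ Ω) :
    T.CEqn ((f.csub ρ).csub τ) (f.csub (ρ.csub τ)) := by
  have h := Theory.CEqn.csub (Theory.CEqn.der_promote_pack f ρ) (Theory.CSubEqn.refl τ)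
  rw [CTm.csub, CSub.pack_csub] at h
  exact h.symm.trans (.der_promote_pack f _)

/-- Terms that agree on `a ⊗ b` are equal. -/
theorem Theory.CEqn.ext_tens {Ω : List T.ty.CTy} {A B D : T.ty.CTy}
    {f g : CTm T.sig Γ (.tens A B :: Ω) D}
    (h : T.CEqn (f.csub (.cons (.left (.left (.allRight Ω))) (.tens (.left (.right .nil)) .var .var)
        (.id Ω)))
      (g.csub (.cons (.left (.left (.allRight Ω))) (.tens (.left (.right .nil)) .var .var)
        (.id Ω)))) : T.CEqn f g := by
  -- The `η`-rule with a variable as the term that is taken apart: `f` is recovered by a `let` from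
  -- its restriction to `a ⊗ b`.
  have e (f : CTm T.sig Γ (.tens A B :: Ω) D) :=
    (Theory.CEqn.letT_eta (.left (.allRight Ω)) f .var).trans (.csub_id f)
  exact (e f).symm.trans ((Theory.CEqn.letT _ (.refl _) h).trans (e g))

/-- Terms that agree on `•` are equal. -/
theorem Theory.CEqn.ext_unit {Ω : List T.ty.CTy} {D : T.ty.CTy}
    {f g : CTm T.sig Γ (.unit :: Ω) D}
    (h : T.CEqn (f.csub (.cons (.allRight Ω) .unit (.id Ω)))
      (g.csub (.cons (.allRight Ω) .unit (.id Ω)))) : T.CEqn f g := by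
  have e (f : CTm T.sig Γ (.unit :: Ω) D) :=
    (Theory.CEqn.letU_eta (.left (.allRight Ω)) f .var).trans (.csub_id f)
  exact (e f).symm.trans ((Theory.CEqn.letU _ (.refl _) h).trans (e g))

end Equations

theorem Split.allRight_assoc {α : Type u} {m m₁ m₂ : List α} (q : Split m m₁ m₂) :
    (allRight m).assoc q = ⟨m₁, q, allRight m₁⟩ := by
  induction q with
  | nil => rfl
  | left s ih => rw [allRight, assoc, ih]; rfl
  | right s ih => rw [allRight, assoc, ih]

theorem CSub.split_id {Θ : TySys.{u}} {S : TmSig Θ} {Γ : List Θ.HTy} {Ω Ω₁ Ω₂ : List Θ.CTy}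
    (p : Split Ω Ω₁ Ω₂) :
    (CSub.id Ω : CSub S Γ Ω Ω).split p = ⟨Ω₁, Ω₂, p, .id Ω₁, .id Ω₂⟩ := by
  induction p with
  | nil => rfl
  | left s ih =>
    rw [CSub.id, CSub.lift, CSub.split, ih]
    simp only
    rw [Split.assoc, Split.allRight_assoc]
    rfl
  | right s ih =>
    rw [CSub.id, CSub.lift, CSub.split, ih]
    simp only
    rw [Split.assoc, Split.allRight_assoc]
    simp only [Split.comm, Split.comm_comm]
    rfl

/-! ### Terms modulo derivable equality -/

/-- Core terms modulo derivable equality. -/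
def Theory.cSetoid (T : Theory.{u}) (Γ : List T.ty.HTy) (Ω : List T.ty.CTy) (A : T.ty.CTy) :
    Setoid (CTm T.sig Γ Ω A) :=
  ⟨T.CEqn, ⟨.refl, .symm, .trans⟩⟩

def HCls (T : Theory.{u}) (Γ : List T.ty.HTy) (X : T.ty.HTy) : Type u := Quotient (T.hSetoid Γ X)

def CCls (T : Theory.{u}) (Γ : List T.ty.HTy) (Ω : List T.ty.CTy) (A : T.ty.CTy) : Type u :=
  Quotient (T.cSetoid Γ Ω A)

variable {T : Theory.{u}} {Γ : List T.ty.HTy}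

def HCls.mk {X : T.ty.HTy} (t : HTm T.sig Γ X) : HCls T Γ X := Quotient.mk _ t

def CCls.mk {Ω : List T.ty.CTy} {A : T.ty.CTy} (f : CTm T.sig Γ Ω A) : CCls T Γ Ω A :=
  Quotient.mk _ f

theorem HCls.mk_eq {X : T.ty.HTy} {s t : HTm T.sig Γ X} : mk s = mk t ↔ T.HEqn s t :=
  Quotient.eq (r := T.hSetoid Γ X)

theorem CCls.mk_eq {Ω : List T.ty.CTy} {A : T.ty.CTy} {s t : CTm T.sig Γ Ω A} :
    mk s = mk t ↔ T.CEqn s t :=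
  Quotient.eq (r := T.cSetoid Γ Ω A)

theorem HCls.ind {X : T.ty.HTy} {P : HCls T Γ X → Prop} (h : ∀ t, P (.mk t)) (t) : P t :=
  Quotient.ind h t

theorem CCls.ind {Ω : List T.ty.CTy} {A : T.ty.CTy} {P : CCls T Γ Ω A → Prop}
    (h : ∀ t, P (.mk t)) (t) : P t :=
  Quotient.ind h t

def HCls.promote {Ω : List T.ty.CTy} {A : T.ty.CTy} (f : CCls T Γ Ω A) :
    HCls T Γ (.proof (tensorTy Ω) A) :=
  Quotient.map (sa := T.cSetoid Γ Ω A) (sb := T.hSetoid Γ _) HTm.promote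
    (fun _ _ h => Theory.HEqn.promote h) f

def CCls.der {Ω : List T.ty.CTy} {A B : T.ty.CTy} (t : HCls T Γ (.proof A B))
    (f : CCls T Γ Ω A) : CCls T Γ Ω B :=
  Quotient.map₂ (sa := T.hSetoid Γ _) (sb := T.cSetoid Γ Ω A) (sc := T.cSetoid Γ Ω B) CTm.der
    (fun _ _ h _ _ h' => Theory.CEqn.der h h') t f

def CCls.tens {Ω Ω₁ Ω₂ : List T.ty.CTy} {A B : T.ty.CTy} (p : Split Ω Ω₁ Ω₂)
    (f : CCls T Γ Ω₁ A) (g : CCls T Γ Ω₂ B) : CCls T Γ Ω (.tens A B) :=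
  Quotient.map₂ (sa := T.cSetoid Γ Ω₁ A) (sb := T.cSetoid Γ Ω₂ B)
    (sc := T.cSetoid Γ Ω (.tens A B)) (CTm.tens p)
    (fun _ _ h _ _ h' => Theory.CEqn.tens p h h') f g

def CCls.var {A : T.ty.CTy} : CCls T Γ [A] A := .mk .var

def CCls.unit : CCls T Γ [] .unit := .mk .unit

namespace HCls

open CCls

variable {A A' A'' B B' B'' D D' E : T.ty.CTy}

theorem der_promote_pack {Δ Ω : List T.ty.CTy} (f : CTm T.sig Γ Ω A) (ρ : CSub T.sig Γ Δ Ω) :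
    der (promote (.mk f)) (.mk ρ.pack) = .mk (f.csub ρ) :=
  Quotient.sound (s := T.cSetoid Γ Δ A) (Theory.CEqn.der_promote_pack f ρ)

theorem der_promote_tensVars {Ω : List T.ty.CTy} (f : CCls T Γ Ω A) :
    der (promote f) (.mk (.tensVars Ω)) = f := by
  induction f using CCls.ind with | _ f
  exact CCls.mk_eq.2 (.der_promote f)

theorem promote_der (t : HCls T Γ (.proof A B)) :
    promote (Ω := [A]) (der t var) = t := by
  induction t using HCls.ind with | _ t
  exact HCls.mk_eq.2 (.promote_der t)

/-- Morphisms from `A` are determined by their values on `v`. -/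
def Dense {Ω : List T.ty.CTy} (v : CCls T Γ Ω A) : Prop :=
  ∀ ⦃D : T.ty.CTy⦄ ⦃s t : HCls T Γ (.proof A D)⦄, der s v = der t v → s = t

theorem dense_var : Dense (var : CCls T Γ [A] A) := fun _ s t h => by
  rw [← promote_der s, ← promote_der t, h]

/-! ### The category of proofs -/

/-- The identity `promote(a)`. -/
def one (A : T.ty.CTy) : HCls T Γ (.proof A A) := promote (Ω := [A]) var

/-- The composite `promote(derelict(t)[derelict(s)/b])`. -/
def seq (s : HCls T Γ (.proof A B)) (t : HCls T Γ (.proof B D)) : HCls T Γ (.proof A D) :=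
  promote (Ω := [A]) (der t (der s var))

/-- The tensor product `promote(derelict(s) ⊗ derelict(t))`. -/
def par (s : HCls T Γ (.proof A A')) (t : HCls T Γ (.proof B B')) :
    HCls T Γ (.proof (.tens A B) (.tens A' B')) :=
  promote (Ω := [A, B]) (tens (.left (.right .nil)) (der s var) (der t var))

/-- Promotion in several variables takes apart a right-nested tensor product only, so the
left-nested domain requires a `let`, while the inverse does not. -/
def assoc (A B D : T.ty.CTy) : HCls T Γ (.proof (.tens (.tens A B) D) (.tens A (.tens B D))) :=
  promote (Ω := [.tens A B, D]) (.mk (.letT (.left (.right .nil)) .var (.tensVars [A, B, D])))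

def assocInv (A B D : T.ty.CTy) :
    HCls T Γ (.proof (.tens A (.tens B D)) (.tens (.tens A B) D)) :=
  promote (Ω := [A, B, D])
    (tens (.left (.left (.right .nil))) (tens (.left (.right .nil)) var var) var)

def swap (A B : T.ty.CTy) : HCls T Γ (.proof (.tens A B) (.tens B A)) :=
  promote (Ω := [A, B]) (tens (.right (.left .nil)) var var)

def lunit (A : T.ty.CTy) : HCls T Γ (.proof (.tens .unit A) A) :=
  promote (Ω := [.unit, A]) (.mk (.letU (.left (.right .nil)) .var .var))

def lunitInv (A : T.ty.CTy) : HCls T Γ (.proof A (.tens .unit A)) :=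
  promote (Ω := [A]) (tens (.right .nil) unit var)

variable {Ω Ω₁ Ω₂ Ω₃ Ω₄ Ω₅ : List T.ty.CTy}

-- The simplification rules for `der` evaluate each structural proof on terms in arbitrary contexts.
-- With them both sides of a coherence equation are computed on a pattern of variables.
@[simp]
theorem der_one (f : CCls T Γ Ω A) : der (one A) f = f := by
  induction f using CCls.ind with | _ f
  exact der_promote_pack (Ω := [A]) .var (.single f)

@[simp]
theorem der_seq (s : HCls T Γ (.proof A B)) (t : HCls T Γ (.proof B D)) (f : CCls T Γ Ω A) :
    der (seq s t) f = der t (der s f) := by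
  induction f using CCls.ind with | _ f
  induction s using HCls.ind with | _ s
  induction t using HCls.ind with | _ t
  exact der_promote_pack (Ω := [A]) (.der t (.der s .var)) (.single f)

@[simp]
theorem der_par (s : HCls T Γ (.proof A A')) (t : HCls T Γ (.proof B B')) (p : Split Ω Ω₁ Ω₂)
    (f : CCls T Γ Ω₁ A) (g : CCls T Γ Ω₂ B) :
    der (par s t) (tens p f g) = tens p (der s f) (der t g) := by
  induction f using CCls.ind with | _ f
  induction g using CCls.ind with | _ g
  induction s using HCls.ind with | _ s
  induction t using HCls.ind with | _ t
  refine (der_promote_pack (Ω := [A, B]) (.tens (.left (.right .nil)) (.der s .var) (.der t .var))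
    (.cons p f (.single g))).trans (congrArg _ ?_)
  exact CTm.tens_csub_cons p f (.single g) _ _

/-- The splittings `a`, `b` are arbitrary up to the equation `e`, so the identity applies to
patterns whose splittings are not literally of the form `p.assoc q`. -/
theorem der_assoc_of_eq {l l₁ m m₁ m₂ : List T.ty.CTy} (p : Split l l₁ m) (q : Split m m₁ m₂)
    (f : CCls T Γ l₁ A) (g : CCls T Γ m₁ B) (h : CCls T Γ m₂ D) {k : List T.ty.CTy}
    (a : Split l k m₂) (b : Split k l₁ m₁) (e : p.assoc q = ⟨k, a, b⟩) :
    der (assoc A B D) (tens a (tens b f g) h) = tens p f (tens q g h) := by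
  obtain ⟨rfl, e⟩ := Sigma.mk.inj e
  obtain ⟨rfl, rfl⟩ := Prod.mk.inj (eq_of_heq e)
  induction f using CCls.ind with | _ f
  induction g using CCls.ind with | _ g
  induction h using CCls.ind with | _ h
  refine (der_promote_pack (Ω := [.tens A B, D])
    (.letT (.left (.right .nil)) .var (.tensVars [A, B, D]))
    (.cons (p.assoc q).2.1 (.tens (p.assoc q).2.2 f g) (.single h))).trans ?_
  refine CCls.mk_eq.2 ?_
  rw [CTm.csub, show (.left (.right .nil) : Split [A.tens B, D] [A.tens B] [D]) =
    .left (.allRight [D]) from rfl, CSub.split_left_allRight]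
  -- `β` for `let`, after which the two successive substitutions are merged. The result differs from
  -- the target only by an identity substitution in `h`.
  refine (Theory.CEqn.letT_tens p q _ f g).trans ((Theory.CEqn.csub_csub _ _ _).trans ?_)
  rw [CSub.lift_csub_cons, CSub.lift_csub_cons, CSub.single_csub, CTm.tensVars_csub]
  exact .tens _ (.refl _) (.tens _ (.refl _) (.csub_id h))

-- `coassoc` finds the splittings of the right-hand side from those of the left, which makes the
-- identity a rewriting rule.
@[simp]
theorem der_assoc (a : Split Ω Ω₁ Ω₂) (b : Split Ω₁ Ω₃ Ω₄) (f : CCls T Γ Ω₃ A)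
    (g : CCls T Γ Ω₄ B) (h : CCls T Γ Ω₂ D) :
    der (assoc A B D) (tens a (tens b f g) h) =
      tens (a.coassoc b).2.1 f (tens (a.coassoc b).2.2 g h) :=
  der_assoc_of_eq _ _ _ _ _ _ _ (Split.assoc_coassoc a b)

@[simp]
theorem der_assocInv (p : Split Ω Ω₁ Ω₂) (q : Split Ω₂ Ω₃ Ω₄) (f : CCls T Γ Ω₁ A)
    (g : CCls T Γ Ω₃ B) (h : CCls T Γ Ω₄ D) :
    der (assocInv A B D) (tens p f (tens q g h)) =
      tens (p.assoc q).2.1 (tens (p.assoc q).2.2 f g) h := by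
  induction f using CCls.ind with | _ f
  induction g using CCls.ind with | _ g
  induction h using CCls.ind with | _ h
  refine (der_promote_pack (Ω := [A, B, D])
    (.tens (.left (.left (.right .nil))) (.tens (.left (.right .nil)) .var .var) .var)
    (.cons p f (.cons q g (.single h)))).trans (congrArg _ ?_)
  rw [CTm.csub, CSub.split, show (.left (.right .nil) : Split [B, D] [B] [D]) =
    .left (.allRight [D]) from rfl, CSub.split_left_allRight]
  refine congrArg₂ (CTm.tens _) ?_ rfl
  exact CTm.tens_csub_cons (p.assoc q).2.2 f (.single g) _ _

@[simp]
theorem der_swap (p : Split Ω Ω₁ Ω₂) (f : CCls T Γ Ω₁ A) (g : CCls T Γ Ω₂ B) :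
    der (swap A B) (tens p f g) = tens p.comm g f := by
  induction f using CCls.ind with | _ f
  induction g using CCls.ind with | _ g
  refine (der_promote_pack (Ω := [A, B]) (.tens (.right (.left .nil)) .var .var)
    (.cons p f (.single g))).trans (congrArg _ ?_)
  rw [CTm.csub, CSub.split, show (.left .nil : Split [B] [B] []) = .allLeft [B] from rfl,
    CSub.split_allLeft]
  simp only
  rw [Split.comm_comm, Split.assoc_allRight]
  rfl

@[simp]
theorem der_lunit (f : CCls T Γ Ω A) :
    der (lunit A) (tens (.allRight Ω) unit f) = f := by
  induction f using CCls.ind with | _ f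
  refine (der_promote_pack (Ω := [.unit, A]) (.letU (.left (.right .nil)) .var .var)
    (.cons (.allRight Ω) .unit (.single f))).trans ?_
  refine CCls.mk_eq.2 ?_
  rw [CTm.csub, show (.left (.right .nil) : Split [CTy.unit, A] [.unit] [A]) =
    .left (.allRight [A]) from rfl, CSub.split_left_allRight]
  exact .letU_unit f

@[simp]
theorem der_lunitInv (f : CCls T Γ Ω A) :
    der (lunitInv A) f = tens (.allRight Ω) unit f := by
  induction f using CCls.ind with | _ f
  refine (der_promote_pack (Ω := [A]) (.tens (.right .nil) .unit .var) (.single f)).trans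
    (congrArg _ ?_)
  rw [CTm.csub, show (.right .nil : Split [A] [] [A]) = .allRight [A] from rfl,
    CSub.split_allRight]
  rfl

/-! ### Density -/

/-- Substitution of `a ⊗ b` for the first variable. -/
def tensHead (f : CCls T Γ (.tens A B :: Ω) D) : CCls T Γ (A :: B :: Ω) D :=
  Quotient.map (sa := T.cSetoid Γ _ D) (sb := T.cSetoid Γ _ D)
    (fun f => f.csub (.cons (.left (.left (.allRight Ω))) (.tens (.left (.right .nil)) .var .var)
      (.id Ω))) (fun _ _ h => Theory.CEqn.csub h (.refl _)) f

/-- Substitution of `•` for the first variable. -/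
def unitHead (f : CCls T Γ (.unit :: Ω) D) : CCls T Γ Ω D :=
  Quotient.map (sa := T.cSetoid Γ _ D) (sb := T.cSetoid Γ _ D)
    (fun f => f.csub (.cons (.allRight Ω) .unit (.id Ω)))
    (fun _ _ h => Theory.CEqn.csub h (.refl _)) f

@[simp]
theorem tensHead_var : tensHead (var : CCls T Γ _ (.tens A B)) =
    tens (.left (.right .nil)) var var :=
  rfl

@[simp]
theorem unitHead_var : unitHead (var : CCls T Γ _ .unit) = unit :=
  rfl

@[simp]
theorem tensHead_tens (p : Split Ω Ω₁ Ω₂) (f : CCls T Γ (.tens A B :: Ω₁) D)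
    (g : CCls T Γ Ω₂ E) :
    tensHead (tens (.left p) f g) = tens (.left (.left p)) (tensHead f) g := by
  induction f using CCls.ind with | _ f
  induction g using CCls.ind with | _ g
  refine CCls.mk_eq.2 ?_
  change T.CEqn ((CTm.tens (.left p) f g).csub _) (.tens (.left (.left p)) (f.csub _) g)
  rw [CTm.csub, CSub.split, CSub.split_id]
  simp only
  rw [Split.assoc, Split.assoc, Split.allRight_assoc]
  exact .tens _ (.refl _) (.csub_id g)

@[simp]
theorem unitHead_tens (p : Split Ω Ω₁ Ω₂) (f : CCls T Γ (.unit :: Ω₁) D)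
    (g : CCls T Γ Ω₂ E) :
    unitHead (tens (.left p) f g) = tens p (unitHead f) g := by
  induction f using CCls.ind with | _ f
  induction g using CCls.ind with | _ g
  refine CCls.mk_eq.2 ?_
  change T.CEqn ((CTm.tens (.left p) f g).csub _) (.tens p (f.csub _) g)
  rw [CTm.csub, CSub.split, CSub.split_id]
  simp only
  rw [Split.allRight_assoc]
  exact .tens _ (.refl _) (.csub_id g)

/-- Substitution acts on `derelict(s)[v]` only inside `v`. If `s` and `t` agree on `v` with `a ⊗ b`
substituted for its first variable, the `η`-rule in the form `ext_tens` therefore shows that they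
agree on `v`. -/
theorem Dense.tensHead {v : CCls T Γ (.tens A B :: Ω) D} (hv : Dense v) :
    Dense (tensHead v) := fun E s t h => by
  apply hv
  induction v using CCls.ind with | _ v
  induction s using HCls.ind with | _ s
  induction t using HCls.ind with | _ t
  exact CCls.mk_eq.2 (.ext_tens (CCls.mk_eq.1 h))

theorem Dense.unitHead {v : CCls T Γ (.unit :: Ω) D} (hv : Dense v) :
    Dense (unitHead v) := fun E s t h => by
  apply hv
  induction v using CCls.ind with | _ v
  induction s using HCls.ind with | _ s
  induction t using HCls.ind with | _ t
  exact CCls.mk_eq.2 (.ext_unit (CCls.mk_eq.1 h))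

theorem one_seq (s : HCls T Γ (.proof A B)) : seq (one A) s = s :=
  dense_var (by simp)

theorem seq_one (s : HCls T Γ (.proof A B)) : seq s (one B) = s :=
  dense_var (by simp)

theorem seq_seq (r : HCls T Γ (.proof A B)) (s : HCls T Γ (.proof B D))
    (t : HCls T Γ (.proof D E)) : seq (seq r s) t = seq r (seq s t) :=
  dense_var (by simp)

/-- Here `e'` is a section of `e`, so precomposition with `e` is injective. -/
theorem Dense.der {v : CCls T Γ Ω A} (hv : Dense v) {e : HCls T Γ (.proof A B)}
    {e' : HCls T Γ (.proof B A)} (h : seq e' e = one B) : Dense (der e v) := fun E s t hst => by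
  rw [← one_seq s, ← one_seq t, ← h, seq_seq, seq_seq]
  exact congrArg _ (hv (by simpa using hst))

theorem dense_unit : Dense (unit : CCls T Γ [] .unit) := by
  simpa using Dense.unitHead (T := T) (Γ := Γ) dense_var

/-- The nested patterns are obtained from a single variable by repeatedly taking apart the first
variable. -/
theorem dense_tens :
    Dense (tens (.left (.right .nil)) var var : CCls T Γ [A, B] (.tens A B)) := by
  simpa using Dense.tensHead (T := T) (Γ := Γ) (A := A) (B := B) dense_var

theorem dense_tens_left :
    Dense (tens (.left (.left (.right .nil))) (tens (.left (.right .nil)) var var) var :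
      CCls T Γ [A, B, D] (.tens (.tens A B) D)) := by
  simpa using Dense.tensHead (T := T) (Γ := Γ) (dense_tens (A := .tens A B) (B := D))

theorem dense_tens_left_left :
    Dense (tens (.left (.left (.left (.right .nil)))) (tens (.left (.left (.right .nil)))
      (tens (.left (.right .nil)) var var) var) var :
      CCls T Γ [A, B, D, E] (.tens (.tens (.tens A B) D) E)) := by
  simpa using Dense.tensHead (T := T) (Γ := Γ) (dense_tens_left (A := .tens A B) (B := D) (D := E))

theorem dense_unit_tens :
    Dense (tens (.right .nil) unit var : CCls T Γ [A] (.tens .unit A)) := by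
  simpa using Dense.unitHead (T := T) (Γ := Γ) (dense_tens (A := .unit) (B := A))

theorem dense_unit_tens_tens :
    Dense (tens (.left (.right .nil)) (tens (.right .nil) unit var) var :
      CCls T Γ [A, B] (.tens (.tens .unit A) B)) := by
  simpa using Dense.unitHead (T := T) (Γ := Γ) (dense_tens_left (A := .unit) (B := A) (D := B))

theorem swap_swap : seq (swap A B) (swap B A) = (one _ : HCls T Γ _) :=
  dense_tens (by simp; rfl)

/-- Only the first variable can be taken apart, so the tensor product in second position is reached
from the left-nested pattern through the symmetry. -/
theorem dense_tens_right :
    Dense (tens (.right (.right (.left .nil))) var (tens (.left (.right .nil)) var var) :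
      CCls T Γ [A, B, D] (.tens D (.tens A B))) := by
  have := dense_tens_left.der (swap_swap (T := T) (Γ := Γ) (A := D) (B := .tens A B))
  rw [der_swap] at this
  exact this

/-! ### Coherence -/

/-- Defined through the symmetry, so that its laws follow from those of `lunit`. -/
def runit (A : T.ty.CTy) : HCls T Γ (.proof (.tens A .unit) A) := seq (swap A .unit) (lunit A)

def runitInv (A : T.ty.CTy) : HCls T Γ (.proof A (.tens A .unit)) :=
  seq (lunitInv A) (swap .unit A)

theorem par_one_one : par (one A) (one B) = (one _ : HCls T Γ _) :=
  dense_tens (by simp)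

theorem par_seq (s : HCls T Γ (.proof A A')) (s' : HCls T Γ (.proof A' A''))
    (t : HCls T Γ (.proof B B')) (t' : HCls T Γ (.proof B' B'')) :
    par (seq s s') (seq t t') = seq (par s t) (par s' t') :=
  dense_tens (by simp)

theorem assoc_assocInv : seq (assoc A B D) (assocInv A B D) = (one _ : HCls T Γ _) :=
  dense_tens_left (by simp; rfl)

theorem assocInv_assoc : seq (assocInv A B D) (assoc A B D) = (one _ : HCls T Γ _) := by
  exact dense_tens_right (by simp; rfl)

theorem lunit_lunitInv : seq (lunit A) (lunitInv A) = (one _ : HCls T Γ _) :=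
  dense_unit_tens (by
    rw [der_seq]
    exact (congrArg _ (der_lunit var)).trans ((der_lunitInv _).trans (der_one _).symm))

theorem lunitInv_lunit : seq (lunitInv A) (lunit A) = (one _ : HCls T Γ _) :=
  dense_var (by simp)

theorem par_assoc (a : HCls T Γ (.proof A A')) (b : HCls T Γ (.proof B B'))
    (d : HCls T Γ (.proof D D')) :
    seq (par (par a b) d) (assoc A' B' D') = seq (assoc A B D) (par a (par b d)) :=
  dense_tens_left (by simp)

theorem par_swap (a : HCls T Γ (.proof A A')) (b : HCls T Γ (.proof B B')) :
    seq (par a b) (swap A' B') = seq (swap A B) (par b a) :=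
  dense_tens (by simp)

theorem par_lunit (a : HCls T Γ (.proof A A')) :
    seq (par (one .unit) a) (lunit A') = seq (lunit A) a :=
  dense_unit_tens (by
    simp only [der_seq, der_par, der_one]
    exact (der_lunit _).trans (congrArg _ (der_lunit _)).symm)

theorem par_runit (a : HCls T Γ (.proof A A')) :
    seq (par a (one .unit)) (runit A') = seq (runit A) a := by
  rw [runit, runit, ← seq_seq, par_swap, seq_seq, par_lunit, seq_seq]

theorem runit_runitInv : seq (runit A) (runitInv A) = (one _ : HCls T Γ _) := by
  rw [runit, runitInv, seq_seq, ← seq_seq (lunit A), lunit_lunitInv, one_seq, swap_swap]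

theorem runitInv_runit : seq (runitInv A) (runit A) = (one _ : HCls T Γ _) := by
  rw [runit, runitInv, seq_seq, ← seq_seq (swap _ _), swap_swap, one_seq, lunitInv_lunit]

/-- On `((a ⊗ b) ⊗ d) ⊗ e` both sides compute to the same nested tensor product; the splittings in
it are concrete and agree by computation. -/
theorem pentagon : seq (par (assoc A B D) (one E)) (seq (assoc A (.tens B D) E)
      (par (one A) (assoc B D E))) =
    (seq (assoc (.tens A B) D E) (assoc A B (.tens D E)) : HCls T Γ _) :=
  dense_tens_left_left (by simp; rfl)

theorem triangle : seq (assoc A .unit B) (par (one A) (lunit B)) =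
    (par (runit A) (one B) : HCls T Γ _) := by
  have h : seq (par (swap A .unit) (one B)) (par (swap .unit A) (one B)) =
      (one _ : HCls T Γ _) := by
    rw [← par_seq, swap_swap, one_seq, par_one_one]
  -- The pattern needed is `(a ⊗ •) ⊗ b`, obtained from `(• ⊗ a) ⊗ b` by the invertible proof in
  -- `h`.
  refine dense_unit_tens_tens.der h ?_
  simp only [der_seq, der_par, der_one, der_swap, der_assoc, runit]
  refine (congrArg (tens _ _) (der_lunit _)).trans (congrArg (tens _ · _) (der_lunit _).symm)

theorem hexagon : seq (assoc A B D) (seq (swap A (.tens B D)) (assoc B D A)) =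
    (seq (par (swap A B) (one D)) (seq (assoc B A D) (par (one B) (swap A D))) : HCls T Γ _) :=
  dense_tens_left (by simp; rfl)

theorem hexagon_reverse : seq (assocInv A B D) (seq (swap (.tens A B) D) (assocInv D A B)) =
    (seq (par (one A) (swap B D)) (seq (assocInv A D B) (par (swap A D) (one B))) :
      HCls T Γ _) :=
  dense_tens_right (by simp; rfl)

/-! ### Promotion in several variables -/

/-- The head type `D` is variable so that the induction can use the head `D ⊗ A`: that head is taken
apart into `d ⊗ a`, and the associator moves `a` to the front of the remaining variables. -/
theorem dense_cons_tensVars (D : T.ty.CTy) : (Ω : List T.ty.CTy) →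
    Dense (tens (.left (.allRight Ω)) var (.mk (.tensVars Ω)) :
      CCls T Γ (D :: Ω) (.tens D (tensorTy Ω)))
  | [] => by
    have h := (dense_unit_tens (A := D)).der (swap_swap (T := T) (Γ := Γ) (A := D) (B := .unit))
    rw [der_swap] at h
    exact h
  | [A] => dense_tens
  | A :: B :: Ω => by
    have h := (dense_cons_tensVars (.tens D A) (B :: Ω)).tensHead
    rw [tensHead_tens] at h
    have h := h.der (assocInv_assoc (T := T) (Γ := Γ))
    rw [tensHead_var, der_assoc_of_eq (.left (.right (.allRight (B :: Ω))))
      (.left (.allRight (B :: Ω)))] at h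
    · exact h
    · rw [Split.assoc, Split.assoc, Split.allRight_assoc]
      rfl

theorem dense_tensVars : (Ω : List T.ty.CTy) → Dense (.mk (.tensVars Ω) : CCls T Γ Ω _)
  | [] => dense_unit
  | [_] => dense_var
  | A :: B :: Ω => dense_cons_tensVars A (B :: Ω)

end HCls

-- Host substitution for a single variable

section Substitution

variable {Θ : TySys.{u}} {S : TmSig Θ} {Γ Δ Ξ : List Θ.HTy} {X Y : Θ.HTy}

theorem HTm.ren_eq_sub (t : HTm S Γ X) (ρ : Ren Γ Δ) :
    t.ren ρ = t.sub (ρ.sub (.id Δ)) := by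
  rw [← HTm.ren_sub, HTm.sub_id]

theorem Theory.HEqn.of_eq {T : Theory.{u}} {Γ : List T.ty.HTy} {X : T.ty.HTy}
    {s t : HTm T.sig Γ X} (h : s = t) : T.HEqn s t :=
  h ▸ .refl s

theorem HSub.ext_cons {σ τ : HSub S Δ (X :: Γ)} (hz : σ _ .z = τ _ .z)
    (hs : ∀ Y (y : HVar Γ Y), σ _ (.s y) = τ _ (.s y)) : σ = τ := by
  funext Y y
  cases y with
  | z => exact hz
  | s y => exact hs _ y

/-- The substitution of a term for the only variable. -/
abbrev HSub.single (t : HTm S Δ X) : HSub S Δ [X] := .cons t .nil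

theorem HSub.eq_single (σ : HSub S Δ [X]) : σ = .single (σ _ .z) :=
  HSub.ext_cons rfl fun _ y => nomatch y

theorem HTm.sub_single_sub (t : HTm S [X] Y) (s : HTm S Γ X) (σ : HSub S Δ Γ) :
    (t.sub (.single s)).sub σ = t.sub (.single (s.sub σ)) :=
  (t.sub_sub _ _).trans (congrArg t.sub (HSub.eq_single _))

theorem HTm.ren_eq_single (t : HTm S [X] Y) (ρ : Ren [X] Δ) :
    t.ren ρ = t.sub (.single (.var (ρ _ .z))) :=
  (t.ren_eq_sub ρ).trans (congrArg t.sub (HSub.eq_single _))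

theorem HTm.sub_single_var (t : HTm S [X] Y) : t.sub (.single (.var .z)) = t :=
  (congrArg t.sub (HSub.eq_single (.id [X])).symm).trans t.sub_id

end Substitution

theorem Theory.HEqn.sub_single {T : Theory.{u}} {Γ : List T.ty.HTy} {X Y : T.ty.HTy}
    (t : HTm T.sig [X] Y) {s s' : HTm T.sig Γ X} (h : T.HEqn s s') :
    T.HEqn (t.sub (.single s)) (t.sub (.single s')) :=
  .sub (.refl t) fun _ x => match x with | .z => h

-- The syntactic host category is cartesian closed

namespace SynH

variable {T : Theory.{u}} {X Y Z : T.ty.HTy}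

theorem mk_eq {s t : HTm T.sig [X] Y} : mk s = mk t ↔ T.HEqn s t :=
  HCls.mk_eq

theorem mk_surj (f : SynH.of X ⟶ SynH.of Y) : ∃ t, mk t = f :=
  Quotient.exists_rep (s := T.hSetoid [X] Y) f

/-- The type `1` is terminal. -/
def terminalCone (T : Theory.{u}) : Limits.LimitCone (Functor.empty.{0} (SynH T)) where
  cone := Limits.asEmptyCone (SynH.of .unit)
  isLimit := Limits.IsTerminal.ofUniqueHom (fun X => mk (X := X) .unit) fun X m => by
    obtain ⟨t, rfl⟩ := mk_surj (X := X) m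
    exact mk_eq.2 (.unit_eta t)

/-- The type `X × Y` is a product. -/
noncomputable def prodCone (X Y : SynH T) : Limits.LimitCone (Limits.pair X Y) where
  cone := Limits.BinaryFan.mk (P := SynH.of (T := T) (.prod X Y))
    (mk (X := HTy.prod X Y) (Y := X) (.fst (.var .z)))
    (mk (X := HTy.prod X Y) (Y := Y) (.snd (.var .z)))
  isLimit := Limits.BinaryFan.IsLimit.mk _
    (fun {P} f g => Quotient.map₂ (sa := T.hSetoid [P] X) (sb := T.hSetoid [P] Y)
      (sc := T.hSetoid [P] (.prod X Y)) HTm.pair (fun _ _ h _ _ h' => Theory.HEqn.pair h h') f g)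
    (fun {P} f g => by
      obtain ⟨s, rfl⟩ := mk_surj (X := P) f
      obtain ⟨t, rfl⟩ := mk_surj (X := P) g
      exact mk_eq.2 (.fst_pair s t))
    (fun {P} f g => by
      obtain ⟨s, rfl⟩ := mk_surj (X := P) f
      obtain ⟨t, rfl⟩ := mk_surj (X := P) g
      exact mk_eq.2 (.snd_pair s t))
    (fun {P} f g m hf hg => by
      obtain ⟨r, rfl⟩ := mk_surj (X := P) (Y := HTy.prod X Y) m
      subst hf hg
      exact mk_eq.2 (.symm (.pair_eta r)))

noncomputable instance cartesian : CartesianMonoidalCategory (SynH T) :=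
  .ofChosenFiniteProducts (terminalCone T) prodCone

noncomputable instance braided : BraidedCategory (SynH T) := .ofCartesianMonoidalCategory

theorem whiskerLeft_mk (t : HTm T.sig [Y] Z) : SynH.of X ◁ mk t =
    mk (X := HTy.prod X Y) (Y := HTy.prod X Z)
      (.pair (.fst (.var .z)) (t.sub (.single (.snd (.var .z))))) := by
  refine CartesianMonoidalCategory.hom_ext _ _ ?_ ?_
  · rw [whiskerLeft_fst]
    exact mk_eq.2 (.symm (.fst_pair _ _))
  · rw [whiskerLeft_snd]
    exact mk_eq.2 (.symm (.snd_pair _ _))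

/-- Morphisms `X × Y ⟶ Z` are morphisms `Y ⟶ (X → Z)`. -/
def curryEquiv (X Y Z : T.ty.HTy) :
    (SynH.of (T := T) (.prod X Y) ⟶ SynH.of Z) ≃ (SynH.of Y ⟶ SynH.of (.arr X Z)) where
  toFun := Quotient.map (sa := T.hSetoid [.prod X Y] Z) (sb := T.hSetoid [Y] (.arr X Z))
    (fun t => .lam (t.sub (.single (.pair (.var .z) (.var (.s .z))))))
    (fun _ _ h => .lam (.sub h fun _ _ => .refl _))
  invFun := Quotient.map (sa := T.hSetoid [Y] (.arr X Z)) (sb := T.hSetoid [.prod X Y] Z)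
    (fun t => .app (t.sub (.single (.snd (.var .z)))) (.fst (.var .z)))
    (fun _ _ h => .app (.sub h fun _ _ => .refl _) (.refl _))
  left_inv f := by
    obtain ⟨t, rfl⟩ := mk_surj f
    refine mk_eq.2 (.trans (.app_lam _ _) ?_)
    rw [HTm.sub_single_sub, HTm.sub_single_sub]
    exact (Theory.HEqn.sub_single t (.pair_eta _)).trans (.of_eq t.sub_single_var)
  right_inv f := by
    obtain ⟨t, rfl⟩ := mk_surj f
    refine mk_eq.2 (.trans (.lam (.app ?_ (.fst_pair _ _))) (.lam_eta t))
    rw [HTm.sub_single_sub]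
    exact (Theory.HEqn.sub_single t (.snd_pair _ _)).trans
      (.of_eq (t.ren_eq_single fun _ => .s).symm)

theorem curryEquiv_naturality (X : T.ty.HTy) {Y' Y Z : T.ty.HTy} (f : SynH.of Y' ⟶ SynH.of Y)
    (g : SynH.of X ⊗ SynH.of Y ⟶ SynH.of Z) :
    curryEquiv X Y' Z (SynH.of X ◁ f ≫ g) = f ≫ curryEquiv X Y Z g := by
  obtain ⟨s, rfl⟩ := mk_surj f
  obtain ⟨t, rfl⟩ := mk_surj (X := HTy.prod X Y) g
  refine (congrArg (fun w => curryEquiv X Y' Z (w ≫ mk t)) (whiskerLeft_mk s)).trans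
    (mk_eq.2 (.lam ?_))
  refine .trans (.of_eq (HTm.sub_single_sub t _ _))
    (.trans ?_ (.of_eq (HTm.sub_single_sub t _ _).symm))
  refine .sub_single t (.pair (.fst_pair _ _) ?_)
  refine .trans (.of_eq (HTm.sub_single_sub s _ _)) ?_
  exact (Theory.HEqn.sub_single s (.snd_pair _ _)).trans
    (.of_eq (s.ren_eq_single fun _ => .s).symm)

noncomputable instance closed : MonoidalClosed (SynH T) where
  closed X :=
    { rightAdj := Adjunction.rightAdjointOfEquiv (F := tensorLeft X)
        (G_obj := fun Z => SynH.of (T := T) (.arr X Z)) (fun Y Z => curryEquiv X Y Z)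
        (fun _ _ _ f g => curryEquiv_naturality X f g)
      adj := Adjunction.adjunctionOfEquivRight _ _ }

/-- The counit of the adjunction is the inverse of `curryEquiv` at the identity, which computes to
an application. -/
theorem ev_eq (X Y : T.ty.HTy) : (ihom.ev (SynH.of X)).app (SynH.of Y) =
    mk (X := HTy.prod X (.arr X Y)) (.app (.snd (.var .z)) (.fst (.var .z))) :=
  rfl

end SynH

-- The syntactic core category and its enrichment

namespace SynC

variable {T : Theory.{u}} {P Q : SynH T} {A A' A'' B B' B'' D D' E : SynC T}

/-- The host type `Proof(A, B)`, as an object of the syntactic host category. -/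
def proof (A B : SynC T) : SynH T := SynH.of (.proof A B)

def tens (A B : SynC T) : SynC T := SynC.of (.tens A B)

def unit : SynC T := SynC.of .unit

/-! ### Families of morphisms -/

/-- A morphism `P ⟶ proof A B` is by definition a class of host terms over `[P]`, so the results on
proofs over an arbitrary host context apply directly to families. -/
def one (P : SynH T) (A : SynC T) : P ⟶ proof A A := HCls.one (Γ := [P]) A

def seq (f : P ⟶ proof A B) (g : P ⟶ proof B D) : P ⟶ proof A D := HCls.seq (Γ := [P]) f g

def par (f : P ⟶ proof A A') (g : P ⟶ proof B B') : P ⟶ proof (tens A B) (tens A' B') :=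
  HCls.par (Γ := [P]) f g

def assoc (P : SynH T) (A B D : SynC T) : P ⟶ proof (tens (tens A B) D) (tens A (tens B D)) :=
  HCls.assoc (Γ := [P]) A B D

def assocInv (P : SynH T) (A B D : SynC T) : P ⟶ proof (tens A (tens B D)) (tens (tens A B) D) :=
  HCls.assocInv (Γ := [P]) A B D

def swap (P : SynH T) (A B : SynC T) : P ⟶ proof (tens A B) (tens B A) :=
  HCls.swap (Γ := [P]) A B

def lunit (P : SynH T) (A : SynC T) : P ⟶ proof (tens unit A) A := HCls.lunit (Γ := [P]) A

def lunitInv (P : SynH T) (A : SynC T) : P ⟶ proof A (tens unit A) := HCls.lunitInv (Γ := [P]) A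

def runit (P : SynH T) (A : SynC T) : P ⟶ proof (tens A unit) A := HCls.runit (Γ := [P]) A

def runitInv (P : SynH T) (A : SynC T) : P ⟶ proof A (tens A unit) := HCls.runitInv (Γ := [P]) A

theorem comp_seq (h : Q ⟶ P) (f : P ⟶ proof A B) (g : P ⟶ proof B D) :
    h ≫ seq f g = seq (h ≫ f) (h ≫ g) := by
  obtain ⟨h, rfl⟩ := SynH.mk_surj h
  obtain ⟨f, rfl⟩ := SynH.mk_surj f
  obtain ⟨g, rfl⟩ := SynH.mk_surj g
  rfl

theorem comp_par (h : Q ⟶ P) (f : P ⟶ proof A A') (g : P ⟶ proof B B') :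
    h ≫ par f g = par (h ≫ f) (h ≫ g) := by
  obtain ⟨h, rfl⟩ := SynH.mk_surj h
  obtain ⟨f, rfl⟩ := SynH.mk_surj f
  obtain ⟨g, rfl⟩ := SynH.mk_surj g
  rfl

theorem comp_one (h : Q ⟶ P) : h ≫ one P A = one Q A := by
  obtain ⟨h, rfl⟩ := SynH.mk_surj h
  rfl

theorem comp_assoc (h : Q ⟶ P) : h ≫ assoc P A B D = assoc Q A B D := by
  obtain ⟨h, rfl⟩ := SynH.mk_surj h
  rfl

theorem comp_swap (h : Q ⟶ P) : h ≫ swap P A B = swap Q A B := by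
  obtain ⟨h, rfl⟩ := SynH.mk_surj h
  rfl

theorem comp_lunit (h : Q ⟶ P) : h ≫ lunit P A = lunit Q A := by
  obtain ⟨h, rfl⟩ := SynH.mk_surj h
  rfl

theorem comp_runit (h : Q ⟶ P) : h ≫ runit P A = runit Q A := by
  obtain ⟨h, rfl⟩ := SynH.mk_surj h
  rfl

theorem one_seq (f : P ⟶ proof A B) : seq (one P A) f = f := HCls.one_seq _

theorem seq_one (f : P ⟶ proof A B) : seq f (one P B) = f := HCls.seq_one _

theorem seq_seq (f : P ⟶ proof A B) (g : P ⟶ proof B D) (h : P ⟶ proof D E) :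
    seq (seq f g) h = seq f (seq g h) := HCls.seq_seq _ _ _

/-- Morphisms are global elements of `Proof(A, B)`, so that the comparison with the underlying
category of the enrichment is the identity. -/
noncomputable instance category : Category.{u} (SynC T) where
  Hom A B := 𝟙_ (SynH T) ⟶ proof A B
  id A := one _ A
  comp f g := seq f g
  id_comp f := one_seq f
  comp_id f := seq_one f
  assoc f g h := seq_seq f g h

theorem par_one_one : par (one P A) (one P B) = one P (tens A B) := HCls.par_one_one

theorem par_seq (f : P ⟶ proof A A') (f' : P ⟶ proof A' A'') (g : P ⟶ proof B B')
    (g' : P ⟶ proof B' B'') : par (seq f f') (seq g g') = seq (par f g) (par f' g') :=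
  HCls.par_seq _ _ _ _

theorem par_assoc (f : P ⟶ proof A A') (g : P ⟶ proof B B') (h : P ⟶ proof D D') :
    seq (par (par f g) h) (assoc P A' B' D') = seq (assoc P A B D) (par f (par g h)) :=
  HCls.par_assoc _ _ _

theorem par_swap (f : P ⟶ proof A A') (g : P ⟶ proof B B') :
    seq (par f g) (swap P A' B') = seq (swap P A B) (par g f) :=
  HCls.par_swap _ _

theorem par_lunit (f : P ⟶ proof A A') :
    seq (par (one P unit) f) (lunit P A') = seq (lunit P A) f :=
  HCls.par_lunit _

theorem par_runit (f : P ⟶ proof A A') :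
    seq (par f (one P unit)) (runit P A') = seq (runit P A) f :=
  HCls.par_runit _

noncomputable instance monoidal : MonoidalCategory (SynC T) :=
  letI : MonoidalCategoryStruct (SynC T) :=
    { tensorObj := tens
      tensorUnit := unit
      tensorHom := fun f g => par f g
      whiskerLeft := fun A _ _ f => par (one _ A) f
      whiskerRight := fun f A => par f (one _ A)
      associator := fun A B D => ⟨assoc _ A B D, assocInv _ A B D, HCls.assoc_assocInv,
        HCls.assocInv_assoc⟩
      leftUnitor := fun A => ⟨lunit _ A, lunitInv _ A, HCls.lunit_lunitInv, HCls.lunitInv_lunit⟩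
      rightUnitor := fun A => ⟨runit _ A, runitInv _ A, HCls.runit_runitInv,
        HCls.runitInv_runit⟩ }
  .ofTensorHom
    (id_tensorHom_id := fun _ _ => par_one_one)
    (tensorHom_comp_tensorHom := fun _ _ _ _ => (par_seq _ _ _ _).symm)
    (associator_naturality := fun _ _ _ => par_assoc _ _ _)
    (leftUnitor_naturality := fun _ => par_lunit _)
    (rightUnitor_naturality := fun _ => par_runit _)
    (pentagon := fun _ _ _ _ => HCls.pentagon)
    (triangle := fun _ _ => HCls.triangle)

noncomputable def braiding (A B : SynC T) : A ⊗ B ≅ B ⊗ A :=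
  ⟨swap _ A B, swap _ B A, HCls.swap_swap, HCls.swap_swap⟩

noncomputable instance symmetric : SymmetricCategory (SynC T) where
  braiding := braiding
  braiding_naturality_right _ _ _ _ := par_swap _ _
  braiding_naturality_left _ _ := par_swap _ _
  hexagon_forward _ _ _ := HCls.hexagon
  hexagon_reverse _ _ _ := HCls.hexagon_reverse
  symmetry _ _ := HCls.swap_swap

/-- Composition as a morphism of the syntactic host category. -/
noncomputable def homComp (A B D : SynC T) : proof A B ⊗ proof B D ⟶ proof A D :=
  seq (fst (proof A B) (proof B D)) (snd (proof A B) (proof B D))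

/-- The tensor product as a morphism of the syntactic host category. -/
noncomputable def homTens (A A' B B' : SynC T) :
    proof A A' ⊗ proof B B' ⟶ proof (tens A B) (tens A' B') :=
  par (fst (proof A A') (proof B B')) (snd (proof A A') (proof B B'))

/-- With `comp_homTens`, this turns every enriched axiom into an identity between families,
evaluated at projections. -/
theorem comp_homComp (h : P ⟶ proof A B ⊗ proof B D) :
    h ≫ homComp A B D = seq (h ≫ fst _ _) (h ≫ snd _ _) :=
  comp_seq h _ _

theorem comp_homTens (h : P ⟶ proof A A' ⊗ proof B B') :
    h ≫ homTens A A' B B' = par (h ≫ fst _ _) (h ≫ snd _ _) :=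
  comp_par h _ _

theorem unit_comp {X : SynH T} (f : 𝟙_ (SynH T) ⟶ X) (h : P ⟶ 𝟙_ (SynH T)) :
    h ≫ f = toUnit P ≫ f := by
  rw [toUnit_unique h (toUnit P)]

theorem leftUnitor_inv_tensorHom {X Y : SynH T} (f : 𝟙_ (SynH T) ⟶ X) (g : 𝟙_ (SynH T) ⟶ Y) :
    (λ_ (𝟙_ (SynH T))).inv ≫ (f ⊗ₘ g) = lift f g := by
  ext
  · rw [Category.assoc, tensorHom_fst, lift_fst, ← Category.assoc, unit_comp, toUnit_unit,
      Category.id_comp]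
  · rw [Category.assoc, tensorHom_snd, lift_snd, ← Category.assoc, unit_comp, toUnit_unit,
      Category.id_comp]

theorem homComp_eq (f : 𝟙_ (SynH T) ⟶ proof A B) (g : 𝟙_ (SynH T) ⟶ proof B D) :
    (λ_ _).inv ≫ (f ⊗ₘ g) ≫ homComp A B D = seq f g := by
  rw [← Category.assoc, leftUnitor_inv_tensorHom, comp_homComp, lift_fst, lift_snd]

theorem homTens_eq (f : 𝟙_ (SynH T) ⟶ proof A A') (g : 𝟙_ (SynH T) ⟶ proof B B') :
    (λ_ _).inv ≫ (f ⊗ₘ g) ≫ homTens A A' B B' = par f g := by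
  rw [← Category.assoc, leftUnitor_inv_tensorHom, comp_homTens, lift_fst, lift_snd]

/-- Composition with a fixed morphism on the right. -/
noncomputable def postcomp (A : SynC T) (g : 𝟙_ (SynH T) ⟶ proof B D) :
    proof A B ⟶ proof A D :=
  (ρ_ _).inv ≫ _ ◁ g ≫ homComp A B D

/-- Composition with a fixed morphism on the left. -/
noncomputable def precomp (g : 𝟙_ (SynH T) ⟶ proof A B) (D : SynC T) :
    proof B D ⟶ proof A D :=
  (λ_ _).inv ≫ g ▷ _ ≫ homComp A B D

theorem comp_postcomp (h : P ⟶ proof A B) (g : 𝟙_ (SynH T) ⟶ proof B D) :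
    h ≫ postcomp A g = seq h (toUnit P ≫ g) := by
  rw [postcomp, comp_homComp, comp_seq, comp_seq, whiskerLeft_fst, whiskerLeft_snd,
    rightUnitor_inv_fst, Category.comp_id, ← Category.assoc, ← Category.assoc, unit_comp]

theorem comp_precomp (h : P ⟶ proof B D) (g : 𝟙_ (SynH T) ⟶ proof A B) :
    h ≫ precomp g D = seq (toUnit P ≫ g) h := by
  rw [precomp, comp_homComp, comp_seq, comp_seq, whiskerRight_fst, whiskerRight_snd,
    leftUnitor_inv_snd, Category.comp_id, ← Category.assoc, ← Category.assoc, unit_comp]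

/-- The interchange law `par_seq`, at the four projections of the product of hom-objects. -/
theorem homTens_homComp (A A' A'' B B' B'' : SynC T) :
    (homComp A A' A'' ⊗ₘ homComp B B' B'') ≫ homTens A A'' B B'' =
      tensorμ (proof A A') (proof A' A'') (proof B B') (proof B' B'') ≫
        (homTens A A' B B' ⊗ₘ homTens A' A'' B' B'') ≫
          homComp (tens A B) (tens A' B') (tens A'' B'') := by
  rw [comp_homTens, comp_homComp, tensorHom_fst, tensorHom_snd, tensorHom_fst, tensorHom_snd,
    comp_homComp, comp_homComp, par_seq, comp_seq, comp_homTens, comp_homTens, comp_par, comp_par,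
    tensorμ_fst_assoc, tensorμ_fst_assoc, tensorμ_snd_assoc, tensorμ_snd_assoc, tensorHom_fst,
    tensorHom_snd, tensorHom_fst, tensorHom_snd]

theorem homTens_assoc (A A' B B' D D' : SynC T) :
    homTens A A' B B' ▷ (proof D D') ≫ homTens (tens A B) (tens A' B') D D' ≫
        postcomp (tens (tens A B) D) (assoc _ A' B' D') =
      (α_ (proof A A') (proof B B') (proof D D')).hom ≫
        proof A A' ◁ homTens B B' D D' ≫ homTens A A' (tens B D) (tens B' D') ≫
          precomp (assoc _ A B D) (tens A' (tens B' D')) := by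
  rw [comp_postcomp, comp_precomp, comp_seq, comp_seq, comp_seq, comp_homTens, comp_homTens,
    whiskerRight_fst, whiskerRight_snd, whiskerLeft_fst, whiskerLeft_snd, comp_homTens, comp_par,
    comp_homTens, comp_par, associator_hom_fst, associator_hom_snd_fst, associator_hom_snd_snd]
  simp only [comp_assoc, par_assoc]

theorem homTens_swap (A A' B B' : SynC T) :
    homTens A A' B B' ≫ postcomp (tens A B) (swap _ A' B') =
      (β_ (proof A A') (proof B B')).hom ≫ homTens B B' A A' ≫
        precomp (swap _ A B) (tens B' A') := by
  rw [comp_postcomp, comp_precomp, comp_seq, comp_homTens, braiding_hom_fst, braiding_hom_snd]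
  simp only [comp_swap]
  exact par_swap _ _

theorem homTens_lunit (A A' : SynC T) :
    (λ_ (proof A A')).inv ≫ one _ unit ▷ (proof A A') ≫ homTens unit unit A A' ≫
        postcomp (tens unit A) (lunit _ A') =
      precomp (lunit _ A) A' := by
  rw [← Category.id_comp (precomp _ _), comp_precomp, comp_postcomp, comp_seq, comp_seq,
    comp_homTens, comp_par, whiskerRight_fst, whiskerRight_snd, leftUnitor_inv_snd]
  simp only [comp_lunit, comp_one]
  exact par_lunit _

theorem homTens_runit (A A' : SynC T) :
    (ρ_ (proof A A')).inv ≫ proof A A' ◁ one _ unit ≫ homTens A A' unit unit ≫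
        postcomp (tens A unit) (runit _ A') =
      precomp (runit _ A) A' := by
  rw [← Category.id_comp (precomp _ _), comp_precomp, comp_postcomp, comp_seq, comp_seq,
    comp_homTens, comp_par, whiskerLeft_fst, whiskerLeft_snd, rightUnitor_inv_fst]
  simp only [comp_runit, comp_one]
  exact par_runit _

noncomputable instance enriched : EnrichedCategory (SynH T) (SynC T) where
  Hom A B := proof A B
  id A := one _ A
  comp := homComp
  id_comp A B := by
    simp only [comp_homComp, whiskerRight_fst, whiskerRight_snd, comp_one, one_seq,
      leftUnitor_inv_snd]
  comp_id A B := by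
    simp only [comp_homComp, whiskerLeft_fst, whiskerLeft_snd, comp_one, seq_one,
      rightUnitor_inv_fst]
  assoc A B D E := by
    simp only [comp_homComp, comp_seq, whiskerLeft_fst, whiskerLeft_snd, whiskerRight_fst,
      whiskerRight_snd, seq_seq, associator_inv_fst_fst, associator_inv_fst_snd,
      associator_inv_snd]

noncomputable instance enrichedOrdinary : EnrichedOrdinaryCategory (SynH T) (SynC T) where
  homEquiv := Equiv.refl _
  homEquiv_comp f g := (homComp_eq f g).symm

noncomputable instance enrichedSymmetricMonoidal :
    EnrichedSymmetricMonoidal (SynH T) (SynC T) where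
  eTensor := homTens
  eTensor_eHomEquiv f g := homTens_eq f g
  eTensor_id _ _ := (homTens_eq _ _).trans par_one_one
  eTensor_comp := homTens_homComp
  associator_eNatural := homTens_assoc
  leftUnitor_eNatural := homTens_lunit
  rightUnitor_eNatural := homTens_runit
  braiding_eNatural := homTens_swap

end SynC

-- Values of morphisms of the syntactic core category on core terms

section Elements

variable {T : Theory.{u}}

/-- Core terms with one host variable modulo derivable equality, seen as generalized elements of an
object of the syntactic core category. -/
def El (P : SynH T) (Ω : List T.ty.CTy) (A : SynC T) : Type u := CCls T [P] Ω A

namespace El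

variable {P Q : SynH T} {Ω Ω₁ Ω₂ Ω₃ Ω₄ Δ : List T.ty.CTy} {A A' B B' D D' : SynC T}

def mk {A : T.ty.CTy} (f : CTm T.sig [P] Ω A) : El P Ω (SynC.of A) := CCls.mk f

def var {A : T.ty.CTy} : El P [A] (SynC.of A) := CCls.var

def unit : El P [] (𝟙_ (SynC T)) := CCls.unit

def tens (p : Split Ω Ω₁ Ω₂) (x : El P Ω₁ A) (y : El P Ω₂ B) : El P Ω (A ⊗ B) := CCls.tens p x y

def app (f : P ⟶ (A ⟶[SynH T] B)) (x : El P Ω A) : El P Ω B :=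
  CCls.der (Γ := [P]) f x

/-- Substitution for the host variable. -/
def pull (h : Q ⟶ P) (x : El P Ω A) : El Q Ω A :=
  Quotient.map₂ (sa := T.hSetoid [Q] P) (sb := T.cSetoid [P] Ω A) (sc := T.cSetoid [Q] Ω A)
    (fun s f => f.hsub (.single s))
    (fun _ _ h _ _ h' => Theory.CEqn.hsub h' fun _ x => match x with | .z => h) h x

theorem mk_eq {A : T.ty.CTy} {f g : CTm T.sig [P] Ω A} : mk f = mk g ↔ T.CEqn f g :=
  CCls.mk_eq

theorem mk_surj {A : T.ty.CTy} (x : El P Ω (SynC.of A)) : ∃ f, mk f = x :=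
  Quotient.exists_rep (s := T.cSetoid [P] Ω A) x

/-- In the syntactic model `eSeq` is `SynC.seq`, since `homComp` is the composite of the two
projections; values of composites are thus given by `der_seq`. -/
theorem app_eSeq (f : P ⟶ (A ⟶[SynH T] B)) (g : P ⟶ (B ⟶[SynH T] D)) (x : El P Ω A) :
    app (eSeq f g) x = app g (app f x) := by
  have h : eSeq f g = SynC.seq f g := by
    refine (SynC.comp_homComp (lift f g)).trans ?_
    rw [lift_fst, lift_snd]
  rw [h]
  exact HCls.der_seq (Γ := [P]) f g x

theorem app_ePar (f : P ⟶ (A ⟶[SynH T] A')) (g : P ⟶ (B ⟶[SynH T] B')) (p : Split Ω Ω₁ Ω₂)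
    (x : El P Ω₁ A) (y : El P Ω₂ B) :
    app (ePar f g) (tens p x y) = tens p (app f x) (app g y) := by
  have h : ePar f g = SynC.par f g := by
    refine (SynC.comp_homTens (lift f g)).trans ?_
    rw [lift_fst, lift_snd]
  rw [h]
  exact HCls.der_par (Γ := [P]) f g p x y

theorem app_one (x : El P Ω A) : app (eConst (𝟙 A)) x = x := by
  have h : eConst (H := SynH T) (P := P) (𝟙 A) = SynC.one P A := SynC.comp_one _
  rw [h]
  exact HCls.der_one (Γ := [P]) x

theorem app_comp (f : A ⟶ B) (g : B ⟶ D) (x : El P Ω A) :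
    app (eConst (f ≫ g)) x = app (eConst g) (app (eConst f) x) := by
  rw [eConst_comp, app_eSeq]

theorem app_tensor (f : A ⟶ A') (g : B ⟶ B') (p : Split Ω Ω₁ Ω₂) (x : El P Ω₁ A)
    (y : El P Ω₂ B) :
    app (eConst (f ⊗ₘ g)) (tens p x y) = tens p (app (eConst f) x) (app (eConst g) y) := by
  rw [eConst_tensor, app_ePar]

theorem app_whiskerLeft (g : B ⟶ B') (p : Split Ω Ω₁ Ω₂) (x : El P Ω₁ A)
    (y : El P Ω₂ B) : app (eConst (A ◁ g)) (tens p x y) = tens p x (app (eConst g) y) := by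
  rw [← id_tensorHom, app_tensor, app_one]

theorem app_whiskerRight (f : A ⟶ A') (p : Split Ω Ω₁ Ω₂) (x : El P Ω₁ A)
    (y : El P Ω₂ B) : app (eConst (f ▷ B)) (tens p x y) = tens p (app (eConst f) x) y := by
  rw [← tensorHom_id, app_tensor, app_one]

theorem app_associator {l l₁ m m₁ m₂ k : List T.ty.CTy} (p : Split l l₁ m) (q : Split m m₁ m₂)
    (x : El P l₁ A) (y : El P m₁ B) (z : El P m₂ D) (a : Split l k m₂) (b : Split k l₁ m₁)
    (e : p.assoc q = ⟨k, a, b⟩) :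
    app (eConst (α_ A B D).hom) (tens a (tens b x y) z) = tens p x (tens q y z) := by
  have h : eConst (H := SynH T) (P := P) (α_ A B D).hom = SynC.assoc P A B D :=
    SynC.comp_assoc _
  rw [h]
  exact HCls.der_assoc_of_eq (Γ := [P]) p q x y z a b e

theorem app_associator_inv {l l₁ m m₁ m₂ k : List T.ty.CTy} (p : Split l l₁ m)
    (q : Split m m₁ m₂) (x : El P l₁ A) (y : El P m₁ B) (z : El P m₂ D) (a : Split l k m₂)
    (b : Split k l₁ m₁) (e : p.assoc q = ⟨k, a, b⟩) :
    app (eConst (α_ A B D).inv) (tens p x (tens q y z)) = tens a (tens b x y) z := by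
  rw [← app_associator p q x y z a b e, ← app_comp, Iso.hom_inv_id, app_one]

theorem app_braiding (p : Split Ω Ω₁ Ω₂) (x : El P Ω₁ A) (y : El P Ω₂ B) :
    app (eConst (β_ A B).hom) (tens p x y) = tens p.comm y x := by
  have h : eConst (H := SynH T) (P := P) (β_ A B).hom = SynC.swap P A B :=
    SynC.comp_swap _
  rw [h]
  exact HCls.der_swap (Γ := [P]) p x y

theorem app_leftUnitor (x : El P Ω A) :
    app (eConst (λ_ A).hom) (tens (.allRight Ω) unit x) = x := by
  have h : eConst (H := SynH T) (P := P) (λ_ A).hom = SynC.lunit P A :=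
    SynC.comp_lunit _
  rw [h]
  exact HCls.der_lunit (Γ := [P]) x

theorem app_leftUnitor_inv (x : El P Ω A) :
    app (eConst (λ_ A).inv) x = tens (.allRight Ω) unit x := by
  conv_lhs => rw [← app_leftUnitor x]
  rw [← app_comp, Iso.hom_inv_id, app_one]

theorem app_rightUnitor (x : El P Ω A) :
    app (eConst (ρ_ A).hom) (tens (.allLeft Ω) x unit) = x := by
  rw [← braiding_leftUnitor, app_comp, app_braiding, Split.comm_comm, app_leftUnitor]

theorem app_rightUnitor_inv (x : El P Ω A) :
    app (eConst (ρ_ A).inv) x = tens (.allLeft Ω) x unit := by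
  conv_lhs => rw [← app_rightUnitor x]
  rw [← app_comp, Iso.hom_inv_id, app_one]

theorem pull_app (h : Q ⟶ P) (f : P ⟶ (A ⟶[SynH T] B)) (x : El P Ω A) :
    pull h (app f x) = app (h ≫ f) (pull h x) := by
  obtain ⟨h, rfl⟩ := SynH.mk_surj h
  obtain ⟨f, rfl⟩ := SynH.mk_surj f
  obtain ⟨x, rfl⟩ := mk_surj x
  rfl

theorem pull_tens (h : Q ⟶ P) (p : Split Ω Ω₁ Ω₂) (x : El P Ω₁ A) (y : El P Ω₂ B) :
    pull h (tens p x y) = tens p (pull h x) (pull h y) := by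
  obtain ⟨h, rfl⟩ := SynH.mk_surj h
  obtain ⟨x, rfl⟩ := mk_surj x
  obtain ⟨y, rfl⟩ := mk_surj y
  rfl

theorem pull_unit (h : Q ⟶ P) : pull h (unit : El P _ _) = unit := by
  obtain ⟨h, rfl⟩ := SynH.mk_surj h
  rfl

theorem pull_var {A : T.ty.CTy} (h : Q ⟶ P) : pull h (var : El P [A] _) = var := by
  obtain ⟨h, rfl⟩ := SynH.mk_surj h
  rfl

end El

end Elements

/-- The `η`-rule of `let` for the term `derelict(t)[c ⊗ v/ω]` with a fresh variable `c`. It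
identifies the interpretation of a `let`, a composite of morphisms, with the `let` of the calculus.
-/
theorem HCls.letT_of_der {T : Theory.{u}} {Γ : List T.ty.HTy} {Ω Ω₁ Ω₂ : List T.ty.CTy}
    {A B D Y : T.ty.CTy} (t : HCls T Γ (.proof (.tens (.tens A B) Y) D)) (p : Split Ω Ω₁ Ω₂)
    (f : CTm T.sig Γ Ω₁ (.tens A B)) (v : CTm T.sig Γ Ω₂ Y) (h : CTm T.sig Γ (A :: B :: Ω₂) D)
    (e : CCls.der t (CCls.tens (.left (.left (.allRight Ω₂)))
      (CCls.tens (.left (.right .nil)) CCls.var CCls.var) (.mk v)) = .mk h) :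
    CCls.der t (CCls.tens p (.mk f) (.mk v)) = .mk (.letT p f h) := by
  induction t using HCls.ind with | _ t
  have hc {Δ Δ₁ : List T.ty.CTy} (q : Split Δ Δ₁ Ω₂) (g : CTm T.sig Γ Δ₁ (.tens A B)) :
      T.CEqn ((CTm.der t (.tens (.left (.allRight Ω₂)) .var v)).csub (.cons q g (.id Ω₂)))
        (.der t (.tens q g v)) := by
    rw [CTm.csub, CTm.tens_csub_cons]
    exact .der (.refl _) (.tens _ (.refl _) (.csub_id v))
  refine CCls.mk_eq.2 ?_
  refine (hc p f).symm.trans ((Theory.CEqn.letT_eta p _ f).symm.trans (.letT _ (.refl _) ?_))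
  exact (hc _ _).trans (CCls.mk_eq.1 e)

theorem HCls.letU_of_der {T : Theory.{u}} {Γ : List T.ty.HTy} {Ω Ω₁ Ω₂ : List T.ty.CTy}
    {D Y : T.ty.CTy} (t : HCls T Γ (.proof (.tens .unit Y) D)) (p : Split Ω Ω₁ Ω₂)
    (f : CTm T.sig Γ Ω₁ .unit) (v : CTm T.sig Γ Ω₂ Y) (h : CTm T.sig Γ Ω₂ D)
    (e : CCls.der t (CCls.tens (.allRight Ω₂) CCls.unit (.mk v)) = .mk h) :
    CCls.der t (CCls.tens p (.mk f) (.mk v)) = .mk (.letU p f h) := by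
  induction t using HCls.ind with | _ t
  have hc {Δ Δ₁ : List T.ty.CTy} (q : Split Δ Δ₁ Ω₂) (g : CTm T.sig Γ Δ₁ .unit) :
      T.CEqn ((CTm.der t (.tens (.left (.allRight Ω₂)) .var v)).csub (.cons q g (.id Ω₂)))
        (.der t (.tens q g v)) := by
    rw [CTm.csub, CTm.tens_csub_cons]
    exact .der (.refl _) (.tens _ (.refl _) (.csub_id v))
  refine CCls.mk_eq.2 ?_
  refine (hc p f).symm.trans ((Theory.CEqn.letU_eta p _ f).symm.trans (.letU _ (.refl _) ?_))
  exact (hc _ _).trans (CCls.mk_eq.1 e)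

-- The tensor product of the variables of a core context

section Contexts

variable (T : Theory.{u})

/-- The object of the syntactic core category for a core context. -/
noncomputable abbrev coreCtx (Ω : List T.ty.CTy) : SynC T := tensCtx (SynC.of (T := T)) Ω

/-- The object of the syntactic host category for a host context. -/
noncomputable abbrev hostCtx (Γ : List T.ty.HTy) : SynH T := prodCtx (SynH.of (T := T)) Γ

theorem coreCtx_eq : (Ω : List T.ty.CTy) → SynC.of (tensorTy Ω) = coreCtx T Ω
  | [] => rfl
  | [_] => rfl
  | A :: B :: Ω => congrArg (SynC.of A ⊗ ·) (coreCtx_eq (B :: Ω))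

variable {T} {P Q : SynH T} {Ω Ω₁ Ω₂ Δ : List T.ty.CTy}

/-- The tensor product of the variables of a context. -/
noncomputable def varsTm {Γ : List T.ty.HTy} : (Ω : List T.ty.CTy) → CTm T.sig Γ Ω (coreCtx T Ω)
  | [] => .unit
  | [_] => .var
  | _ :: B :: Ω => .tens (.left (.allRight (B :: Ω))) .var (varsTm (B :: Ω))

/-- The types `tensorTy Ω` and `coreCtx T Ω` are equal by induction on `Ω`, not by definition, so
the two terms can only be compared heterogeneously. -/
theorem varsTm_heq {Γ : List T.ty.HTy} : (Ω : List T.ty.CTy) →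
    HEq (CTm.tensVars Ω : CTm T.sig Γ Ω _) (varsTm Ω : CTm T.sig Γ Ω _)
  | [] => .rfl
  | [_] => .rfl
  | A :: B :: Ω => by
    have h {Y Y' : T.ty.CTy} (e : Y = Y') (s : CTm T.sig Γ (B :: Ω) Y)
        (s' : CTm T.sig Γ (B :: Ω) Y') (hs : HEq s s') :
        HEq (CTm.tens (.left (.allRight (B :: Ω))) (.var (A := A)) s)
          (CTm.tens (.left (.allRight (B :: Ω))) (.var (A := A)) s') := by
      subst e
      rw [eq_of_heq hs]
    exact h (coreCtx_eq T (B :: Ω)) _ _ (varsTm_heq (B :: Ω))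

namespace El

/-- The tensor product of a list of terms. -/
noncomputable def pack (ρ : CSub T.sig [P] Δ Ω) : El P Δ (coreCtx T Ω) :=
  CCls.mk ((varsTm Ω).csub ρ)

noncomputable def vars (P : SynH T) (Ω : List T.ty.CTy) : El P Ω (coreCtx T Ω) := CCls.mk (varsTm Ω)

theorem pack_id (Ω : List T.ty.CTy) : pack (P := P) (.id Ω) = vars P Ω :=
  CCls.mk_eq.2 (.csub_id _)

theorem pack_cons_cons {Δ₁ Δ₂ : List T.ty.CTy} {A B : T.ty.CTy} (p : Split Δ Δ₁ Δ₂)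
    (f : CTm T.sig [P] Δ₁ A) (ρ : CSub T.sig [P] Δ₂ (B :: Ω)) :
    pack (P := P) (.cons p f ρ) = tens p (mk f) (pack ρ) :=
  congrArg CCls.mk (CTm.tens_csub_cons p f ρ .var (varsTm (B :: Ω)))

theorem app_consIso {Δ₁ Δ₂ : List T.ty.CTy} {A : T.ty.CTy} (p : Split Δ Δ₁ Δ₂)
    (f : CTm T.sig [P] Δ₁ A) (ρ : CSub T.sig [P] Δ₂ Ω) :
    app (eConst (consIso (SynC.of (T := T)) A Ω).hom) (pack (P := P) (.cons p f ρ)) =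
      tens p (mk f) (pack ρ) := by
  match Ω, Δ₂, ρ with
  | [], _, .nil =>
    obtain rfl := p.eq_left rfl
    rw [p.eq_allLeft]
    exact app_rightUnitor_inv _
  | B :: Ω, _, ρ => exact (app_one _).trans (pack_cons_cons p f ρ)

theorem app_consIso_inv {Δ₁ Δ₂ : List T.ty.CTy} {A : T.ty.CTy} (p : Split Δ Δ₁ Δ₂)
    (f : CTm T.sig [P] Δ₁ A) (ρ : CSub T.sig [P] Δ₂ Ω) :
    app (eConst (consIso (SynC.of (T := T)) A Ω).inv) (tens p (mk f) (pack ρ)) =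
      pack (P := P) (.cons p f ρ) := by
  rw [← app_consIso, ← app_comp, Iso.hom_inv_id, app_one]

theorem app_consIso_vars (A : T.ty.CTy) (Ω : List T.ty.CTy) :
    app (eConst (consIso (SynC.of (T := T)) A Ω).hom) (vars P (A :: Ω)) =
      tens (.left (.allRight Ω)) var (vars P Ω) := by
  rw [← pack_id, ← pack_id]
  exact app_consIso _ _ _

theorem app_consIso_inv_vars (A : T.ty.CTy) (Ω : List T.ty.CTy) :
    app (eConst (consIso (SynC.of (T := T)) A Ω).inv) (tens (.left (.allRight Ω)) var (vars P Ω)) =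
      vars P (A :: Ω) := by
  rw [← app_consIso_vars, ← app_comp, Iso.hom_inv_id, app_one]

/-- On variables, permuting the factors by the symmetry only changes the splitting: each associator
or braiding in `splitHom` regroups or reverses it, and the end result is `p`. -/
theorem app_splitHom (p : Split Ω Ω₁ Ω₂) :
    app (eConst (splitHom (SynC.of (T := T)) p)) (vars P Ω) =
      tens p (vars P Ω₁) (vars P Ω₂) := by
  induction p with
  | nil => exact app_leftUnitor_inv _
  | @left A l l₁ l₂ s ih =>
    have hs : (Split.left (a := A) (.allRight l)).assoc s =
        ⟨A :: l₁, .left s, .left (.allRight l₁)⟩ := by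
      rw [Split.assoc, Split.allRight_assoc]
    rw [splitHom, app_comp, app_comp, app_comp, app_consIso_vars, app_whiskerLeft, ih,
      app_associator_inv _ _ _ _ _ _ _ hs, app_whiskerRight, app_consIso_inv_vars]
  | @right A l l₁ l₂ s ih =>
    have hs : (Split.left (a := A) (.allRight l)).assoc s =
        ⟨A :: l₁, .left s, .left (.allRight l₁)⟩ := by
      rw [Split.assoc, Split.allRight_assoc]
    have hs' : (Split.right (a := A) s).assoc (.left (.allRight l₂)) =
        ⟨A :: l₁, .left s, .right (.allLeft l₁)⟩ := by
      rw [Split.assoc, Split.assoc_allRight]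
    rw [splitHom, app_comp, app_comp, app_comp, app_comp, app_comp, app_consIso_vars,
      app_whiskerLeft, ih, app_associator_inv _ _ _ _ _ _ _ hs, app_whiskerRight, app_braiding,
      Split.comm, app_associator _ _ _ _ _ _ _ hs', app_whiskerLeft, app_consIso_inv_vars]

theorem pull_vars (h : Q ⟶ P) : (Ω : List T.ty.CTy) → pull h (vars P Ω) = vars Q Ω
  | [] => pull_unit h
  | [_] => pull_var h
  | A :: B :: Ω =>
    (pull_tens h (.left (.allRight (B :: Ω))) (var (A := A)) (vars P (B :: Ω))).trans
      (congrArg₂ (tens _) (pull_var h) (pull_vars h (B :: Ω)))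

/-- The value on the variables determines all other values, by substitution. -/
theorem app_pack {A : T.ty.CTy} {t : P ⟶ (coreCtx T Ω ⟶[SynH T] SynC.of A)}
    {g : CTm T.sig [P] Ω A} (h : app t (vars P Ω) = mk g) (ρ : CSub T.sig [P] Δ Ω) :
    app t (pack ρ) = mk (g.csub ρ) := by
  obtain ⟨t, rfl⟩ := SynH.mk_surj t
  exact mk_eq.2 (.csub (mk_eq.1 h) (.refl ρ))

theorem comp_eqToHom_of_app_vars {A : T.ty.CTy} {t : P ⟶ (coreCtx T Ω ⟶[SynH T] SynC.of A)}
    {g : CTm T.sig [P] Ω A} (h : app t (vars P Ω) = mk g)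
    (e : (coreCtx T Ω ⟶[SynH T] SynC.of A) = SynH.of (.proof (tensorTy Ω) A)) :
    t ≫ eqToHom e = SynH.mk (.promote g) := by
  -- With `coreCtx T Ω` replaced by a variable type `Y`, the equality of types can be eliminated;
  -- the claim is then density of the tensor product of the variables.
  have key {Y : T.ty.CTy} (hY : tensorTy Ω = Y) (v : CTm T.sig [P] Ω Y)
      (hv : HEq (CTm.tensVars Ω : CTm T.sig [P] Ω _) v)
      (t : P ⟶ SynH.of (.proof Y A)) (h : CCls.der (Γ := [P]) t (.mk v) = .mk g)
      (e : SynH.of (T := T) (.proof Y A) = SynH.of (.proof (tensorTy Ω) A)) :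
      t ≫ eqToHom e = SynH.mk (.promote g) := by
    subst hY
    obtain rfl := eq_of_heq hv
    refine (Category.comp_id t).trans ?_
    exact HCls.dense_tensVars Ω (h.trans (HCls.der_promote_tensVars (.mk g)).symm)
  exact key (coreCtx_eq T Ω) (varsTm Ω) (varsTm_heq Ω) t h e

/-- Promotion of a term in context. -/
noncomputable def promote {A : T.ty.CTy} (g : CTm T.sig [P] Ω A) :
    P ⟶ (coreCtx T Ω ⟶[SynH T] SynC.of A) :=
  HCls.mk (coreCtx_eq T Ω ▸ HTm.promote g)

theorem app_promote {A : T.ty.CTy} (g : CTm T.sig [P] Ω A) : app (promote g) (vars P Ω) = mk g := by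
  have key {Y : T.ty.CTy} (hY : tensorTy Ω = Y) (v : CTm T.sig [P] Ω Y)
      (hv : HEq (CTm.tensVars Ω : CTm T.sig [P] Ω _) v) :
      CCls.der (Γ := [P]) (HCls.mk (hY ▸ HTm.promote g)) (.mk v) = .mk g := by
    subst hY
    obtain rfl := eq_of_heq hv
    exact HCls.der_promote_tensVars (.mk g)
  exact key (coreCtx_eq T Ω) (varsTm Ω) (varsTm_heq Ω)

theorem ext_vars {A : T.ty.CTy} {s t : P ⟶ (coreCtx T Ω ⟶[SynH T] SynC.of A)}
    (h : app s (vars P Ω) = app t (vars P Ω)) : s = t := by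
  have key {Y : T.ty.CTy} (hY : tensorTy Ω = Y) (v : CTm T.sig [P] Ω Y)
      (hv : HEq (CTm.tensVars Ω : CTm T.sig [P] Ω _) v)
      (s t : HCls T [P] (.proof Y A)) (h : CCls.der s (.mk v) = CCls.der t (.mk v)) : s = t := by
    subst hY
    obtain rfl := eq_of_heq hv
    exact HCls.dense_tensVars Ω h
  exact key (coreCtx_eq T Ω) (varsTm Ω) (varsTm_heq Ω) s t h

end El

end Contexts

-- The syntactic model and completeness

section SyntacticModel

variable {T : Theory.{u}}

/-- The tuple of a list of host terms. -/
noncomputable def tupleTm {Δ : List T.ty.HTy} : (Γ : List T.ty.HTy) → HSub T.sig Δ Γ →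
    HTm T.sig Δ (hostCtx T Γ)
  | [], _ => .unit
  | X :: Γ, σ => .pair (σ X .z) (tupleTm Γ fun Y y => σ Y (.s y))

/-- The components of the variable of the product of a host context. -/
noncomputable def projTm : {Γ : List T.ty.HTy} → {X : T.ty.HTy} → HVar Γ X →
    HTm T.sig [hostCtx T Γ] X
  | _ :: Γ, X, .z => .fst (X := X) (Y := hostCtx T Γ) (.var .z)
  | Y :: Γ, _, .s x => (projTm x).sub (.single (.snd (X := Y) (Y := hostCtx T Γ) (.var .z)))

/-- The components of the variable of the product of a host context. -/
noncomputable def projSub (Γ : List T.ty.HTy) : HSub T.sig [hostCtx T Γ] Γ := fun _ x => projTm x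

theorem CSub.id_hsub {Θ : TySys.{u}} {S : TmSig Θ} {Γ Δ : List Θ.HTy} (σ : HSub S Δ Γ) :
    (Ω : List Θ.CTy) → (CSub.id Ω : CSub S Γ Ω Ω).hsub σ = .id Ω
  | [] => by rw [CSub.id, CSub.hsub]; rfl
  | A :: Ω => by
    rw [CSub.id, CSub.lift, CSub.hsub, CTm.hsub, CSub.id_hsub σ Ω]
    rfl

theorem projVar_eq {Γ : List T.ty.HTy} {X : T.ty.HTy} (x : HVar Γ X) :
    projVar (SynH.of (T := T)) x = SynH.mk (projTm x) := by
  induction x with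
  | z => rfl
  | s x ih => exact congrArg (SynH.mk _ ≫ ·) ih

theorem tuple_eq {P : T.ty.HTy} : (Γ : List T.ty.HTy) → (σ : HSub T.sig [P] Γ) →
    tuple (SynH.of (T := T)) Γ (fun X x => SynH.mk (σ X x)) = SynH.mk (tupleTm Γ σ)
  | [], _ => rfl
  | X :: Γ, σ => congrArg (lift (SynH.mk (σ X .z))) (tuple_eq Γ fun Y y => σ Y (.s y))

theorem projTm_tupleTm {Δ Γ : List T.ty.HTy} {X : T.ty.HTy} (x : HVar Γ X)
    (σ : HSub T.sig Δ Γ) : T.HEqn ((projTm x).sub (.single (tupleTm Γ σ))) (σ X x) := by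
  induction x with
  | z => exact .fst_pair _ _
  | s x ih =>
    refine .trans (.of_eq (HTm.sub_single_sub _ _ _)) ?_
    exact .trans (.sub_single _ (.snd_pair _ _)) (ih fun Y y => σ Y (.s y))

variable (T) in
/-- The interpretation of the types and terms of a theory by themselves. -/
noncomputable def synInterp : Interp (SynH T) (SynC T) T.sig where
  hObj := SynH.of
  cObj := SynC.of
  hObj_unit := rfl
  hObj_prod _ _ := rfl
  hObj_arr _ _ := rfl
  hObj_proof _ _ := rfl
  cObj_unit := rfl
  cObj_tens _ _ := rfl
  hSym k := SynH.mk (.sym k (projSub _))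
  cSym k := El.promote (.sym k (projSub _) (.id _))

/-- The binder case of the interpretation: after `β`-reduction, the lifted projections out of `Γ`
become the projections out of the extended context. -/
theorem projSub_cons (X : T.ty.HTy) (Γ : List T.ty.HTy) :
    (((projSub Γ).lift X).comp ((HSub.single (.snd (X := X) (Y := hostCtx T Γ) (.var .z))).lift
      X)).comp (.cons (.fst (X := X) (Y := hostCtx T Γ) (.var .z)) (.id _)) =
    projSub (T := T) (X :: Γ) := by
  refine HSub.ext_cons rfl fun Y y => ?_
  refine (HTm.sub_sub _ _ _).trans ((HTm.ren_sub _ _ _).trans ?_)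
  exact congrArg (projTm y).sub (HSub.eq_single _)

theorem curry_mk {X P Y : T.ty.HTy} (t : HTm T.sig [.prod X P] Y) (u : HTm T.sig [X, P] Y)
    (h : T.HEqn ((u.sub ((HSub.single (.snd (.var .z))).lift X)).sub
      (.cons (.fst (.var .z)) (.id [.prod X P]))) t) :
    MonoidalClosed.curry (A := SynH.of X) (Y := SynH.of P) (X := SynH.of Y) (SynH.mk t) =
      SynH.mk (.lam u) := by
  refine (MonoidalClosed.curry_eq_iff _ _).2 (Eq.symm ?_)
  refine (congrArg₂ (· ≫ ·) (SynH.whiskerLeft_mk (HTm.lam u)) (SynH.ev_eq X Y)).trans ?_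
  exact SynH.mk_eq.2 (.trans (.app (.snd_pair _ _) (.fst_pair _ _)) (.trans (.app_lam _ _) h))

namespace El

variable {P : SynH T} {Ω Ω₁ Ω₂ : List T.ty.CTy}

/-- The common shape of the interpretations of `f ⊗ g`, of both forms of `let`, and of a nonempty
list of terms. -/
theorem app_split_par {A A₁ A₂ B₁ B₂ D : SynC T} {s : A ⟶ A₁ ⊗ A₂} {f : P ⟶ (A₁ ⟶[SynH T] B₁)}
    {g : P ⟶ (A₂ ⟶[SynH T] B₂)} (r : P ⟶ ((B₁ ⊗ B₂) ⟶[SynH T] D)) {p : Split Ω Ω₁ Ω₂}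
    {v : El P Ω A} {x : El P Ω₁ A₁} {y : El P Ω₂ A₂} {x' : El P Ω₁ B₁} {y' : El P Ω₂ B₂}
    (hs : app (eConst s) v = tens p x y) (hf : app f x = x') (hg : app g y = y') :
    app (eSeq (eConst s) (eSeq (ePar f g) r)) v = app r (tens p x' y') := by
  rw [app_eSeq, hs, app_eSeq, app_ePar, hf, hg]

theorem app_letT_hom (A B : T.ty.CTy) (Ω : List T.ty.CTy) :
    app (eConst (𝟙 (SynC.of A ⊗ SynC.of B) ▷ coreCtx T Ω ≫
      (α_ (SynC.of A) (SynC.of B) (coreCtx T Ω)).hom ≫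
        SynC.of A ◁ (consIso (SynC.of (T := T)) B Ω).inv ≫
          (consIso (SynC.of (T := T)) A (B :: Ω)).inv))
      (tens (.left (.left (.allRight Ω))) (tens (.left (.right .nil)) var var) (vars P Ω)) =
    vars P (A :: B :: Ω) := by
  have h : (Split.left (a := A) (.right (a := B) (.allRight Ω))).assoc (.left (.allRight Ω)) =
      ⟨[A, B], .left (.left (.allRight Ω)), .left (.right .nil)⟩ := by
    rw [Split.assoc, Split.assoc, Split.allRight_assoc]
    rfl
  rw [id_whiskerRight, Category.id_comp, app_comp, app_comp, app_associator _ _ _ _ _ _ _ h,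
    app_whiskerLeft, app_consIso_inv_vars]
  exact app_consIso_inv_vars A (B :: Ω)

theorem app_letU_hom (Ω : List T.ty.CTy) :
    app (eConst (𝟙 (𝟙_ (SynC T)) ▷ coreCtx T Ω ≫ (λ_ (coreCtx T Ω)).hom))
      (tens (.allRight Ω) unit (vars P Ω)) = vars P Ω := by
  rw [id_whiskerRight, Category.id_comp, app_leftUnitor]

end El

-- Simultaneous induction on terms. A core term is described by its value on the tensor product of
-- its variables rather than as a promotion: values are computed by the rules for `app`, and by
-- density they determine the morphism.
mutual
theorem synInterp_hTm {Γ : List T.ty.HTy} {X : T.ty.HTy} : (t : HTm T.sig Γ X) →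
    (synInterp T).hTm t = SynH.mk (t.sub (projSub Γ))
  | .var x => by rw [Interp.hTm]; exact projVar_eq x
  | .sym k σ => by
    rw [Interp.hTm]
    have h : (fun X x => (synInterp T).hTm (σ X x)) =
        fun X x => SynH.mk ((σ X x).sub (projSub Γ)) :=
      funext fun X => funext fun x => synInterp_hTm (σ X x)
    refine (congrArg (tuple _ _ · ≫ _) h).trans ?_
    refine (congrArg (· ≫ _) (tuple_eq _ fun X x => (σ X x).sub (projSub Γ))).trans ?_
    exact SynH.mk_eq.2 (.sym k fun Y x => projTm_tupleTm x _)
  | .unit => by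
    rw [Interp.hTm]; exact Category.comp_id _
  | .pair s t => by
    rw [Interp.hTm, synInterp_hTm s, synInterp_hTm t]; exact Category.comp_id _
  | .fst t => by
    rw [Interp.hTm, synInterp_hTm t]; exact congrArg (_ ≫ ·) (Category.id_comp _)
  | .snd t => by
    rw [Interp.hTm, synInterp_hTm t]; exact congrArg (_ ≫ ·) (Category.id_comp _)
  | .lam t => by
    rw [Interp.hTm, synInterp_hTm t]
    refine (Category.comp_id _).trans (curry_mk _ _ (.of_eq ?_))
    exact (congrArg (HTm.sub · _) (t.sub_sub _ _)).trans ((t.sub_sub _ _).trans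
      (congrArg t.sub (projSub_cons _ Γ)))
  | .app t s => by
    rw [Interp.hTm, synInterp_hTm t, synInterp_hTm s]
    refine (congrArg (lift _ · ≫ _) (Category.comp_id _)).trans ?_
    exact SynH.mk_eq.2 (.app (.snd_pair _ _) (.fst_pair _ _))
  | .promote f => by
    rw [Interp.hTm]
    exact El.comp_eqToHom_of_app_vars (synInterp_cTm f) _
theorem synInterp_cTm {Γ : List T.ty.HTy} {Ω : List T.ty.CTy} {A : T.ty.CTy} :
    (f : CTm T.sig Γ Ω A) →
    El.app ((synInterp T).cTm f) (El.vars (hostCtx T Γ) Ω) = El.mk (f.hsub (projSub Γ))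
  | .var => by
    rw [Interp.cTm]
    exact (congrArg (El.app · El.var) (eConst_id _).symm).trans (El.app_one _)
  | .sym k σ τ => by
    rw [Interp.cTm]
    have h : (fun X x => (synInterp T).hTm (σ X x)) =
        fun X x => SynH.mk ((σ X x).sub (projSub Γ)) :=
      funext fun X => funext fun x => synInterp_hTm (σ X x)
    have h' : tuple (SynH.of (T := T)) _ (fun X x => (synInterp T).hTm (σ X x)) =
        SynH.mk (tupleTm _ fun X x => (σ X x).sub (projSub Γ)) :=
      (congrArg (tuple _ _) h).trans (tuple_eq _ _)
    refine (El.app_eSeq _ _ _).trans ((congrArg₂ El.app (congrArg (· ≫ _) h')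
      (synInterp_cSub τ)).trans ?_)
    refine (El.app_pack (g := .sym k (fun X x => (σ X x).sub (projSub Γ)) (.id _)) ?_ _).trans ?_
    -- The symbol is evaluated on the variables over its own host context, and the result is pulled
    -- back along the tuple of its host arguments.
    · refine (congrArg (El.app _) (El.pull_vars (SynH.mk (tupleTm _ fun X x =>
        (σ X x).sub (projSub Γ))) _).symm).trans ?_
      refine (El.pull_app _ _ _).symm.trans ((congrArg (El.pull _) (El.app_promote _)).trans ?_)
      refine El.mk_eq.2 (.sym k (fun Y x => projTm_tupleTm x _) ?_)
      rw [CSub.id_hsub]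
      exact .refl _
    · rw [CTm.csub, CSub.id_csub]
      rfl
  | .unit => by
    rw [Interp.cTm]
    exact El.app_one _
  | .tens p f g => by
    rw [Interp.cTm]
    exact (El.app_split_par _ (El.app_splitHom p) (synInterp_cTm f) (synInterp_cTm g)).trans
      (El.app_one _)
  | .letT (Ω₂ := Ω₂) p f h => by
    rw [Interp.cTm]
    refine (El.app_split_par _ (El.app_splitHom p) (synInterp_cTm f) (El.app_one _)).trans ?_
    refine HCls.letT_of_der _ p _ (varsTm Ω₂) (h.hsub (projSub Γ)) ?_
    exact (El.app_eSeq _ _ _).trans ((congrArg (El.app _) (El.app_letT_hom _ _ Ω₂)).trans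
      (synInterp_cTm h))
  | .letU (Ω₂ := Ω₂) p f h => by
    rw [Interp.cTm]
    refine (El.app_split_par _ (El.app_splitHom p) (synInterp_cTm f) (El.app_one _)).trans ?_
    refine HCls.letU_of_der _ p _ (varsTm Ω₂) (h.hsub (projSub Γ)) ?_
    exact (El.app_eSeq _ _ _).trans ((congrArg (El.app _) (El.app_letU_hom Ω₂)).trans
      (synInterp_cTm h))
  | .der t g => by
    rw [Interp.cTm, synInterp_hTm t]
    refine (El.app_eSeq _ _ _).trans ((congrArg₂ El.app (Category.comp_id _)
      (synInterp_cTm g)).trans ?_)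
    rfl
theorem synInterp_cSub {Γ : List T.ty.HTy} {Δ Ω : List T.ty.CTy} :
    (ρ : CSub T.sig Γ Δ Ω) →
    El.app ((synInterp T).cSub ρ) (El.vars (hostCtx T Γ) Δ) = El.pack (ρ.hsub (projSub Γ))
  | .nil => by
    rw [Interp.cSub]
    exact El.app_one _
  | .cons p f ρ => by
    rw [Interp.cSub]
    exact (El.app_split_par _ (El.app_splitHom p) (synInterp_cTm f) (synInterp_cSub ρ)).trans
      (El.app_consIso_inv _ _ _)
end

theorem projSub_comp_tupleTm {Γ : List T.ty.HTy} (Y : T.ty.HTy) (x : HVar Γ Y) :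
    T.HEqn ((projSub Γ).comp (.single (tupleTm Γ (.id Γ))) Y x) (HSub.id Γ Y x) :=
  projTm_tupleTm x _

/-- Substituting the tuple of the variables of `Γ` for the single variable of product type undoes
the replacement by components, up to derivable equality. Hence the interpretation reflects
equations. -/
theorem synInterp_hTm_eq {Γ : List T.ty.HTy} {X : T.ty.HTy} (s t : HTm T.sig Γ X) :
    (synInterp T).hTm s = (synInterp T).hTm t ↔ T.HEqn s t := by
  rw [synInterp_hTm, synInterp_hTm]
  refine SynH.mk_eq.trans ⟨fun h => ?_, fun h => .sub h fun _ _ => .refl _⟩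
  have e (t : HTm T.sig Γ X) :
      T.HEqn ((t.sub (projSub Γ)).sub (.single (tupleTm Γ (.id Γ)))) t := by
    rw [HTm.sub_sub]
    exact .trans (.sub (.refl t) projSub_comp_tupleTm) (.of_eq t.sub_id)
  exact (e s).symm.trans (.trans (.sub h fun _ _ => .refl _) (e t))

theorem synInterp_cTm_eq {Γ : List T.ty.HTy} {Ω : List T.ty.CTy} {A : T.ty.CTy}
    (f g : CTm T.sig Γ Ω A) : (synInterp T).cTm f = (synInterp T).cTm g ↔ T.CEqn f g := by
  have e (f : CTm T.sig Γ Ω A) :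
      T.CEqn ((f.hsub (projSub Γ)).hsub (.single (tupleTm Γ (.id Γ)))) f := by
    have h := Theory.CEqn.hsub (.refl f) (projSub_comp_tupleTm (T := T) (Γ := Γ))
    rwa [CTm.hsub_id, ← CTm.hsub_hsub] at h
  refine ⟨fun h => ?_, fun h => ?_⟩
  · have h := congrArg (fun m => El.app m (El.vars (hostCtx T Γ) Ω)) h
    have h := El.mk_eq.1 ((synInterp_cTm f).symm.trans (h.trans (synInterp_cTm g)))
    exact (e f).symm.trans (.trans (.hsub h fun _ _ => .refl _) (e g))
  · refine El.ext_vars ((synInterp_cTm f).trans (Eq.trans ?_ (synInterp_cTm g).symm))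
    exact El.mk_eq.2 (.hsub h fun _ _ => .refl _)

variable (T) in
theorem synInterp_isModel : (synInterp T).IsModel where
  hAx s t h := (synInterp_hTm_eq s t).2 (.ax h)
  cAx f g h := (synInterp_cTm_eq f g).2 (.ax h)

variable (T) in
theorem synInterp_isSyntactic : IsSyntactic T (synInterp T) where
  unit_eq := rfl
  prod_eq _ _ := rfl
  fst_eq _ _ := (Category.id_comp _).symm
  snd_eq _ _ := (Category.id_comp _).symm
  arr_eq _ _ := rfl
  ev_eq _ _ := (Category.id_comp _).symm
  hom_eq _ _ := rfl
  eId_eq _ := ((Category.id_comp _).trans (Category.comp_id _)).symm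
  eComp_eq _ _ _ := ((Category.id_comp _).trans (Category.comp_id _)).symm
  coreUnit_eq := rfl
  tens_eq _ _ := rfl
  eTensor_eq _ _ _ _ := ((Category.id_comp _).trans (Category.comp_id _)).symm
  hObj_eq _ := rfl
  cObj_eq _ := rfl
  hTm_eq X Y t := by
    -- The context `[X]` is interpreted by `X × 1` and its variable by the first projection, which
    -- is the right unitor.
    refine (synInterp_hTm t).trans ?_
    refine (congrArg SynH.mk (congrArg t.sub (HSub.eq_single _))).trans ?_
    refine Eq.trans ?_ (congrArg ((ρ_ (SynH.of X)).hom ≫ ·)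
      ((Category.id_comp _).trans (Category.comp_id _)).symm)
    exact (congrArg (· ≫ SynH.mk t) (rightUnitor_hom (SynH.of X))).symm

end SyntacticModel

end HC

theorem mainTheorem2 (T : HC.Theory.{u}) :
    -- soundness
    (∀ (H : Type u₁) [Category.{v₁} H] [CartesianMonoidalCategory H] [BraidedCategory H]
        [MonoidalClosed H] (C : Type u₂) [Category.{v₂} C] [MonoidalCategory C]
        [SymmetricCategory C] [EnrichedSymmetricMonoidal H C] (I : HC.Interp H C T.sig),
        I.IsModel →
          (∀ {Γ : List T.ty.HTy} {X : T.ty.HTy} (s t : HC.HTm T.sig Γ X),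
            T.HEqn s t → I.hTm s = I.hTm t) ∧
          (∀ {Γ : List T.ty.HTy} {Ω : List T.ty.CTy} {A : T.ty.CTy} (f g : HC.CTm T.sig Γ Ω A),
            T.CEqn f g → I.cTm f = I.cTm g)) ∧
    -- completeness: an equation that holds in all models is derivable
    (∀ {Γ : List T.ty.HTy} {X : T.ty.HTy} (s t : HC.HTm T.sig Γ X),
      (∀ (H : Type u) [Category.{u} H] [CartesianMonoidalCategory H] [BraidedCategory H]
        [MonoidalClosed H] (C : Type u) [Category.{u} C] [MonoidalCategory C]
        [SymmetricCategory C] [EnrichedSymmetricMonoidal H C] (I : HC.Interp H C T.sig),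
        I.IsModel → I.hTm s = I.hTm t) → T.HEqn s t) ∧
    (∀ {Γ : List T.ty.HTy} {Ω : List T.ty.CTy} {A : T.ty.CTy} (f g : HC.CTm T.sig Γ Ω A),
      (∀ (H : Type u) [Category.{u} H] [CartesianMonoidalCategory H] [BraidedCategory H]
        [MonoidalClosed H] (C : Type u) [Category.{u} C] [MonoidalCategory C]
        [SymmetricCategory C] [EnrichedSymmetricMonoidal H C] (I : HC.Interp H C T.sig),
        I.IsModel → I.cTm f = I.cTm g) → T.CEqn f g) ∧
    -- the syntactic model, in which exactly the derivable equations hold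
    ∃ (_ : CartesianMonoidalCategory (HC.SynH T)) (_ : BraidedCategory (HC.SynH T))
      (_ : MonoidalClosed (HC.SynH T)) (_ : Category.{u} (HC.SynC T))
      (_ : MonoidalCategory (HC.SynC T)) (_ : SymmetricCategory (HC.SynC T))
      (_ : EnrichedSymmetricMonoidal (HC.SynH T) (HC.SynC T))
      (G : HC.Interp (HC.SynH T) (HC.SynC T) T.sig),
      HC.IsSyntactic T G ∧ G.IsModel ∧
        (∀ {Γ : List T.ty.HTy} {X : T.ty.HTy} (s t : HC.HTm T.sig Γ X),
          G.hTm s = G.hTm t ↔ T.HEqn s t) ∧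
        (∀ {Γ : List T.ty.HTy} {Ω : List T.ty.CTy} {A : T.ty.CTy} (f g : HC.CTm T.sig Γ Ω A),
          G.cTm f = G.cTm g ↔ T.CEqn f g) := by
  refine ⟨?_, ?_, ?_, ?_⟩
  · intro H _ _ _ _ C _ _ _ _ I hI
    exact ⟨fun s t h => hI.hTm_eq h, fun f g h => hI.cTm_eq h⟩
  · intro Γ X s t h
    exact (HC.synInterp_hTm_eq s t).1 (h _ _ _ (HC.synInterp_isModel T))
  · intro Γ Ω A f g h
    exact (HC.synInterp_cTm_eq f g).1 (h _ _ _ (HC.synInterp_isModel T))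
  · exact ⟨_, _, _, _, _, _, _, HC.synInterp T, HC.synInterp_isSyntactic T, HC.synInterp_isModel T,
      HC.synInterp_hTm_eq, HC.synInterp_cTm_eq⟩
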